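/- Let $n\ge 2$. The partition monoid $\mathcal P_n$ consists of all set partitions of $\{1,\dots,n\}\cup\{1',\dots,n'\}$ (upper and lower vertices), with the product $\alpha\beta$ obtained by stacking $\alpha$ on top of $\beta$, identifying the lower vertices of $\alpha$ with the upper vertices of $\beta$, taking connected components, and restricting to the two outer rows; $\alpha^*$ is $\alpha$ with the two rows interchanged, and $\operatorname{rank}(\alpha)$ is the number of blocks meeting both rows. The kernel (cokernel) of $\alpha$ is the equivalence relation that $\alpha$ induces on the upper (lower) row. Let $S$ be either the planar partition monoid $\mathcal{PP}_n$ (the partitions that can be drawn without crossings inside the rectangle with upper row $1,\dots,n$ and lower row $1',\dots,n'$, i.e. those that are non-crossing for the cyclic order $1,\dots,n,n',\dots,1'$) or the Motzkin monoid $\mathcal M_n$ (the elements of $\mathcal{PP}_n$ all of whose blocks have size at most $2$). Put $I_q=\{\alpha\in S:\operatorname{rank}(\alpha)\le q\}$, and let $\overline{\mathrm{id}}_q\in S$ be the partition with transversals $\{1,1'\},\dots,\{q,q'\}$ and all other blocks singletons. Let $M$ be the minimal ideal of $S$. A retraction of an ideal $I$ is a homomorphism $f:I\to M$ fixing $M$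 pointwise; $I$ is retractable if there is one. An IN-pair is a pair $(I,N)$ where $I$ is an ideal and $N$ is a normal subgroup of a maximal subgroup of $S$ contained in a $\mathscr J$-class $J$ that is stable (for $x\in J$, $a\in S$: $xa\,\mathscr J\,x\Rightarrow xa\,\mathscr R\,x$ and $ax\,\mathscr J\,x\Rightarrow ax\,\mathscr L\,x$), regular, and minimal among the $\mathscr J$-classes in $S\setminus I$. It is retractable if $I$ is retractable and $|xN|=|Nx|=1$ for all $x\in M$. Let $\nu_N=\{(sxt,syt): x,y\in N,\ s,t\in S\}\cap(J\times J)$ and $\Delta=\{(x,x):x\in S\}$. For an ideal $I$ let $R_I=\Delta\cup(I\times I)$, and for a retractable IN-pair $(I,N)$, with $f$ the retraction of $I$, let $\lambda_{I,N}$, $\rho_{I,N}$, $\mu_{I,N}$ be $\Delta\cup\nu_N\cup\{(x,y)\in I\times I: f(x)\mathrel{\mathscr K} f(y)\}$ with $\mathscr K=\mathscr L,\mathscr R,\mathscr H$ (Green's relations of $S$), respectively. Then: (i) The ideals of $S$ are exactly $I_0,\dots,I_n$; write $R_q=R_{I_q}$. (ii) The retractable IN-pairs of $S$ are exactly the pairs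 $(I_i,\{\varepsilon\})$ with $i\in\{0,1\}$ and $\varepsilon$ an idempotent of rank $i+1$; thus, with the maximal subgroup in rank $i+1$ chosen to be $\{\overline{\mathrm{id}}_{i+1}\}$, they are $(I_0,\{\overline{\mathrm{id}}_1\})$ and $(I_1,\{\overline{\mathrm{id}}_2\})$. A retraction of $I_i$ ($i=0,1$) maps $\alpha$ to the partition of rank $0$ with the same kernel and cokernel. Let $\lambda_i,\rho_i,\mu_i$ be the relations $\lambda,\rho,\mu$ associated with $(I_i,\{\overline{\mathrm{id}}_{i+1}\})$. (iii) The $n+7$ relations $R_0,\dots,R_n,\lambda_0,\rho_0,\mu_0,\lambda_1,\rho_1,\mu_1$ are pairwise distinct congruences of $S$, and every congruence of $S$ is one of them. (iv) The $*$-congruences of $S$ (the congruences $\xi$ with $(\alpha,\beta)\in\xi\Rightarrow(\alpha^*,\beta^*)\in\xi$) are exactly the same congruences with $\lambda_0,\lambda_1,\rho_0,\rho_1$ excluded. (v) The covering relations of the congruence lattice of $S$ (write $\xi\lessdot\zeta$ if $\zeta$ covers $\xi$) are exactly: $\mu_i\lessdot\lambda_i\lessdot R_i$ and $\mu_i\lessdot\rho_i\lessdot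 R_i$ for $i=0,1$; $\mu_0\lessdot\mu_1$, $\lambda_0\lessdot\lambda_1$, $\rho_0\lessdot\rho_1$; and $R_q\lessdot R_{q+1}$ for $0\le q<n$. Here $\mu_0=\Delta$ and $R_n=S\times S$. The covering relations of the lattice of $*$-congruences are exactly: $\mu_0\lessdot\mu_1$; $\mu_i\lessdot R_i$ for $i=0,1$; and $R_q\lessdot R_{q+1}$ for $0\le q<n$. Every congruence of $S$ is principal, i.e. generated by a single pair. -/

import Mathlib

/-! ### Green's relations, ideals, retractions and IN-pairs of a monoid -/

namespace MonoidCong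

variable {S : Type*} [Monoid S]

/-- Green's relation `R`: equality of the principal right ideals `aS` and `bS`. -/
def GreenR (a b : S) : Prop := {x : S | ∃ s, x = a * s} = {x : S | ∃ s, x = b * s}

/-- Green's relation `L`: equality of the principal left ideals `Sa` and `Sb`. -/
def GreenL (a b : S) : Prop := {x : S | ∃ s, x = s * a} = {x : S | ∃ s, x = s * b}

/-- Green's relation `J`: equality of the principal two-sided ideals `SaS` and `SbS`. -/
def GreenJ (a b : S) : Prop :=
  {x : S | ∃ s t, x = s * a * t} = {x : S | ∃ s t, x = s * b * t}

/-- Green's relation `H`, the intersection of `R` and `L`. -/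
def GreenH (a b : S) : Prop := GreenR a b ∧ GreenL a b

/-- The order on `J`-classes: `J_a ≤ J_b` if and only if `a ∈ SbS`. -/
def JLE (a b : S) : Prop := ∃ s t, a = s * b * t

/-- A (non-empty, two-sided) ideal. -/
def IsIdeal (I : Set S) : Prop := I.Nonempty ∧ ∀ x ∈ I, ∀ a : S, a * x ∈ I ∧ x * a ∈ I

/-- The intersection of all ideals of `S`. If `S` has a minimal ideal (for example if `S` is
finite), then this is the minimal ideal. -/
def minimalIdeal (S : Type*) [Monoid S] : Set S := {x | ∀ I : Set S, IsIdeal I → x ∈ I}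

/-- `f`, restricted to the ideal `I`, is a retraction of `I` onto the minimal ideal of `S`: a
semigroup homomorphism that fixes the minimal ideal pointwise. (The values of `f` outside `I` are
irrelevant.) -/
structure IsRetraction (I : Set S) (f : S → S) : Prop where
  maps : ∀ x ∈ I, f x ∈ minimalIdeal S
  map_mul : ∀ x ∈ I, ∀ y ∈ I, f (x * y) = f x * f y
  fixes : ∀ x ∈ minimalIdeal S, f x = x

/-- The Rees congruence (as a relation) of an ideal `I`. -/
def reesRel (I : Set S) (x y : S) : Prop := x = y ∨ (x ∈ I ∧ y ∈ I)

/-- The `J`-class of `e`. -/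
def jClass (e : S) : Set S := {x | GreenJ x e}

/-- Stability of a `J`-class. -/
def IsStable (J : Set S) : Prop :=
  ∀ x ∈ J, ∀ a : S, (GreenJ (x * a) x → GreenR (x * a) x) ∧ (GreenJ (a * x) x → GreenL (a * x) x)

/-- Every element of `J` is (von Neumann) regular in `S`. -/
def IsRegular (J : Set S) : Prop := ∀ x ∈ J, ∃ y : S, x = x * y * x

/-- `N` is a normal subgroup of the maximal subgroup of `S` with identity `e`, that is, of the
`H`-class of the idempotent `e`. -/
structure IsNormalSubgroupAt (e : S) (N : Set S) : Prop where
  idem : e * e = e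
  subset : ∀ x ∈ N, GreenH x e
  one_mem : e ∈ N
  mul_mem : ∀ x ∈ N, ∀ y ∈ N, x * y ∈ N
  inv_mem : ∀ x ∈ N, ∃ y ∈ N, x * y = e ∧ y * x = e
  conj_mem : ∀ x ∈ N, ∀ g h : S, GreenH g e → GreenH h e → g * h = e → h * g = e → g * x * h ∈ N

/-- `(I, N)` is an IN-pair: `I` is an ideal, and `N` is a normal subgroup of a maximal subgroup
contained in a stable regular `J`-class that is minimal among the `J`-classes in `S \ I`. -/
def IsINPair (I N : Set S) : Prop :=
  IsIdeal I ∧ ∃ e : S, IsNormalSubgroupAt e N ∧ IsStable (jClass e) ∧ IsRegular (jClass e) ∧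
    e ∉ I ∧ ∀ x, x ∉ I → JLE x e → GreenJ x e

/-- A retractable IN-pair: `I` is retractable, and all elements of `N` act in the same way on the
minimal ideal. -/
def IsRetractableINPair (I N : Set S) : Prop :=
  IsINPair I N ∧ (∃ f, IsRetraction I f) ∧
    ∀ x ∈ minimalIdeal S, (∃ y, {z | ∃ u ∈ N, z = x * u} = {y}) ∧ ∃ y, {z | ∃ u ∈ N, z = u * x} = {y}

/-- The relation `ν_N = S(N × N)S ∩ (J × J)`, where `J` is the `J`-class containing `N`. -/
def nuRel (N : Set S) (u v : S) : Prop :=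
  ∃ x ∈ N, ∃ y ∈ N, ∃ s t : S, u = s * x * t ∧ v = s * y * t ∧ GreenJ u x ∧ GreenJ v x

/-- The relation `Δ ∪ ν_N ∪ {(x, y) ∈ I × I : (f x, f y) ∈ ξ}`, where `f` is the retraction of `I`
onto the minimal ideal. -/
def zetaRel (I N : Set S) (ξ : S → S → Prop) (x y : S) : Prop :=
  x = y ∨ nuRel N x y ∨ (x ∈ I ∧ y ∈ I ∧ ∃ f, IsRetraction I f ∧ ξ (f x) (f y))

/-- The relation `λ_{I,N}`. -/
def lamRel (I N : Set S) : S → S → Prop := zetaRel I N GreenL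

/-- The relation `ρ_{I,N}`. -/
def rhoRel (I N : Set S) : S → S → Prop := zetaRel I N GreenR

/-- The relation `μ_{I,N}`. -/
def muRel (I N : Set S) : S → S → Prop := zetaRel I N GreenH

end MonoidCong

/-! ### The partition monoid -/

/-- A set partition of `{1, …, n} ∪ {1', …, n'}`, given by the equivalence relation "in the same
block"; `Sum.inl i` is an upper vertex, `Sum.inr i` is a lower (dashed) vertex. -/
@[ext] structure PartitionMonoid (n : ℕ) where
  rel : Setoid (Fin n ⊕ Fin n)

namespace PartitionMonoid

variable {n : ℕ}

/-- The vertices of the product graph of two partitions: three rows of `n` vertices. -/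
inductive Vertex (n : ℕ) : Type
  | top (i : Fin n)
  | mid (i : Fin n)
  | bot (i : Fin n)

/-- The vertices of the first factor inside the product graph. -/
def inUpper : Fin n ⊕ Fin n → Vertex n := Sum.elim Vertex.top Vertex.mid

/-- The vertices of the second factor inside the product graph. -/
def inLower : Fin n ⊕ Fin n → Vertex n := Sum.elim Vertex.mid Vertex.bot

/-- The vertices of the product inside the product graph. -/
def inOuter : Fin n ⊕ Fin n → Vertex n := Sum.elim Vertex.top Vertex.bot

/-- Adjacency in the product graph of `α` and `β`. -/
inductive ProductEdge (α β : PartitionMonoid n) : Vertex n → Vertex n → Prop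
  | upper (x y : Fin n ⊕ Fin n) (h : α.rel x y) : ProductEdge α β (inUpper x) (inUpper y)
  | lower (x y : Fin n ⊕ Fin n) (h : β.rel x y) : ProductEdge α β (inLower x) (inLower y)

theorem ProductEdge.symm {α β : PartitionMonoid n} {u v : Vertex n} (h : ProductEdge α β u v) :
    ProductEdge α β v u := by
  cases h with
  | upper x y h => exact .upper _ _ (α.rel.symm h)
  | lower x y h => exact .lower _ _ (β.rel.symm h)

/-- Two vertices of the product graph are connected by a path. -/
def Joined (α β : PartitionMonoid n) : Vertex n → Vertex n → Prop :=
  Relation.ReflTransGen (ProductEdge α β)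

theorem Joined.symm {α β : PartitionMonoid n} {u v : Vertex n} (h : Joined α β u v) :
    Joined α β v u :=
  haveI : Std.Symm (ProductEdge α β) := ⟨fun _ _ h => h.symm⟩
  Relation.ReflTransGen.stdSymm.symm _ _ h

/-- The product: `x` and `y` are in the same block of `αβ` if and only if they are connected by a
path in the product graph. -/
instance : Mul (PartitionMonoid n) where
  mul α β :=
    { rel :=
        { r := fun x y => Joined α β (inOuter x) (inOuter y)
          iseqv := ⟨fun _ => .refl, fun h => h.symm, fun h k => h.trans k⟩ } }

/-- The identity partition, with blocks `{i, i'}`. -/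
instance : One (PartitionMonoid n) where
  one := { rel := Setoid.ker (Sum.elim id id) }

theorem mul_rel {α β : PartitionMonoid n} {x y : Fin n ⊕ Fin n} :
    (α * β).rel x y ↔ Joined α β (inOuter x) (inOuter y) := Iff.rfl

theorem one_rel {x y : Fin n ⊕ Fin n} :
    (1 : PartitionMonoid n).rel x y ↔ Sum.elim id id x = Sum.elim id id y := Iff.rfl

/-- A pair of subsets of the two rows whose union is a union of blocks. -/
def Saturated (α : PartitionMonoid n) (f g : Fin n → Prop) : Prop :=
  ∀ x y, α.rel x y → (Sum.elim f g x ↔ Sum.elim f g y)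

theorem rel_iff_saturated {α : PartitionMonoid n} {x y : Fin n ⊕ Fin n} :
    α.rel x y ↔ ∀ f g, Saturated α f g → (Sum.elim f g x ↔ Sum.elim f g y) := by
  refine ⟨fun h f g hs => hs x y h, fun h => ?_⟩
  have key : ∀ z, Sum.elim (fun i => α.rel x (Sum.inl i)) (fun i => α.rel x (Sum.inr i)) z ↔
      α.rel x z := by
    intro z; cases z <;> rfl
  have := h (fun i => α.rel x (Sum.inl i)) (fun i => α.rel x (Sum.inr i)) (by
    intro a b hab
    rw [key, key]
    exact ⟨fun h => α.rel.trans h hab, fun h => α.rel.trans h (α.rel.symm hab)⟩)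
  rw [key, key] at this
  exact this.1 (α.rel.refl x)

theorem ext_saturated {α β : PartitionMonoid n}
    (h : ∀ f g, Saturated α f g ↔ Saturated β f g) : α = β := by
  ext x y
  rw [rel_iff_saturated, rel_iff_saturated]
  simp only [h]

theorem saturated_mul {α β : PartitionMonoid n} {f g : Fin n → Prop} :
    Saturated (α * β) f g ↔ ∃ m, Saturated α f m ∧ Saturated β m g := by
  constructor
  · intro h
    let k : Vertex n → Prop := fun v => ∃ y, Joined α β (inOuter y) v ∧ Sum.elim f g y
    have hk : ∀ u v, ProductEdge α β u v → (k u ↔ k v) := by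
      intro u v huv
      constructor
      · rintro ⟨y, hy, h⟩; exact ⟨y, hy.tail huv, h⟩
      · rintro ⟨y, hy, h⟩; exact ⟨y, hy.tail huv.symm, h⟩
    have ho : ∀ x, k (inOuter x) ↔ Sum.elim f g x := by
      intro x
      constructor
      · rintro ⟨y, hy, h'⟩; exact (h y x hy).1 h'
      · intro h'; exact ⟨x, .refl, h'⟩
    refine ⟨fun i => k (.mid i), ?_, ?_⟩
    · have e : ∀ x, Sum.elim f (fun i => k (.mid i)) x ↔ k (inUpper x) := by
        rintro (i | i)
        · exact (ho (.inl i)).symm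
        · rfl
      intro x y hxy
      rw [e, e]; exact hk _ _ (.upper x y hxy)
    · have e : ∀ x, Sum.elim (fun i => k (.mid i)) g x ↔ k (inLower x) := by
        rintro (i | i)
        · rfl
        · exact (ho (.inr i)).symm
      intro x y hxy
      rw [e, e]; exact hk _ _ (.lower x y hxy)
  · rintro ⟨m, h1, h2⟩
    let k : Vertex n → Prop := fun v => match v with
      | .top i => f i
      | .mid i => m i
      | .bot i => g i
    have e1 : ∀ x, k (inUpper x) ↔ Sum.elim f m x := by rintro (i | i) <;> rfl
    have e2 : ∀ x, k (inLower x) ↔ Sum.elim m g x := by rintro (i | i) <;> rfl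
    have e3 : ∀ x, k (inOuter x) ↔ Sum.elim f g x := by rintro (i | i) <;> rfl
    have hk : ∀ u v, Joined α β u v → (k u ↔ k v) := by
      intro u v huv
      induction huv with
      | refl => rfl
      | tail _ h ih =>
        rw [ih]
        cases h with
        | upper x y h => rw [e1, e1]; exact h1 x y h
        | lower x y h => rw [e2, e2]; exact h2 x y h
    intro x y hxy
    rw [← e3, ← e3]; exact hk _ _ hxy

theorem saturated_one {f g : Fin n → Prop} :
    Saturated (1 : PartitionMonoid n) f g ↔ f = g := by
  constructor
  · intro h; funext i; exact propext (h (.inl i) (.inr i) rfl)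
  · rintro rfl x y h
    have h' : Sum.elim id id x = Sum.elim id id y := h
    cases x <;> cases y <;> simp_all

instance : Monoid (PartitionMonoid n) where
  mul_assoc α β γ := ext_saturated fun f g => by
    simp only [saturated_mul]
    constructor
    · rintro ⟨m, ⟨k, h1, h2⟩, h3⟩; exact ⟨k, h1, m, h2, h3⟩
    · rintro ⟨k, h1, m, h2, h3⟩; exact ⟨m, ⟨k, h1, h2⟩, h3⟩
  one_mul α := ext_saturated fun f g => by simp [saturated_mul, saturated_one]
  mul_one α := ext_saturated fun f g => by simp [saturated_mul, saturated_one]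

/-- The involution `α ↦ α^*`, which interchanges the two rows. -/
instance : Star (PartitionMonoid n) where
  star α := { rel := Setoid.comap Sum.swap α.rel }

theorem star_rel {α : PartitionMonoid n} {x y : Fin n ⊕ Fin n} :
    (star α).rel x y ↔ α.rel x.swap y.swap := Iff.rfl

/-- The rank: the number of transversals, i.e. of blocks that meet both rows. -/
noncomputable def rank (α : PartitionMonoid n) : ℕ :=
  Set.ncard {B ∈ α.rel.classes | (∃ i, Sum.inl i ∈ B) ∧ ∃ j, Sum.inr j ∈ B}

/-- The kernel, an equivalence relation on the indices of the upper row. -/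
def ker (α : PartitionMonoid n) : Setoid (Fin n) := Setoid.comap Sum.inl α.rel

/-- The cokernel, an equivalence relation on the indices of the lower row. -/
def coker (α : PartitionMonoid n) : Setoid (Fin n) := Setoid.comap Sum.inr α.rel

/-- The partition with transversals `{1, 1'}, …, {q, q'}` whose other blocks are singletons. -/
def idBar (n q : ℕ) : PartitionMonoid n where
  rel :=
    { r := fun x y => x = y ∨ (Sum.elim id id x = Sum.elim id id y ∧ (Sum.elim id id x).val < q)
      iseqv := by
        refine ⟨fun _ => Or.inl rfl, ?_, ?_⟩
        · rintro x y (rfl | ⟨h, h'⟩)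
          · exact Or.inl rfl
          · exact Or.inr ⟨h.symm, h ▸ h'⟩
        · rintro x y z (rfl | ⟨h, h'⟩)
          · exact id
          · rintro (rfl | ⟨k, -⟩)
            · exact Or.inr ⟨h, h'⟩
            · exact Or.inr ⟨h.trans k, h'⟩ }

/-! ### Planar partitions and partitions with small blocks -/

/-- The position of a vertex on the boundary of the rectangle, read clockwise from the upper left
corner: `1, …, n, n', …, 1'`. -/
def boundaryPos : Fin n ⊕ Fin n → ℕ := Sum.elim (fun i => i.val) (fun i => 2 * n - 1 - i.val)

/-- Planarity: no two blocks cross. The edges being drawn inside the rectangle with the vertices on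
its boundary, two blocks cross if and only if two points of the one separate two points of the
other in the cyclic order of the boundary. -/
def IsPlanar (α : PartitionMonoid n) : Prop :=
  ∀ a b c d : Fin n ⊕ Fin n, boundaryPos a < boundaryPos b → boundaryPos b < boundaryPos c →
    boundaryPos c < boundaryPos d → α.rel a c → α.rel b d → α.rel a b

/-- All blocks have size at most two. -/
def HasSmallBlocks (α : PartitionMonoid n) : Prop := ∀ B ∈ α.rel.classes, B.ncard ≤ 2

theorem boundaryPos_injective : Function.Injective (boundaryPos (n := n)) := by
  rintro (i | i) (j | j) h <;> simp only [boundaryPos, Sum.elim_inl, Sum.elim_inr] at h <;>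
    first
      | (exfalso; omega)
      | (congr 1; ext; omega)

open Classical in
/-- `1` if `u` and `v` are in the same row and `u` is strictly to the left of `v`, else `0`. -/
noncomputable def leftOf : Vertex n → Vertex n → ZMod 2
  | .top i, .top j => if i < j then 1 else 0
  | .mid i, .mid j => if i < j then 1 else 0
  | .bot i, .bot j => if i < j then 1 else 0
  | _, _ => 0

theorem leftOf_eq {u x : Fin n ⊕ Fin n} (h : boundaryPos u ≠ boundaryPos x)
    (e : Fin n ⊕ Fin n → Vertex n) (he : e = inUpper ∨ e = inLower) :
    leftOf (e u) (e x) = (if boundaryPos u < boundaryPos x then 1 else 0) +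
      Sum.elim (fun _ => 0) (fun _ => 1) x := by
  have := fun i : Fin n => i.isLt
  rcases he with rfl | rfl <;> rcases x with x | x <;> rcases u with u | u <;>
    have h1 := this x <;> have h2 := this u <;> clear this <;>
    simp only [inUpper, inLower, Sum.elim_inl, Sum.elim_inr, leftOf] <;>
    split_ifs <;>
    first
      | decide
      | (exfalso; simp only [boundaryPos, Sum.elim_inl, Sum.elim_inr, Fin.lt_def] at *; omega)

theorem leftOf_chord {α : PartitionMonoid n} (hα : IsPlanar α) {x y u v : Fin n ⊕ Fin n}
    (hxy : α.rel x y) (huv : α.rel u v) (hux : ¬ α.rel u x) (e : Fin n ⊕ Fin n → Vertex n)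
    (he : e = inUpper ∨ e = inLower) :
    leftOf (e u) (e x) + leftOf (e v) (e x) = leftOf (e u) (e y) + leftOf (e v) (e y) := by
  have huy : ¬ α.rel u y := fun h => hux (α.rel.trans h (α.rel.symm hxy))
  have hvx : ¬ α.rel v x := fun h => hux (α.rel.trans huv h)
  have hvy : ¬ α.rel v y := fun h => huy (α.rel.trans huv h)
  have hyx := α.rel.symm hxy
  have hvu := α.rel.symm huv
  have hne : ∀ {a b}, ¬ α.rel a b → boundaryPos a ≠ boundaryPos b := by
    intro a b h h'
    exact h (boundaryPos_injective h' ▸ α.rel.refl a)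
  have hcross : ∀ {a b c d}, α.rel a c → α.rel b d → ¬ α.rel a b →
      ¬ (boundaryPos a < boundaryPos b ∧ boundaryPos b < boundaryPos c ∧
        boundaryPos c < boundaryPos d) := fun h1 h2 h3 h => h3 (hα _ _ _ _ h.1 h.2.1 h.2.2 h1 h2)
  have s : ∀ {a b}, ¬ α.rel a b → ¬ α.rel b a := fun h h' => h (α.rel.symm h')
  have c1 := hcross huv hxy hux
  have c2 := hcross huv hyx huy
  have c3 := hcross hvu hxy hvx
  have c4 := hcross hvu hyx hvy
  have c5 := hcross hxy huv (s hux)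
  have c6 := hcross hxy hvu (s hvx)
  have c7 := hcross hyx huv (s huy)
  have c8 := hcross hyx hvu (s hvy)
  have two : ∀ z : ZMod 2, z + z = 0 := fun z => CharTwo.add_self_eq_zero z
  have key : ((if boundaryPos u < boundaryPos x then 1 else 0) +
      (if boundaryPos v < boundaryPos x then 1 else 0) : ZMod 2) =
      (if boundaryPos u < boundaryPos y then 1 else 0) +
      (if boundaryPos v < boundaryPos y then 1 else 0) := by
    have n1 := hne hux
    have n2 := hne huy
    have n3 := hne hvx
    have n4 := hne hvy
    split_ifs <;> first | decide | (exfalso; omega)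
  rw [leftOf_eq (hne hux) e he, leftOf_eq (hne huy) e he, leftOf_eq (hne hvx) e he,
    leftOf_eq (hne hvy) e he]
  linear_combination key + two (Sum.elim (fun _ => 0) (fun _ => 1) x) -
    two (Sum.elim (fun _ => 0) (fun _ => 1) y)

/-- The product of planar partitions is planar. -/
theorem IsPlanar.mul {α β : PartitionMonoid n} (hα : IsPlanar α) (hβ : IsPlanar β) :
    IsPlanar (α * β) := by
  intro a b c d hab hbc hcd hac hbd
  by_contra hnab
  rw [mul_rel] at hac hbd hnab
  have two : ∀ z : ZMod 2, z + z = 0 := fun z => CharTwo.add_self_eq_zero z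
  -- vertices that are not connected to `a` avoid the component of `a`
  let Out : Vertex n → Prop := fun v => ¬ Joined α β (inOuter a) v
  have key : ∀ v, Joined α β (inOuter a) v → ∃ f g : Fin n ⊕ Fin n → ZMod 2,
      (∀ x y, α.rel x y → Out (inUpper x) → f x = f y) ∧
      (∀ x y, β.rel x y → Out (inLower x) → g x = g y) ∧
      (∀ i, f (.inr i) + g (.inl i) = leftOf v (.mid i)) ∧
      (∀ i, f (.inl i) = leftOf (inOuter a) (.top i) + leftOf v (.top i)) ∧
      (∀ i, g (.inr i) = leftOf (inOuter a) (.bot i) + leftOf v (.bot i)) := by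
    intro v hv
    induction hv with
    | refl =>
      refine ⟨0, 0, fun _ _ _ _ => rfl, fun _ _ _ _ => rfl, ?_, ?_, ?_⟩
      · intro i; rcases a with a | a <;> simp [inOuter, leftOf]
      · intro i; simp [two]
      · intro i; simp [two]
    | @tail v w hv hvw ih =>
      obtain ⟨f, g, hf, hg, h1, h2, h3⟩ := ih
      have hw := hv.tail hvw
      cases hvw with
      | upper p q hpq =>
        refine ⟨fun x => f x + (leftOf (inUpper p) (inUpper x) + leftOf (inUpper q) (inUpper x)),
          g, ?_, hg, ?_, ?_, ?_⟩
        · intro x y hxy hx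
          have hpx : ¬ α.rel p x := fun h => hx (Relation.ReflTransGen.tail hv (.upper _ _ h))
          simp only
          rw [hf x y hxy hx, leftOf_chord hα hxy hpq hpx inUpper (Or.inl rfl)]
        · intro i
          have := h1 i
          have t := two (leftOf (inUpper p) (.mid i))
          simp only [inUpper, Sum.elim_inr] at *
          linear_combination this + t
        · intro i
          have := h2 i
          have t := two (leftOf (inUpper p) (.top i))
          simp only [inUpper, Sum.elim_inl] at *
          linear_combination this + t
        · intro i
          rw [h3 i]
          rcases p with p | p <;> rcases q with q | q <;> simp [inUpper, leftOf]
      | lower p q hpq =>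
        refine ⟨f, fun x => g x + (leftOf (inLower p) (inLower x) + leftOf (inLower q) (inLower x)),
          hf, ?_, ?_, ?_, ?_⟩
        · intro x y hxy hx
          have hpx : ¬ β.rel p x := fun h => hx (Relation.ReflTransGen.tail hv (.lower _ _ h))
          simp only
          rw [hg x y hxy hx, leftOf_chord hβ hxy hpq hpx inLower (Or.inr rfl)]
        · intro i
          have := h1 i
          have t := two (leftOf (inLower p) (.mid i))
          simp only [inLower, Sum.elim_inl] at *
          linear_combination this + t
        · intro i
          rw [h2 i]
          rcases p with p | p <;> rcases q with q | q <;> simp [inLower, leftOf]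
        · intro i
          have := h3 i
          have t := two (leftOf (inLower p) (.bot i))
          simp only [inLower, Sum.elim_inr] at *
          linear_combination this + t
  obtain ⟨f, g, hf, hg, h1, h2, h3⟩ := key _ hac
  have h1' : ∀ i, f (.inr i) = g (.inl i) := by
    intro i
    have e : leftOf (inOuter c) (.mid i) = 0 := by rcases c with c | c <;> simp [inOuter, leftOf]
    have := h1 i
    rw [e] at this
    linear_combination this - two (g (.inl i))
  let k : Vertex n → ZMod 2 := fun v => match v with
    | .top i => f (.inl i)
    | .mid i => f (.inr i)
    | .bot i => g (.inr i)
  have ku : ∀ x, k (inUpper x) = f x := by rintro (i | i) <;> rfl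
  have kl : ∀ x, k (inLower x) = g x := by
    rintro (i | i)
    · exact h1' i
    · rfl
  have hk : ∀ v, Joined α β (inOuter b) v → k (inOuter b) = k v := by
    intro v hv
    induction hv with
    | refl => rfl
    | @tail v w hv hvw ih =>
      have ho : Out v := fun h => hnab (h.trans (Joined.symm hv))
      rw [ih]
      cases hvw with
      | upper p q hpq => rw [ku, ku]; exact hf p q hpq ho
      | lower p q hpq => rw [kl, kl]; exact hg p q hpq ho
  have hbd' := hk _ hbd
  have ko : ∀ x, k (inOuter x) =
      leftOf (inOuter a) (inOuter x) + leftOf (inOuter c) (inOuter x) := by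
    rintro (i | i)
    · exact h2 i
    · exact h3 i
  rw [ko, ko] at hbd'
  clear hk ko ku kl k h1' h1 h2 h3 hf hg f g key Out hnab hac hbd
  have lt := fun i : Fin n => i.isLt
  rcases a with a | a <;> rcases b with b | b <;> rcases c with c | c <;> rcases d with d | d <;>
    have l1 := lt a <;> have l2 := lt b <;> have l3 := lt c <;> have l4 := lt d <;> clear lt <;>
    simp only [inOuter, boundaryPos, Sum.elim_inl, Sum.elim_inr, leftOf, Fin.lt_def] at * <;>
    first
      | omega
      | (split_ifs at hbd' <;> first | omega | (revert hbd'; decide))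

theorem HasSmallBlocks.eq_or {α : PartitionMonoid n} (hα : HasSmallBlocks α)
    {x y z : Fin n ⊕ Fin n} (hy : α.rel x y) (hz : α.rel x z) (hxy : x ≠ y) : z = x ∨ z = y := by
  by_contra! h
  have := hα {w | α.rel w x} (Setoid.mem_classes _ x)
  have h3 : ({x, y, z} : Set (Fin n ⊕ Fin n)) ⊆ {w | α.rel w x} := by
    rintro w (rfl | rfl | rfl)
    · exact α.rel.refl _
    · exact α.rel.symm hy
    · exact α.rel.symm hz
  have h4 := Set.ncard_le_ncard h3 (Set.toFinite _)
  rw [Set.ncard_eq_three.2 ⟨x, y, z, hxy, h.1.symm, h.2.symm, rfl⟩] at h4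
  omega

theorem hasSmallBlocks_of {α : PartitionMonoid n}
    (h : ∀ x y z, α.rel x y → α.rel x z → x ≠ y → z = x ∨ z = y) : HasSmallBlocks α := by
  rintro B ⟨x, rfl⟩
  by_contra! hc
  obtain ⟨a, ha, b, hb, c, hc, hab, hac, hbc⟩ := (Set.two_lt_ncard (Set.toFinite _)).1 hc
  have hb' := α.rel.trans ha (α.rel.symm hb)
  have hc' := α.rel.trans ha (α.rel.symm hc)
  rcases h a b c hb' hc' hab with e | e
  · exact hac e.symm
  · exact hbc e.symm

/-- The embedding of the vertices of one of the factors into the product graph. -/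
def side : Bool → Fin n ⊕ Fin n → Vertex n
  | true => inUpper
  | false => inLower

theorem side_injective (s : Bool) : Function.Injective (side (n := n) s) := by
  cases s <;> rintro (i | i) (j | j) h <;> simp_all [side, inUpper, inLower]

/-- One of the factors. -/
def factor (α β : PartitionMonoid n) : Bool → PartitionMonoid n
  | true => α
  | false => β

/-- A step of a path without backtracking; the Boolean records the factor to be used next. -/
def WalkStep (α β : PartitionMonoid n) (p q : Vertex n × Bool) : Prop :=
  ∃ x y, (factor α β p.2).rel x y ∧ x ≠ y ∧ side p.2 x = p.1 ∧ side p.2 y = q.1 ∧ q.2 = !p.2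

/-- The side on which an outer vertex lies. -/
def outerSide : Fin n ⊕ Fin n → Bool := Sum.elim (fun _ => true) (fun _ => false)

theorem inOuter_ne_side (x y : Fin n ⊕ Fin n) : side (!outerSide x) y ≠ inOuter x := by
  rcases x with x | x <;> rcases y with y | y <;> simp [outerSide, side, inUpper, inLower, inOuter]

/-- The product of partitions with blocks of size at most two has blocks of size at most two. -/
theorem HasSmallBlocks.mul {α β : PartitionMonoid n} (hα : HasSmallBlocks α)
    (hβ : HasSmallBlocks β) : HasSmallBlocks (α * β) := by
  have hfac : ∀ s, HasSmallBlocks (factor α β s) := by rintro (_ | _) <;> assumption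
  have huniq : Relator.RightUnique (WalkStep α β) := by
    rintro ⟨v, s⟩ ⟨w, t⟩ ⟨w', t'⟩ ⟨x, y, h, hne, e1, e2, e3⟩ ⟨x', y', h', hne', e1', e2', e3'⟩
    simp only at *
    obtain rfl := side_injective s (e1.trans e1'.symm)
    rcases (hfac s).eq_or h h' hne with e | e
    · exact absurd e.symm hne'
    · subst e; simp [← e2, ← e2', e3, e3']
  apply hasSmallBlocks_of
  intro x y z hxy hxz hne
  rw [mul_rel] at hxy hxz
  let Orb : Vertex n × Bool → Prop :=
    Relation.ReflTransGen (WalkStep α β) (inOuter x, outerSide x)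
  have hclosed : ∀ v, Joined α β (inOuter x) v → ∃ s, Orb (v, s) := by
    intro v hv
    induction hv with
    | refl => exact ⟨_, .refl⟩
    | @tail v w _ hvw ih =>
      obtain ⟨s, hs⟩ := ih
      have hvw' : ∃ t p q, (factor α β t).rel p q ∧ side t p = v ∧ side t q = w := by
        cases hvw with
        | upper p q h => exact ⟨true, p, q, h, rfl, rfl⟩
        | lower p q h => exact ⟨false, p, q, h, rfl, rfl⟩
      obtain ⟨t, p, q, hpq, rfl, rfl⟩ := hvw'
      by_cases hpq' : p = q
      · subst hpq'; exact ⟨s, hs⟩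
      by_cases hst : t = s
      · subst hst
        exact ⟨!t, hs.tail ⟨p, q, hpq, hpq', rfl, rfl, rfl⟩⟩
      · rcases hs.cases_tail with e | ⟨⟨u, r⟩, hu, x', y', h, hne, e1, e2, e3⟩
        · exfalso
          have e1 := congrArg Prod.fst e
          have e2 := congrArg Prod.snd e
          simp only at e1 e2
          have : t = !outerSide x := by
            rw [← e2]
            revert hst
            cases t <;> cases s <;> decide
          rw [this] at e1
          exact inOuter_ne_side x p e1
        · simp only at *
          have hr : t = r := by
            rw [e3] at hst
            revert hst
            cases t <;> cases r <;> decide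
          subst hr
          obtain rfl := side_injective t e2
          rcases (hfac t).eq_or ((factor α β t).rel.symm h) hpq hne.symm with e | e
          · exact absurd e.symm hpq'
          · subst e; exact ⟨t, e1 ▸ hu⟩
  -- an outer vertex other than `x` is the end of the walk
  have hend : ∀ w, w ≠ x → Joined α β (inOuter x) (inOuter w) →
      ∃ s, Orb (inOuter w, s) ∧ ∀ q, ¬ WalkStep α β (inOuter w, s) q := by
    intro w hw hj
    obtain ⟨s, hs⟩ := hclosed _ hj
    refine ⟨s, hs, ?_⟩
    have hs' : s = !outerSide w := by
      rcases hs.cases_tail with e | ⟨⟨u, r⟩, _, x', y', _, _, _, e2, e3⟩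
      · exfalso
        have e1 := congrArg Prod.fst e
        simp only at e1
        apply hw
        rcases w with w | w <;> rcases x with x | x <;> simp_all [inOuter]
      · simp only at e2 e3
        by_contra hc
        have : r = !outerSide w := by
          rw [e3] at hc
          revert hc
          cases r <;> cases outerSide w <;> decide
        rw [this] at e2
        exact inOuter_ne_side w y' e2
    subst hs'
    rintro q ⟨x', y', _, _, e1, _⟩
    exact inOuter_ne_side w x' e1
  by_cases hzx : z = x
  · exact Or.inl hzx
  right
  obtain ⟨s, hs, hs'⟩ := hend y (Ne.symm hne) hxy
  obtain ⟨t, ht, ht'⟩ := hend z hzx hxz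
  have hinj : ∀ {u v : Fin n ⊕ Fin n}, inOuter u = inOuter v → u = v := by
    rintro (u | u) (v | v) h <;> simp_all [inOuter]
  rcases Relation.ReflTransGen.total_of_right_unique huniq hs ht with h | h
  · rcases h.cases_head with e | ⟨q, hq, _⟩
    · exact (hinj (congrArg Prod.fst e)).symm
    · exact absurd hq (hs' q)
  · rcases h.cases_head with e | ⟨q, hq, _⟩
    · exact hinj (congrArg Prod.fst e)
    · exact absurd hq (ht' q)

theorem isPlanar_one : IsPlanar (1 : PartitionMonoid n) := by
  intro a b c d h1 h2 h3 h4 h5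
  have e4 : Sum.elim id id a = Sum.elim id id c := h4
  have e5 : Sum.elim id id b = Sum.elim id id d := h5
  rcases a with a | a <;> rcases b with b | b <;> rcases c with c | c <;> rcases d with d | d <;>
    simp only [boundaryPos, Sum.elim_inl, Sum.elim_inr, id, Fin.ext_iff] at * <;>
    exfalso <;> omega

theorem hasSmallBlocks_one : HasSmallBlocks (1 : PartitionMonoid n) := by
  apply hasSmallBlocks_of
  intro x y z h h' hne
  have e : Sum.elim id id x = Sum.elim id id y := h
  have e' : Sum.elim id id x = Sum.elim id id z := h'
  rcases x with x | x <;> rcases y with y | y <;> rcases z with z | z <;> simp_all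

theorem boundaryPos_swap_lt {x y : Fin n ⊕ Fin n} (h : boundaryPos x < boundaryPos y) :
    boundaryPos y.swap < boundaryPos x.swap := by
  rcases x with x | x <;> rcases y with y | y <;>
    simp only [boundaryPos, Sum.elim_inl, Sum.elim_inr, Sum.swap_inl, Sum.swap_inr] at * <;> omega

theorem IsPlanar.star {α : PartitionMonoid n} (hα : IsPlanar α) : IsPlanar (star α) := by
  intro a b c d h1 h2 h3 h4 h5
  rw [star_rel] at h4 h5 ⊢
  have := hα _ _ _ _ (boundaryPos_swap_lt h3) (boundaryPos_swap_lt h2) (boundaryPos_swap_lt h1)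
    (α.rel.symm h5) (α.rel.symm h4)
  exact α.rel.trans h4 (α.rel.trans (α.rel.symm this) (α.rel.symm h5))

theorem HasSmallBlocks.star {α : PartitionMonoid n} (hα : HasSmallBlocks α) :
    HasSmallBlocks (star α) := by
  apply hasSmallBlocks_of
  intro x y z h h' hne
  have hne' : x.swap ≠ y.swap := fun e => hne (by simpa using congrArg Sum.swap e)
  rcases hα.eq_or h h' hne' with e | e
  · exact Or.inl (by simpa using congrArg Sum.swap e)
  · exact Or.inr (by simpa using congrArg Sum.swap e)

end PartitionMonoid

open PartitionMonoid

/-- The planar partition monoid. -/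
def planarPartitionMonoid (n : ℕ) : Submonoid (PartitionMonoid n) where
  carrier := {α | IsPlanar α}
  mul_mem' := IsPlanar.mul
  one_mem' := isPlanar_one

/-- The partial Brauer monoid. -/
def partialBrauerMonoid (n : ℕ) : Submonoid (PartitionMonoid n) where
  carrier := {α | HasSmallBlocks α}
  mul_mem' := HasSmallBlocks.mul
  one_mem' := hasSmallBlocks_one

/-- The Motzkin monoid. -/
def motzkinMonoid (n : ℕ) : Submonoid (PartitionMonoid n) :=
  partialBrauerMonoid n ⊓ planarPartitionMonoid n

theorem star_mem {n : ℕ} {K : Submonoid (PartitionMonoid n)}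
    (hK : K = planarPartitionMonoid n ∨ K = motzkinMonoid n) : ∀ α ∈ K, star α ∈ K := by
  rcases hK with rfl | rfl
  · exact fun α h => IsPlanar.star h
  · exact fun α h => ⟨HasSmallBlocks.star h.1, IsPlanar.star h.2⟩

/-! ### Congruences of the two monoids -/

section

variable {n : ℕ} (K : Submonoid (PartitionMonoid n))

/-- `I_q`, the set of all elements of rank at most `q`. -/
def rankIdeal (q : ℕ) : Set K := {α | (α : PartitionMonoid n).rank ≤ q}

/-- The one-element set consisting of the partial identity of rank `q`. -/
def trivialGroup (q : ℕ) : Set K := {α | (α : PartitionMonoid n) = idBar n q}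

/-- A congruence of `K` that is compatible with the involution. -/
def IsStarCon (hK : ∀ α ∈ K, star α ∈ K) (c : Con K) : Prop :=
  ∀ α β : K, c α β → c ⟨star α, hK α α.2⟩ ⟨star β, hK β β.2⟩

end

/-- Names for the congruences in the classification: `R_0, …, R_n`, and `λ_i, ρ_i, μ_i` for
`i = 0, 1`. -/
inductive CongLabel (n : ℕ) : Type
  | R (q : Fin (n + 1))
  | lam (i : Fin 2)
  | rho (i : Fin 2)
  | mu (i : Fin 2)

namespace CongLabel

variable {n : ℕ}

/-- The relation with a given name. -/
def toRel (K : Submonoid (PartitionMonoid n)) : CongLabel n → K → K → Prop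
  | R q => MonoidCong.reesRel (rankIdeal K q)
  | lam i => MonoidCong.lamRel (rankIdeal K i) (trivialGroup K (i + 1))
  | rho i => MonoidCong.rhoRel (rankIdeal K i) (trivialGroup K (i + 1))
  | mu i => MonoidCong.muRel (rankIdeal K i) (trivialGroup K (i + 1))

/-- The names of the `*`-congruences: all but the `λ_i` and `ρ_i`. -/
def IsStarLabel : CongLabel n → Prop
  | R _ => True
  | mu _ => True
  | lam _ => False
  | rho _ => False

/-- The edges of the Hasse diagram of the congruence lattice, as pairs (lower end, upper end). -/
inductive Hasse : CongLabel n → CongLabel n → Prop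
  | mu_lam (i : Fin 2) : Hasse (mu i) (lam i)
  | mu_rho (i : Fin 2) : Hasse (mu i) (rho i)
  | lam_R (i : Fin 2) (q : Fin (n + 1)) (h : q.val = i.val) : Hasse (lam i) (R q)
  | rho_R (i : Fin 2) (q : Fin (n + 1)) (h : q.val = i.val) : Hasse (rho i) (R q)
  | mu_mu : Hasse (mu 0) (mu 1)
  | lam_lam : Hasse (lam 0) (lam 1)
  | rho_rho : Hasse (rho 0) (rho 1)
  | R_R (q r : Fin (n + 1)) (h : r.val = q.val + 1) : Hasse (R q) (R r)

/-- The edges of the Hasse diagram of the lattice of `*`-congruences. -/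
inductive StarHasse : CongLabel n → CongLabel n → Prop
  | mu_mu : StarHasse (mu 0) (mu 1)
  | mu_R (i : Fin 2) (q : Fin (n + 1)) (h : q.val = i.val) : StarHasse (mu i) (R q)
  | R_R (q r : Fin (n + 1)) (h : r.val = q.val + 1) : StarHasse (R q) (R r)

end CongLabel

namespace PartitionMonoid

variable {n : ℕ}

/-! ### The involution and elementary facts on products -/

/-! Multiplication cannot raise the rank. If an element has rank at most 1, right multiplication
leaves its kernel unchanged and left multiplication leaves its cokernel unchanged
(`ker_mul_of_rank_le_one`, `coker_mul_of_rank_le_one`). So the elements of rank 0 form a rectangular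
band with kernel and cokernel as coordinates, and on elements of rank at most 1 forgetting the
transversal (`flatten`) is a homomorphism onto this band. This produces the relations λ, ρ, μ at
levels 0 and 1. From rank 2 on, the kernel of a product depends on the right factor
(`ker_idBar_mul_ne`), and the construction breaks down.

An arbitrary congruence is analysed through frames: p vertices in each row, joined in pairs by
distinct transversals. By planarity, cutting an element down to p chosen vertices in each row
(`compress`) gives rank p only if these vertices form a frame, and then it gives `idBar n p`.
Suppose that p ≥ 1 and that the congruence never relates rank p to a smaller rank. Then related
elements of rank at least p have the same frames of size p, hence the same transversals. Multiplying
by a strand that exchanges one vertex of a frame also recovers the other blocks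
(`NoDrop.rel_of_update`), so related elements are equal (`NoDrop.eq`). Consequently, a non-trivial
pair containing an element of rank q forces, for every p from 1 to q, each element of rank at most p
to be related to one of rank below p (`IsCongOn.exists_rel_rank_lt`).

Let q be the largest rank in a non-trivial class. If q ≥ 2, then `idBar n 2` is related to an
element of rank at most 1, and multiplying by elements of rank 0 yields pairs of rank at most 1 with
different kernels, and dually with different cokernels. One pair with different kernels already
identifies all elements of rank 0 with a common cokernel, because vertices can be detached from
their kernel classes one at a time (`IsCongOn.trivialize_ker`). Hence all of rank 0 collapses, and
the drops in rank carry this up to rank q. If q ≤ 1, elements of rank 1 can be flattened when q = 1,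
and it only matters whether kernels or cokernels may differ. So every congruence is described by q
and two Booleans (`IsCongOn.exists_stdRel`).

Inclusion of these congruences is componentwise in the three data. A suitable pair lies in a
congruence exactly if the data of the congruence dominate those of the pair
(`CongLabel.toCon_gen_iff`). This gives distinctness and principality, and reduces the covering
relations to an inspection of labels. -/

theorem star_star' (α : PartitionMonoid n) : star (star α) = α := by
  ext x y
  rw [star_rel, star_rel, Sum.swap_swap, Sum.swap_swap]

theorem saturated_star {α : PartitionMonoid n} {f g : Fin n → Prop} :
    Saturated (star α) f g ↔ Saturated α g f := by
  have key : ∀ (f g : Fin n → Prop) z, Sum.elim f g (Sum.swap z) = Sum.elim g f z := by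
    rintro f g (z | z) <;> rfl
  constructor
  · intro h x y hxy
    have := h x.swap y.swap (by rw [star_rel]; simpa using hxy)
    rwa [key, key] at this
  · intro h x y hxy
    have := h _ _ (star_rel.1 hxy)
    rwa [key, key] at this

theorem star_mul' (α β : PartitionMonoid n) : star (α * β) = star β * star α :=
  ext_saturated fun f g => by
    simp only [saturated_mul, saturated_star]
    constructor <;> rintro ⟨m, h1, h2⟩ <;> exact ⟨m, h2, h1⟩

theorem star_injective' : Function.Injective (star : PartitionMonoid n → PartitionMonoid n) :=
  Function.LeftInverse.injective star_star'

theorem ker_star (α : PartitionMonoid n) : (star α).ker = α.coker := rfl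

theorem rel_comm {α : PartitionMonoid n} {v w : Fin n ⊕ Fin n} : α.rel v w ↔ α.rel w v :=
  ⟨fun h => α.rel.symm h, fun h => α.rel.symm h⟩

theorem ker_iff {α : PartitionMonoid n} {x y : Fin n} :
    α.ker x y ↔ α.rel (.inl x) (.inl y) := Iff.rfl

theorem Joined.upper {α β : PartitionMonoid n} {x y : Fin n ⊕ Fin n} (h : α.rel x y) :
    Joined α β (inUpper x) (inUpper y) := .single (.upper x y h)

theorem Joined.lower {α β : PartitionMonoid n} {x y : Fin n ⊕ Fin n} (h : β.rel x y) :
    Joined α β (inLower x) (inLower y) := .single (.lower x y h)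

/-- A labelling of the product graph that is constant along edges is constant on components. -/
theorem Joined.map_eq {X : Type*} {α β : PartitionMonoid n} {u v : Vertex n}
    (h : Joined α β u v) (F : Vertex n → X)
    (hα : ∀ x y, α.rel x y → F (inUpper x) = F (inUpper y))
    (hβ : ∀ x y, β.rel x y → F (inLower x) = F (inLower y)) : F u = F v := by
  induction h with
  | refl => rfl
  | tail _ h ih =>
    rw [ih]
    cases h with
    | upper x y h => exact hα x y h
    | lower x y h => exact hβ x y h

theorem ker_mul_of {α β : PartitionMonoid n} {x y : Fin n} (h : α.rel (.inl x) (.inl y)) :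
    (α * β).rel (.inl x) (.inl y) := Joined.upper (α := α) (β := β) h

theorem coker_mul_of {α β : PartitionMonoid n} {x y : Fin n} (h : β.rel (.inr x) (.inr y)) :
    (α * β).rel (.inr x) (.inr y) := Joined.lower (α := α) (β := β) h

/-- A path that starts in the upper row stays there or leaves it along a transversal. -/
theorem Joined.exit {α β : PartitionMonoid n} {x : Fin n} {v : Vertex n}
    (h : Joined α β (.top x) v) :
    (∃ y, v = .top y ∧ α.rel (.inl x) (.inl y)) ∨ ∃ m, α.rel (.inl x) (.inr m) := by
  induction h with
  | refl => exact Or.inl ⟨x, rfl, α.rel.refl _⟩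
  | @tail v w _ hvw ih =>
    rcases ih with ⟨y, hv, hy⟩ | h
    · cases hvw with
      | upper a b hab =>
        rcases a with a | a
        · cases hv
          rcases b with b | b
          · exact Or.inl ⟨b, rfl, α.rel.trans hy hab⟩
          · exact Or.inr ⟨b, α.rel.trans hy hab⟩
        · cases hv
      | lower a b hab => rcases a with a | a <;> cases hv
    · exact Or.inr h

theorem exists_of_mul_rel {α β : PartitionMonoid n} {x y : Fin n}
    (h : (α * β).rel (.inl x) (.inr y)) : ∃ m, α.rel (.inl x) (.inr m) := by
  rcases Joined.exit (show Joined α β (.top x) (.bot y) from h) with ⟨_, h, _⟩ | h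
  · cases h
  · exact h

theorem exists_of_ker_mul {α β : PartitionMonoid n} {x y : Fin n}
    (h : (α * β).rel (.inl x) (.inl y)) :
    α.rel (.inl x) (.inl y) ∨ ∃ m, α.rel (.inl x) (.inr m) := by
  rcases Joined.exit (show Joined α β (.top x) (.top y) from h) with ⟨z, h, h'⟩ | h
  · cases h; exact Or.inl h'
  · exact Or.inr h

/-! ### The rank -/

/-- The vertices `s i` and `(t i)'` are connected by pairwise distinct transversals. -/
def IsFrame (α : PartitionMonoid n) {p : ℕ} (s t : Fin p → Fin n) : Prop :=
  ∀ i j, α.rel (.inl (s i)) (.inr (t j)) ↔ i = j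

theorem IsFrame.star {α : PartitionMonoid n} {p : ℕ} {s t : Fin p → Fin n} (h : IsFrame α s t) :
    IsFrame (star α) t s := fun i j =>
  ⟨fun k => ((h j i).1 (α.rel.symm k)).symm, fun k => α.rel.symm ((h j i).2 k.symm)⟩

theorem IsFrame.eq_of_upper {α : PartitionMonoid n} {p : ℕ} {s t : Fin p → Fin n}
    (h : IsFrame α s t) {i j : Fin p} (k : α.rel (.inl (s i)) (.inl (s j))) : i = j :=
  (h i j).1 (α.rel.trans k ((h j j).2 rfl))

/-- The set of transversals. -/
def transversals (α : PartitionMonoid n) : Set (Set (Fin n ⊕ Fin n)) :=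
  {B ∈ α.rel.classes | (∃ i, Sum.inl i ∈ B) ∧ ∃ j, Sum.inr j ∈ B}

theorem mem_transversals {α : PartitionMonoid n} {x y : Fin n}
    (h : α.rel (.inl x) (.inr y)) : {z | α.rel z (.inl x)} ∈ α.transversals :=
  ⟨Setoid.mem_classes _ _, ⟨x, α.rel.refl _⟩, ⟨y, α.rel.symm h⟩⟩

theorem exists_of_mem_transversals {α : PartitionMonoid n} {B : Set (Fin n ⊕ Fin n)}
    (h : B ∈ α.transversals) :
    ∃ x y, α.rel (.inl x) (.inr y) ∧ B = {z | α.rel z (.inl x)} := by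
  obtain ⟨⟨v, rfl⟩, ⟨x, hx⟩, ⟨y, hy⟩⟩ := h
  refine ⟨x, y, α.rel.trans hx (α.rel.symm hy), ?_⟩
  ext z
  exact ⟨fun h => α.rel.trans h (α.rel.symm hx), fun h => α.rel.trans h hx⟩

theorem IsFrame.le_rank {α : PartitionMonoid n} {p : ℕ} {s t : Fin p → Fin n}
    (h : IsFrame α s t) : p ≤ α.rank := by
  have hinj : Function.Injective (fun i => {z | α.rel z (.inl (s i))}) := by
    intro i j hij
    have : Sum.inl (s i) ∈ {z | α.rel z (.inl (s j))} := by
      simp only at hij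
      rw [← hij]; exact α.rel.refl _
    exact h.eq_of_upper this
  have := Set.ncard_le_ncard (s := Set.range fun i => {z | α.rel z (.inl (s i))})
    (t := α.transversals) (by rintro _ ⟨i, rfl⟩; exact mem_transversals ((h i i).2 rfl))
    (Set.toFinite _)
  rwa [Set.ncard_range_of_injective hinj, Nat.card_fin] at this

/-- Together with `IsFrame.le_rank` this makes the rank the largest size of a frame, the form in
which ranks are compared below. -/
theorem exists_isFrame (α : PartitionMonoid n) : ∃ s t : Fin α.rank → Fin n, IsFrame α s t := by
  obtain ⟨g⟩ : Nonempty (Fin α.rank ≃ α.transversals) :=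
    ⟨(Finite.equivFin α.transversals).symm⟩
  choose s t h e using fun i => exists_of_mem_transversals (g i).2
  refine ⟨s, t, fun i j => ⟨fun k => g.injective (Subtype.ext ?_), ?_⟩⟩
  · rw [e, e]
    have := α.rel.trans k (α.rel.symm (h j))
    ext z
    exact ⟨fun h => α.rel.trans h this, fun h => α.rel.trans h (α.rel.symm this)⟩
  · rintro rfl; exact h i

theorem rank_star (α : PartitionMonoid n) : (star α).rank = α.rank := by
  have key : ∀ α : PartitionMonoid n, α.rank ≤ (star α).rank := fun α => by
    obtain ⟨s, t, h⟩ := α.exists_isFrame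
    exact h.star.le_rank
  refine le_antisymm ?_ (key α)
  simpa [star_star'] using key (star α)

/-- A path from the upper to the lower row leaves `α` along a transversal of `α`, and different
components of the product leave along different ones. -/
theorem rank_mul_le_left (α β : PartitionMonoid n) : (α * β).rank ≤ α.rank := by
  obtain ⟨s, t, h⟩ := (α * β).exists_isFrame
  choose m hm using fun i => exists_of_mul_rel ((h i i).2 rfl)
  refine IsFrame.le_rank (s := s) (t := m) fun i j => ⟨fun k => ?_, ?_⟩
  · exact h.eq_of_upper (ker_mul_of (α.rel.trans k (α.rel.symm (hm j))))
  · rintro rfl; exact hm i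

theorem rank_mul_le_right (α β : PartitionMonoid n) : (α * β).rank ≤ β.rank := by
  rw [← rank_star, star_mul', ← rank_star β]
  exact rank_mul_le_left _ _

theorem rank_le (α : PartitionMonoid n) : α.rank ≤ n := by
  obtain ⟨s, t, h⟩ := α.exists_isFrame
  have hs : Function.Injective s := fun i j hij => h.eq_of_upper (by rw [hij])
  simpa using Fintype.card_le_of_injective s hs

theorem rank_eq_zero_iff {α : PartitionMonoid n} :
    α.rank = 0 ↔ ∀ x y, ¬ α.rel (.inl x) (.inr y) := by
  constructor
  · intro h x y hxy
    have := IsFrame.le_rank (α := α) (p := 1) (s := fun _ => x) (t := fun _ => y)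
      fun i j => ⟨fun _ => Subsingleton.elim _ _, fun _ => hxy⟩
    omega
  · intro h
    obtain ⟨s, t, hf⟩ := α.exists_isFrame
    by_contra hr
    exact h _ _ ((hf ⟨0, by omega⟩ ⟨0, by omega⟩).2 rfl)

theorem rel_of_rank_le_one {α : PartitionMonoid n} (hα : α.rank ≤ 1) {x y z w : Fin n}
    (h : α.rel (.inl x) (.inr z)) (h' : α.rel (.inl y) (.inr w)) : α.rel (.inl x) (.inl y) := by
  by_contra hc
  have hs := fun {u v} (h : α.rel u v) => α.rel.symm h
  have ht := fun {u v w} (h : α.rel u v) (h' : α.rel v w) => α.rel.trans h h'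
  have := IsFrame.le_rank (α := α) (p := 2) (s := ![x, y]) (t := ![z, w]) (by
    intro i j
    fin_cases i <;> fin_cases j <;> simp
    · exact h
    · exact fun k => hc (ht k (hs h'))
    · exact fun k => hc (ht h (hs k))
    · exact h')
  omega

/-- Elements of rank `0` are determined by their kernel and cokernel. -/
theorem ext_of_rank_eq_zero {α β : PartitionMonoid n} (hα : α.rank = 0) (hβ : β.rank = 0)
    (hk : α.ker = β.ker) (hc : α.coker = β.coker) : α = β := by
  rw [rank_eq_zero_iff] at hα hβ
  ext x y
  rcases x with x | x <;> rcases y with y | y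
  · exact Setoid.ext_iff.1 hk x y
  · exact iff_of_false (hα x y) (hβ x y)
  · exact iff_of_false (fun h => hα y x (α.rel.symm h)) (fun h => hβ y x (β.rel.symm h))
  · exact Setoid.ext_iff.1 hc x y

/-- A right factor can only merge kernel classes that lie on transversals, and here there is at most
one such class. -/
theorem ker_mul_of_rank_le_one {α : PartitionMonoid n} (hα : α.rank ≤ 1) (β : PartitionMonoid n) :
    (α * β).ker = α.ker := by
  ext x y
  refine ⟨fun h => ?_, ker_mul_of⟩
  rcases exists_of_ker_mul h with h' | ⟨m, hm⟩
  · exact h'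
  rcases exists_of_ker_mul ((α * β).rel.symm h) with h' | ⟨m', hm'⟩
  · exact α.rel.symm h'
  · exact rel_of_rank_le_one hα hm hm'

theorem coker_mul_of_rank_le_one (α : PartitionMonoid n) {β : PartitionMonoid n}
    (hβ : β.rank ≤ 1) : (α * β).coker = β.coker := by
  rw [← ker_star, star_mul', ker_mul_of_rank_le_one (by rwa [rank_star]), ker_star]

theorem rank_mul_eq_zero_left {α : PartitionMonoid n} (hα : α.rank = 0) (β : PartitionMonoid n) :
    (α * β).rank = 0 := Nat.le_zero.1 (hα ▸ rank_mul_le_left α β)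

theorem rank_mul_eq_zero_right (α : PartitionMonoid n) {β : PartitionMonoid n} (hβ : β.rank = 0) :
    (α * β).rank = 0 := Nat.le_zero.1 (hβ ▸ rank_mul_le_right α β)

theorem le_of_strictMono {p : ℕ} {s : Fin p → Fin n} (hs : StrictMono s) : p ≤ n := by
  simpa using Fintype.card_le_of_injective s hs.injective

/-- The rectangular band law: the left factor supplies the kernel and the right factor the cokernel.
-/
theorem eq_of_ker_coker {α β γ : PartitionMonoid n} (hγ : γ.rank = 0) (hα : α.rank ≤ 1)
    (hβ : β.rank ≤ 1) (hαβ : (α * β).rank = 0) (hk : γ.ker = α.ker) (hc : γ.coker = β.coker) :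
    α * β = γ :=
  ext_of_rank_eq_zero hαβ hγ (by rw [ker_mul_of_rank_le_one hα, hk])
    (by rw [coker_mul_of_rank_le_one _ hβ, hc])

theorem exists_rel_of_ker_ne {α β : PartitionMonoid n} (h : α.ker ≠ β.ker) :
    ∃ x y, x < y ∧ ((α.rel (.inl x) (.inl y) ∧ ¬ β.rel (.inl x) (.inl y)) ∨
      (β.rel (.inl x) (.inl y) ∧ ¬ α.rel (.inl x) (.inl y))) := by
  by_contra! hc
  apply h
  have key : ∀ x y, x < y → (α.rel (.inl x) (.inl y) ↔ β.rel (.inl x) (.inl y)) :=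
    fun x y hxy => ⟨(hc x y hxy).1, (hc x y hxy).2⟩
  ext x y
  rcases lt_trichotomy x y with h | rfl | h
  · exact key x y h
  · exact iff_of_true (α.ker.refl _) (β.ker.refl _)
  · exact rel_comm.trans ((key y x h).trans rel_comm)

theorem strictMono_pair {x y : Fin n} (h : x < y) : StrictMono (![x, y] : Fin 2 → Fin n) := by
  intro i j hij
  fin_cases i <;> fin_cases j <;> simp_all

/-! ### Strands -/

/-- The blocks of `strand s x y`, as the fibres of a labelling. -/
def strandLabel {p : ℕ} (s : Fin p → Fin n) (x y : Fin n) : Fin n ⊕ Fin n → Fin n ⊕ Fin n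
  | .inl k => if h : k.val < p then .inl (s ⟨k, h⟩) else .inr k
  | .inr j => .inl (if j = y then x else j)

/-- The partition with transversals `{k, (s k)'}` for `k < p` and the lower block `{x', y'}`, whose
other blocks are singletons. For `x = y` there is no exceptional lower block. -/
def strand {p : ℕ} (s : Fin p → Fin n) (x y : Fin n) : PartitionMonoid n where
  rel := Setoid.ker (strandLabel s x y)

/-- The lower block `{x', y'}` of `strand s x y` does not interfere with its transversals. -/
structure IsClear {p : ℕ} (s : Fin p → Fin n) (x y : Fin n) : Prop where
  mono : StrictMono s
  le : x ≤ y
  out : x < y → ∀ i, s i < x ∨ y < s i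

section

variable {p : ℕ} {s : Fin p → Fin n} {x y : Fin n}

theorem IsClear.ne (h : IsClear s x y) (i : Fin p) : (s i = x ∨ s i = y) → x = y := by
  intro e
  by_contra hne
  have hlt := lt_of_le_of_ne h.le hne
  have := h.out hlt i
  omega

theorem strand_rel_inl_inl (h : IsClear s x y) {k l : Fin n} :
    (strand s x y).rel (.inl k) (.inl l) ↔ k = l := by
  refine ⟨fun e => ?_, fun e => e ▸ (strand s x y).rel.refl _⟩
  have e' : strandLabel s x y (.inl k) = strandLabel s x y (.inl l) := e
  simp only [strandLabel] at e'
  split_ifs at e' with h1 h2 h2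
  · have := h.mono.injective (Sum.inl_injective e')
    simpa [Fin.ext_iff] using this
  · exact Sum.inr_injective e'

theorem strand_rel_inl_inr (h : IsClear s x y) {k j : Fin n} :
    (strand s x y).rel (.inl k) (.inr j) ↔ ∃ hk : k.val < p, s ⟨k, hk⟩ = j := by
  have e : (strand s x y).rel (.inl k) (.inr j) ↔
    strandLabel s x y (.inl k) = strandLabel s x y (.inr j) := Iff.rfl
  rw [e]
  simp only [strandLabel]
  constructor
  · intro e'
    split_ifs at e' with h1 h2
    · have e2 := Sum.inl_injective e'
      exact ⟨h1, by rw [h2, e2]; exact h.ne _ (Or.inl e2)⟩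
    · exact ⟨h1, Sum.inl_injective e'⟩
  · rintro ⟨hk, rfl⟩
    rw [dif_pos hk]
    split_ifs with h1
    · rw [h1, h.ne _ (Or.inr h1)]
    · rfl

theorem strand_rel_inr_inr {i j : Fin n} :
    (strand s x y).rel (.inr i) (.inr j) ↔ i = j ∨ (i = x ∧ j = y) ∨ (i = y ∧ j = x) := by
  have e : (strand s x y).rel (.inr i) (.inr j) ↔
    strandLabel s x y (.inr i) = strandLabel s x y (.inr j) := Iff.rfl
  rw [e]
  simp only [strandLabel, Sum.inl.injEq]
  split_ifs with h1 h2 h2 <;> subst_vars <;> grind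

theorem isPlanar_strand (h : IsClear s x y) : IsPlanar (strand s x y) := by
  have hs := fun {k l : Fin n} (hk : k.val < p) (hl : l.val < p) (hkl : k < l) =>
    h.mono (show (⟨k, hk⟩ : Fin p) < ⟨l, hl⟩ from hkl)
  have hout := h.out
  have hle := h.le
  intro a b c d h1 h2 h3 h4 h5
  exfalso
  rcases a with a | a <;> rcases c with c | c <;>
    first
      | (rw [strand_rel_inl_inl h] at h4; subst h4; omega)
      | skip
  · rcases b with b | b <;> rcases d with d | d
    · rw [strand_rel_inl_inl h] at h5; subst h5; omega
    · rw [strand_rel_inl_inr h] at h4 h5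
      obtain ⟨ha, rfl⟩ := h4
      obtain ⟨hb, rfl⟩ := h5
      have := hs ha hb (by simpa [boundaryPos] using h1)
      simp only [boundaryPos, Sum.elim_inl, Sum.elim_inr] at *
      omega
    · simp only [boundaryPos, Sum.elim_inl, Sum.elim_inr] at *
      omega
    · rw [strand_rel_inl_inr h] at h4
      rw [strand_rel_inr_inr] at h5
      obtain ⟨ha, rfl⟩ := h4
      have := fun hlt => hout hlt ⟨a, ha⟩
      simp only [boundaryPos, Sum.elim_inl, Sum.elim_inr, Fin.lt_def, Fin.le_def, Fin.ext_iff] at *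
      omega
  · simp only [boundaryPos, Sum.elim_inl, Sum.elim_inr] at *
    omega
  · rcases b with b | b <;> rcases d with d | d
    · simp only [boundaryPos, Sum.elim_inl, Sum.elim_inr] at *
      omega
    · simp only [boundaryPos, Sum.elim_inl, Sum.elim_inr] at *
      omega
    · simp only [boundaryPos, Sum.elim_inl, Sum.elim_inr] at *
      omega
    · rw [strand_rel_inr_inr] at h4 h5
      simp only [boundaryPos, Sum.elim_inr, Fin.ext_iff, Fin.le_def] at *
      omega

theorem hasSmallBlocks_strand (h : IsClear s x y) : HasSmallBlocks (strand s x y) := by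
  have hne := h.ne
  have hinj := h.mono.injective
  apply hasSmallBlocks_of
  intro u v w h1 h2 h3
  have hsy : ∀ {u v}, (strand s x y).rel u v → (strand s x y).rel v u :=
    fun h => (strand s x y).rel.symm h
  rcases u with u | u <;> rcases v with v | v
  · exact absurd (congrArg _ ((strand_rel_inl_inl h).1 h1)) h3
  · obtain ⟨hu, rfl⟩ := (strand_rel_inl_inr h).1 h1
    rcases w with w | w
    · exact Or.inl (congrArg _ ((strand_rel_inl_inl h).1 h2).symm)
    · obtain ⟨_, rfl⟩ := (strand_rel_inl_inr h).1 h2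
      exact Or.inr rfl
  · obtain ⟨hv, hvu⟩ := (strand_rel_inl_inr h).1 (hsy h1)
    rcases w with w | w
    · obtain ⟨hw, hwu⟩ := (strand_rel_inl_inr h).1 (hsy h2)
      have := hinj (hvu.trans hwu.symm)
      simp only [Fin.mk.injEq] at this
      exact Or.inr (congrArg _ (Fin.ext this.symm))
    · have h4 := strand_rel_inr_inr.1 h2
      have h5 := hne ⟨v, hv⟩
      rw [hvu] at h5
      left; congr 1; grind
  · have h4 := strand_rel_inr_inr.1 h1
    rcases w with w | w
    · obtain ⟨hw, hwu⟩ := (strand_rel_inl_inr h).1 (hsy h2)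
      have h5 := hne ⟨w, hw⟩
      rw [hwu] at h5
      exfalso; apply h3; congr 1; grind
    · have h5 := strand_rel_inr_inr.1 h2
      simp only [Sum.inr.injEq, ne_eq] at h3 ⊢
      grind

/-! ### Products with a strand on the left -/

open Classical in
/-- The labelling whose fibres are the blocks of `strand s x y * α`: the vertices of the lower row
of the strand are identified with the blocks of `α` with which they are connected. -/
noncomputable def mergeLabel (α : PartitionMonoid n) (x y : Fin n) (v : Fin n ⊕ Fin n) :
    Quotient α.rel :=
  if α.rel v (.inl y) then Quotient.mk _ (.inl x) else Quotient.mk _ v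

/-- The labelling of the product graph of `strand s x y` and `α` by its components. -/
noncomputable def strandMulLabel (s : Fin p → Fin n) (x y : Fin n) (α : PartitionMonoid n) :
    Vertex n → Quotient α.rel ⊕ Fin n
  | .top k => if h : k.val < p then .inl (mergeLabel α x y (.inl (s ⟨k, h⟩))) else .inr k
  | .mid j => .inl (mergeLabel α x y (.inl j))
  | .bot j => .inl (mergeLabel α x y (.inr j))

theorem mergeLabel_eq_of_rel {α : PartitionMonoid n} {v w : Fin n ⊕ Fin n} (h : α.rel v w) :
    mergeLabel α x y v = mergeLabel α x y w := by
  have : α.rel v (.inl y) ↔ α.rel w (.inl y) :=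
    ⟨fun k => α.rel.trans (α.rel.symm h) k, fun k => α.rel.trans h k⟩
  unfold mergeLabel
  simp only [show Quotient.mk α.rel v = Quotient.mk α.rel w from Quotient.sound h]
  classical exact if_congr this rfl rfl

theorem mergeLabel_eq_iff {α : PartitionMonoid n} {v w : Fin n ⊕ Fin n} :
    mergeLabel α x y v = mergeLabel α x y w ↔ α.rel v w ∨
      (α.rel v (.inl x) ∧ α.rel w (.inl y)) ∨ (α.rel v (.inl y) ∧ α.rel w (.inl x)) := by
  have hq : ∀ {u v}, (Quotient.mk α.rel u = Quotient.mk α.rel v) ↔ α.rel u v := Quotient.eq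
  have hs : ∀ {u v}, α.rel u v → α.rel v u := fun h => α.rel.symm h
  have ht : ∀ {u v w}, α.rel u v → α.rel v w → α.rel u w := fun h h' => α.rel.trans h h'
  unfold mergeLabel
  split_ifs with h1 h2 h2
  · exact iff_of_true rfl (Or.inl (ht h1 (hs h2)))
  · rw [hq]
    exact ⟨fun h => Or.inr (Or.inr ⟨h1, hs h⟩), fun h => by
      rcases h with h | ⟨_, h⟩ | ⟨_, h⟩
      · exact absurd (ht (hs h) h1) h2
      · exact absurd h h2
      · exact hs h⟩
  · rw [hq]
    exact ⟨fun h => Or.inr (Or.inl ⟨h, h2⟩), fun h => by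
      rcases h with h | ⟨h, _⟩ | ⟨h, _⟩
      · exact absurd (ht h h2) h1
      · exact h
      · exact absurd h h1⟩
  · rw [hq]
    exact ⟨Or.inl, fun h => by
      rcases h with h | ⟨_, h⟩ | ⟨h, _⟩
      · exact h
      · exact absurd h h2
      · exact absurd h h1⟩

/-- The labelling is constant along the edges of the product graph, so it separates components.
Conversely, equal labels come with explicit paths, where the two merged classes of `α` are linked
through the lower block of the strand. -/
theorem strand_mul_rel (hc : IsClear s x y) {α : PartitionMonoid n} {v w : Fin n ⊕ Fin n} :
    (strand s x y * α).rel v w ↔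
      strandMulLabel s x y α (inOuter v) = strandMulLabel s x y α (inOuter w) := by
  constructor
  · intro h
    refine Joined.map_eq h _ ?_ ?_
    · have key : ∀ u, strandMulLabel s x y α (inUpper u) =
          Sum.map (fun j => mergeLabel α x y (.inl j)) id (strandLabel s x y u) := by
        rintro (k | j)
        · simp only [inUpper, Sum.elim_inl, strandMulLabel, strandLabel]
          split_ifs <;> rfl
        · simp only [inUpper, Sum.elim_inr, strandMulLabel, strandLabel, Sum.map_inl]
          split_ifs with h
          · rw [h, mergeLabel_eq_iff.2 (Or.inr (Or.inr ⟨α.rel.refl _, α.rel.refl _⟩))]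
          · rfl
      intro u u' h
      rw [key, key, show strandLabel s x y u = strandLabel s x y u' from h]
    · have key : ∀ u, strandMulLabel s x y α (inLower u) = .inl (mergeLabel α x y u) := by
        rintro (k | j) <;> rfl
      intro u u' h
      rw [key, key, mergeLabel_eq_of_rel h]
  · intro h
    have hx : Joined (strand s x y) α (.mid x) (.mid y) :=
      Joined.upper (strand_rel_inr_inr.2 (Or.inr (Or.inl ⟨rfl, rfl⟩)))
    have hm : ∀ u u', mergeLabel α x y u = mergeLabel α x y u' →
        Joined (strand s x y) α (inLower u) (inLower u') := by
      intro u u' h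
      rcases mergeLabel_eq_iff.1 h with h | ⟨h, h'⟩ | ⟨h, h'⟩
      · exact Joined.lower h
      · exact (Joined.lower h).trans (hx.trans (Joined.lower h').symm)
      · exact (Joined.lower h).trans (hx.symm.trans (Joined.lower h').symm)
    -- Every outer vertex is either attached to a vertex of `α` or an isolated upper vertex of the
    -- strand.
    have hl : ∀ v, (∃ u, Joined (strand s x y) α (inOuter v) (inLower u) ∧
        strandMulLabel s x y α (inOuter v) = .inl (mergeLabel α x y u)) ∨
        ∃ k, v = .inl k ∧ strandMulLabel s x y α (inOuter v) = .inr k := by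
      rintro (k | j)
      · by_cases hk : k.val < p
        · refine Or.inl ⟨.inl (s ⟨k, hk⟩), ?_, by simp [inOuter, strandMulLabel, hk]⟩
          exact Joined.upper ((strand_rel_inl_inr hc).2 ⟨hk, rfl⟩)
        · exact Or.inr ⟨k, rfl, by simp [inOuter, strandMulLabel, hk]⟩
      · exact Or.inl ⟨.inr j, .refl, rfl⟩
    rcases hl v with ⟨u, h1, h2⟩ | ⟨k, rfl, h2⟩ <;>
      rcases hl w with ⟨u', h1', h2'⟩ | ⟨k', rfl, h2'⟩ <;>
      rw [h2, h2'] at h <;> simp only [Sum.inl.injEq, Sum.inr.injEq, reduceCtorEq] at h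
    · exact h1.trans ((hm _ _ h).trans h1'.symm)
    · subst h; exact .refl

theorem isClear_self (hs : StrictMono s) (x : Fin n) : IsClear s x x :=
  ⟨hs, le_rfl, fun h => absurd h (lt_irrefl _)⟩

theorem strand_mul_inl_inr (hc : IsClear s x y) {α : PartitionMonoid n} {k j : Fin n} :
    (strand s x y * α).rel (.inl k) (.inr j) ↔
      ∃ hk : k.val < p, mergeLabel α x y (.inl (s ⟨k, hk⟩)) = mergeLabel α x y (.inr j) := by
  rw [strand_mul_rel hc]
  simp only [inOuter, Sum.elim_inl, Sum.elim_inr, strandMulLabel]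
  split_ifs with h <;> simp [h]

theorem strand_mul_inr_inr (hc : IsClear s x y) {α : PartitionMonoid n} {i j : Fin n} :
    (strand s x y * α).rel (.inr i) (.inr j) ↔
      mergeLabel α x y (.inr i) = mergeLabel α x y (.inr j) := by
  rw [strand_mul_rel hc]
  simp only [inOuter, Sum.elim_inr, strandMulLabel, Sum.inl.injEq]

theorem strand_mul_inl_inl (hc : IsClear s x y) {α : PartitionMonoid n} {k l : Fin n} :
    (strand s x y * α).rel (.inl k) (.inl l) ↔ k = l ∨ ∃ (hk : k.val < p) (hl : l.val < p),
      mergeLabel α x y (.inl (s ⟨k, hk⟩)) = mergeLabel α x y (.inl (s ⟨l, hl⟩)) := by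
  constructor
  · intro h
    rw [strand_mul_rel hc] at h
    simp only [inOuter, Sum.elim_inl, strandMulLabel] at h
    split_ifs at h with h1 h2
    · exact Or.inr ⟨h1, h2, Sum.inl_injective h⟩
    · exact Or.inl (Sum.inr_injective h)
  · rintro (rfl | ⟨hk, hl, h⟩)
    · exact (strand s x y * α).rel.refl _
    · rw [strand_mul_rel hc]
      simp only [inOuter, Sum.elim_inl, strandMulLabel, hk, hl, dif_pos, h]

theorem mergeLabel_self {α : PartitionMonoid n} {v w : Fin n ⊕ Fin n} :
    mergeLabel α x x v = mergeLabel α x x w ↔ α.rel v w := by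
  rw [mergeLabel_eq_iff]
  refine ⟨fun h => ?_, Or.inl⟩
  rcases h with h | ⟨h, h'⟩ | ⟨h, h'⟩
  · exact h
  · exact α.rel.trans h (α.rel.symm h')
  · exact α.rel.trans h (α.rel.symm h')

end

theorem mul_star_rel {β γ : PartitionMonoid n} {v w : Fin n ⊕ Fin n} :
    (β * star γ).rel v w ↔ (γ * star β).rel v.swap w.swap := by
  rw [← star_rel, star_mul', star_star']

theorem idBar_inl_inr {q : ℕ} {i j : Fin n} :
    (idBar n q).rel (.inl i) (.inr j) ↔ i = j ∧ i.val < q := by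
  show (_ ∨ _) ↔ _
  simp

theorem idBar_inl_inl {q : ℕ} {i j : Fin n} :
    (idBar n q).rel (.inl i) (.inl j) ↔ i = j := by
  show (_ ∨ _) ↔ _
  simp +contextual

theorem idBar_inr_inr {q : ℕ} {i j : Fin n} :
    (idBar n q).rel (.inr i) (.inr j) ↔ i = j := by
  show (_ ∨ _) ↔ _
  simp +contextual

theorem ext_rows {α β : PartitionMonoid n}
    (h1 : ∀ i j, α.rel (.inl i) (.inl j) ↔ β.rel (.inl i) (.inl j))
    (h2 : ∀ i j, α.rel (.inl i) (.inr j) ↔ β.rel (.inl i) (.inr j))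
    (h3 : ∀ i j, α.rel (.inr i) (.inr j) ↔ β.rel (.inr i) (.inr j)) : α = β := by
  ext x y
  rcases x with x | x <;> rcases y with y | y
  · exact h1 x y
  · exact h2 x y
  · exact rel_comm.trans ((h2 y x).trans rel_comm)
  · exact h3 x y

theorem strictMono_castLE {q : ℕ} (hq : q ≤ n) : StrictMono (Fin.castLE hq) :=
  fun _ _ h => h

/-! ### Frames of planar partitions -/

/-- Two transversals whose lower ends come in the opposite order to their upper ends would cross. -/
theorem IsPlanar.frame_mono {α : PartitionMonoid n} {p : ℕ} {s t : Fin p → Fin n}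
    (hα : IsPlanar α) (h : IsFrame α s t) (hs : StrictMono s) :
    StrictMono t := by
  intro i j hij
  by_contra hc
  have hne : t i ≠ t j := fun e => hij.ne ((h i j).1 (e ▸ (h i i).2 rfl))
  have h1 := hs hij
  have := hα (.inl (s i)) (.inl (s j)) (.inr (t i)) (.inr (t j)) (by simpa [boundaryPos] using h1)
    (by simp only [boundaryPos, Sum.elim_inl, Sum.elim_inr]; omega)
    (by simp only [boundaryPos, Sum.elim_inr]; omega) ((h i i).2 rfl) ((h j j).2 rfl)
  exact hij.ne (h.eq_of_upper this)

/-- A frame of maximal size meets every transversal. -/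
theorem IsFrame.exists_rel {α : PartitionMonoid n} {s t : Fin α.rank → Fin n} (h : IsFrame α s t)
    {x y : Fin n}
    (hxy : α.rel (.inl x) (.inr y)) : ∃ i, α.rel (.inl x) (.inl (s i)) := by
  by_contra! hc
  have hs : ∀ {u v}, α.rel u v → α.rel v u := fun h => α.rel.symm h
  have ht : ∀ {u v w}, α.rel u v → α.rel v w → α.rel u w := fun h h' => α.rel.trans h h'
  have : IsFrame α (Fin.cons x s : Fin (α.rank + 1) → Fin n) (Fin.cons y t) := by
    intro i j
    refine Fin.cases ?_ (fun i => ?_) i <;> refine Fin.cases ?_ (fun j => ?_) j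
    · simpa using hxy
    · simp only [Fin.cons_zero, Fin.cons_succ, (Fin.succ_ne_zero j).symm, iff_false]
      exact fun k => hc j (ht k (hs ((h j j).2 rfl)))
    · simp only [Fin.cons_zero, Fin.cons_succ, Fin.succ_ne_zero i, iff_false]
      exact fun k => hc i (ht hxy (hs k))
    · simpa using h i j
  have := this.le_rank
  omega

/-- A finite chain has no order automorphism but the identity; this rigidity is what makes the
maximal subgroups trivial. -/
theorem strictMono_fin_eq {p : ℕ} {f : Fin p → Fin n} (hf : StrictMono f)
    (h : ∀ i, (f i).val < p) (i : Fin p) : (f i).val = i.val := by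
  have hg : StrictMono (fun i => (⟨f i, h i⟩ : Fin p)) := fun i j hij => hf hij
  exact congrArg Fin.val (le_antisymm (hg.le_id i) (hg.id_le i))

theorem isFrame_idBar {q : ℕ} (hq : q ≤ n) :
    IsFrame (idBar n q) (Fin.castLE hq) (Fin.castLE hq) := fun i j => by
  rw [idBar_inl_inr]
  simp [Fin.ext_iff]

/-- Pairwise inequivalent vertices on transversals form one side of a frame. -/
theorem IsPlanar.exists_frame_of_finset {α : PartitionMonoid n} {p : ℕ} (hα : IsPlanar α)
    (D : Finset (Fin n)) (hD : D.card = p)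
    (h2 : ∀ x ∈ D, ∀ y ∈ D, α.rel (.inl x) (.inl y) → x = y) (b : Fin n → Fin n)
    (hb : ∀ x ∈ D, α.rel (.inl x) (.inr (b x))) :
    ∃ s : Fin p → Fin n, StrictMono s ∧ StrictMono (b ∘ s) ∧ IsFrame α s (b ∘ s) ∧
      ∀ x, x ∈ D ↔ ∃ i, s i = x := by
  have hm := D.orderEmbOfFin_mem hD
  have hf : IsFrame α (D.orderEmbOfFin hD) (b ∘ D.orderEmbOfFin hD) := fun i j =>
    ⟨fun h => (D.orderEmbOfFin hD).injective
      (h2 _ (hm i) _ (hm j) (α.rel.trans h (α.rel.symm (hb _ (hm j))))),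
      fun h => h ▸ hb _ (hm i)⟩
  refine ⟨D.orderEmbOfFin hD, (D.orderEmbOfFin hD).strictMono,
    hα.frame_mono hf (D.orderEmbOfFin hD).strictMono, hf, fun x => ?_⟩
  rw [← Finset.mem_coe, ← D.range_orderEmbOfFin hD]
  rfl

theorem rank_idBar {q : ℕ} (hq : q ≤ n) : (idBar n q).rank = q := by
  refine le_antisymm ?_ (isFrame_idBar hq).le_rank
  obtain ⟨s, t, h⟩ := (idBar n q).exists_isFrame
  have hs : Function.Injective s := fun i j hij => h.eq_of_upper (by rw [hij])
  have hlt : ∀ i, (s i).val < q := fun i => (idBar_inl_inr.1 ((h i i).2 rfl)).2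
  simpa using Fintype.card_le_of_injective (fun i => (⟨s i, hlt i⟩ : Fin q))
    fun i j hij => hs (Fin.ext (by simpa using hij))

/-- Every transversal is part of a frame of any given size that is not excluded by the rank. -/
theorem IsPlanar.exists_frame_through {α : PartitionMonoid n} {p : ℕ} (hα : IsPlanar α)
    (hp : 1 ≤ p) (hpα : p ≤ α.rank)
    {x y : Fin n} (hxy : α.rel (.inl x) (.inr y)) :
    ∃ s t : Fin p → Fin n, StrictMono s ∧ StrictMono t ∧ IsFrame α s t ∧
      ∃ i, s i = x ∧ t i = y := by
  classical
  obtain ⟨s, t, hf⟩ := α.exists_isFrame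
  have hinj : Function.Injective s := fun i j hij => hf.eq_of_upper (by rw [hij])
  -- The upper ends of a maximal frame, with a representative of the block of `x`, if there is one,
  -- replaced by `x` itself.
  let D : Finset (Fin n) :=
    insert x ((Finset.univ.image s).filter fun z => ¬ α.rel (.inl z) (.inl x))
  have hcard : p ≤ D.card := by
    refine hpα.trans ?_
    have hg : ∀ i : Fin α.rank, (if α.rel (.inl (s i)) (.inl x) then x else s i) ∈ D := by
      intro i
      split_ifs with h
      · exact Finset.mem_insert_self _ _
      · exact Finset.mem_insert_of_mem (by simp [h])
    have := Finset.card_le_card_of_injOn (s := (Finset.univ : Finset (Fin α.rank))) (t := D)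
      (fun i => if α.rel (.inl (s i)) (.inl x) then x else s i) (fun i _ => hg i) (by
        intro i _ j _ hij
        simp only at hij
        split_ifs at hij with h h' h'
        · exact hf.eq_of_upper (α.rel.trans h (α.rel.symm h'))
        · exact absurd (by rw [← hij]) h'
        · exact absurd (by rw [hij]) h
        · exact hinj hij)
    simpa using this
  obtain ⟨E, hE1, hE2, hE3⟩ := Finset.exists_subsuperset_card_eq
    (Finset.singleton_subset_iff.2 (Finset.mem_insert_self x _) : {x} ⊆ D) (by simpa using hp) hcard
  have hD1 : ∀ z ∈ D, ∃ w, α.rel (.inl z) (.inr w) := by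
    intro z hz
    rcases Finset.mem_insert.1 hz with rfl | hz
    · exact ⟨y, hxy⟩
    · obtain ⟨i, _, rfl⟩ := Finset.mem_image.1 (Finset.mem_filter.1 hz).1
      exact ⟨t i, (hf i i).2 rfl⟩
  have hD2 : ∀ z ∈ D, ∀ w ∈ D, α.rel (.inl z) (.inl w) → z = w := by
    intro z hz w hw hzw
    rcases Finset.mem_insert.1 hz with rfl | hz <;> rcases Finset.mem_insert.1 hw with rfl | hw
    · rfl
    · exact absurd (α.rel.symm hzw) (Finset.mem_filter.1 hw).2
    · exact absurd hzw (Finset.mem_filter.1 hz).2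
    · obtain ⟨i, _, rfl⟩ := Finset.mem_image.1 (Finset.mem_filter.1 hz).1
      obtain ⟨j, _, rfl⟩ := Finset.mem_image.1 (Finset.mem_filter.1 hw).1
      rw [hf.eq_of_upper hzw]
  choose! b hb using hD1
  -- The choice `b` may pick another lower vertex in the block of `x`; the update makes the frame
  -- end in `y`.
  have hb' : ∀ z ∈ E, α.rel (.inl z) (.inr (Function.update b x y z)) := by
    intro z hz
    by_cases h : z = x
    · subst h; simpa using hxy
    · rw [Function.update_of_ne h]; exact hb z (hE2 hz)
  obtain ⟨u, h1, h2, h3, h4⟩ := hα.exists_frame_of_finset E hE3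
    (fun z hz w hw => hD2 z (hE2 hz) w (hE2 hw)) _ hb'
  obtain ⟨i, rfl⟩ := (h4 x).1 (hE1 (Finset.mem_singleton_self x))
  exact ⟨u, _, h1, h2, h3, i, rfl, by simp⟩

theorem IsPlanar.exists_frame {α : PartitionMonoid n} {p : ℕ} (hα : IsPlanar α) (hp : p ≤ α.rank) :
    ∃ s t : Fin p → Fin n, StrictMono s ∧ StrictMono t ∧ IsFrame α s t := by
  rcases Nat.eq_zero_or_pos p with rfl | h
  · exact ⟨Fin.elim0, Fin.elim0, fun i => i.elim0, fun i => i.elim0, fun i => i.elim0⟩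
  · obtain ⟨s, t, hf⟩ := α.exists_isFrame
    obtain ⟨u, v, h1, h2, h3, _⟩ := hα.exists_frame_through h hp
      ((hf ⟨0, by omega⟩ ⟨0, by omega⟩).2 rfl)
    exact ⟨u, v, h1, h2, h3⟩

/-! ### Partial order-preserving bijections -/

/-- The partition with transversals `{k, (s k)'}` for `k < p` whose other blocks are singletons. -/
def pick [NeZero n] {p : ℕ} (s : Fin p → Fin n) : PartitionMonoid n := strand s 0 0

section

variable [NeZero n] {p : ℕ} {s t : Fin p → Fin n} {α : PartitionMonoid n}

theorem pick_mul_inl_inr (hs : StrictMono s) {k j : Fin n} :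
    (pick s * α).rel (.inl k) (.inr j) ↔
      ∃ hk : k.val < p, α.rel (.inl (s ⟨k, hk⟩)) (.inr j) := by
  exact (strand_mul_inl_inr (isClear_self hs 0)).trans (exists_congr fun _ => mergeLabel_self)

theorem pick_mul_inr_inr (hs : StrictMono s) {i j : Fin n} :
    (pick s * α).rel (.inr i) (.inr j) ↔ α.rel (.inr i) (.inr j) := by
  exact (strand_mul_inr_inr (isClear_self hs 0)).trans mergeLabel_self

theorem pick_mul_inl_inl (hs : StrictMono s) {k l : Fin n} :
    (pick s * α).rel (.inl k) (.inl l) ↔ k = l ∨ ∃ (hk : k.val < p) (hl : l.val < p),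
      α.rel (.inl (s ⟨k, hk⟩)) (.inl (s ⟨l, hl⟩)) := by
  exact (strand_mul_inl_inl (isClear_self hs 0)).trans
    (or_congr_right (exists_congr fun _ => exists_congr fun _ => mergeLabel_self))

theorem mul_star_pick_inl_inr (ht : StrictMono t) {k j : Fin n} :
    (α * star (pick t)).rel (.inl k) (.inr j) ↔
      ∃ hj : j.val < p, α.rel (.inl k) (.inr (t ⟨j, hj⟩)) := by
  rw [mul_star_rel, rel_comm]
  exact (pick_mul_inl_inr ht).trans (exists_congr fun _ => rel_comm)

theorem mul_star_pick_inl_inl (ht : StrictMono t) {i j : Fin n} :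
    (α * star (pick t)).rel (.inl i) (.inl j) ↔ α.rel (.inl i) (.inl j) := by
  rw [mul_star_rel]
  exact pick_mul_inr_inr ht

theorem mul_star_pick_inr_inr (ht : StrictMono t) {k l : Fin n} :
    (α * star (pick t)).rel (.inr k) (.inr l) ↔ k = l ∨ ∃ (hk : k.val < p) (hl : l.val < p),
      α.rel (.inr (t ⟨k, hk⟩)) (.inr (t ⟨l, hl⟩)) := by
  rw [mul_star_rel]
  exact pick_mul_inl_inl ht

/-- The compression of `α` to the vertices `s k` and `(t k)'`. -/
def compress (α : PartitionMonoid n) (s t : Fin p → Fin n) : PartitionMonoid n :=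
  pick s * α * star (pick t)

theorem compress_inl_inr (hs : StrictMono s) (ht : StrictMono t) {k j : Fin n} :
    (compress α s t).rel (.inl k) (.inr j) ↔ ∃ (hk : k.val < p) (hj : j.val < p),
      α.rel (.inl (s ⟨k, hk⟩)) (.inr (t ⟨j, hj⟩)) := by
  exact (mul_star_pick_inl_inr ht).trans
    ((exists_congr fun _ => pick_mul_inl_inr hs).trans exists_comm)

theorem compress_inl_inl (hs : StrictMono s) (ht : StrictMono t) {k l : Fin n} :
    (compress α s t).rel (.inl k) (.inl l) ↔ k = l ∨ ∃ (hk : k.val < p) (hl : l.val < p),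
      α.rel (.inl (s ⟨k, hk⟩)) (.inl (s ⟨l, hl⟩)) := by
  exact (mul_star_pick_inl_inl ht).trans (pick_mul_inl_inl hs)

theorem compress_inr_inr (hs : StrictMono s) (ht : StrictMono t) {k l : Fin n} :
    (compress α s t).rel (.inr k) (.inr l) ↔ k = l ∨ ∃ (hk : k.val < p) (hl : l.val < p),
      α.rel (.inr (t ⟨k, hk⟩)) (.inr (t ⟨l, hl⟩)) := by
  exact (mul_star_pick_inr_inr ht).trans
    (or_congr_right (exists_congr fun _ => exists_congr fun _ => pick_mul_inr_inr hs))

theorem pick_castLE {q : ℕ} (hq : q ≤ n) : pick (Fin.castLE hq) = idBar n q := by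
  have hc := isClear_self (strictMono_castLE hq) 0
  refine ext_rows (fun i j => ?_) (fun i j => ?_) (fun i j => ?_)
  · rw [pick, strand_rel_inl_inl hc, idBar_inl_inl]
  · rw [pick, strand_rel_inl_inr hc, idBar_inl_inr]
    exact ⟨fun ⟨h, h'⟩ => ⟨h', h⟩, fun ⟨h, h'⟩ => ⟨h', h⟩⟩
  · rw [pick, strand_rel_inr_inr, idBar_inr_inr]
    grind

/-- A planar compression of full rank comes from a frame. -/
theorem IsPlanar.isFrame_of_rank_compress (hs : StrictMono s) (ht : StrictMono t)
    (hα : IsPlanar (compress α s t)) (h : p ≤ (compress α s t).rank) : IsFrame α s t := by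
  -- All transversals of the compression lie in the first `p` columns, so increasing sequences of
  -- length `p` must use the vertices `0, …, p - 1` in order on both sides.
  obtain ⟨a, b, ha, hb, hf⟩ := hα.exists_frame h
  have h1 : ∀ i, (a i).val < p ∧ (b i).val < p := fun i => by
    obtain ⟨h1, h2, _⟩ := (compress_inl_inr hs ht).1 ((hf i i).2 rfl)
    exact ⟨h1, h2⟩
  have ha' := strictMono_fin_eq ha fun i => (h1 i).1
  have hb' := strictMono_fin_eq hb fun i => (h1 i).2
  intro i j
  rw [← hf i j, compress_inl_inr hs ht]
  simp only [ha', hb', Fin.eta, Fin.is_lt, exists_true_left]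

theorem compress_eq_idBar (hs : StrictMono s) (ht : StrictMono t) (h : IsFrame α s t) :
    compress α s t = idBar n p := by
  refine ext_rows (fun i j => ?_) (fun i j => ?_) (fun i j => ?_)
  · rw [compress_inl_inl hs ht, idBar_inl_inl]
    refine ⟨fun k => ?_, Or.inl⟩
    rcases k with k | ⟨hi, hj, k⟩
    · exact k
    · simpa [Fin.ext_iff] using h.eq_of_upper k
  · rw [compress_inl_inr hs ht, idBar_inl_inr]
    simp only [h _ _, Fin.mk.injEq]
    exact ⟨fun ⟨h, _, h'⟩ => ⟨Fin.ext h', h⟩, fun ⟨h, h'⟩ => ⟨h', h ▸ h', by rw [h]⟩⟩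
  · rw [compress_inr_inr hs ht, idBar_inr_inr]
    refine ⟨fun k => ?_, Or.inl⟩
    rcases k with k | ⟨hi, hj, k⟩
    · exact k
    · simpa [Fin.ext_iff] using h.star.eq_of_upper k

/-- A frame of maximal size gives rise to an inverse. -/
theorem mul_pick_mul_eq {s t : Fin α.rank → Fin n} (hs : StrictMono s) (ht : StrictMono t)
    (h : IsFrame α s t) : (α * star (pick t)) * (pick s * α) = α := by
  have hsy : ∀ {u v}, α.rel u v → α.rel v u := fun h => α.rel.symm h
  have htr : ∀ {u v w}, α.rel u v → α.rel v w → α.rel u w := fun h h' => α.rel.trans h h'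
  ext v w
  constructor
  · intro hvw
    -- A middle vertex `i` below the rank stands for the block of the transversal through `s i`; the
    -- remaining middle vertices are isolated. Constancy along edges shows that the product creates
    -- no connection absent from `α`.
    let F : Vertex n → Quotient α.rel ⊕ Fin n := fun u => match u with
      | .top i => .inl (Quotient.mk _ (.inl i))
      | .mid i => if hi : i.val < α.rank then .inl (Quotient.mk _ (.inl (s ⟨i, hi⟩))) else .inr i
      | .bot i => .inl (Quotient.mk _ (.inr i))
    have hq : ∀ {u v}, α.rel u v → Quotient.mk α.rel u = Quotient.mk α.rel v := Quotient.sound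
    have key : F (inOuter v) = F (inOuter w) := by
      refine Joined.map_eq hvw F ?_ ?_
      · have k2 : ∀ i j, (α * star (pick t)).rel (.inl i) (.inr j) → F (.top i) = F (.mid j) := by
          intro i j hij
          obtain ⟨hj, hij⟩ := (mul_star_pick_inl_inr ht).1 hij
          simp only [F, dif_pos hj]
          rw [hq (htr hij (hsy ((h _ _).2 rfl)))]
        rintro (i | i) (j | j) hij
        · exact congrArg Sum.inl (hq ((mul_star_pick_inl_inl ht).1 hij))
        · exact k2 i j hij
        · exact (k2 j i ((α * star (pick t)).rel.symm hij)).symm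
        · rcases (mul_star_pick_inr_inr ht).1 hij with rfl | ⟨hi, hj, k⟩
          · rfl
          · have := h.star.eq_of_upper k
            simp only [Fin.mk.injEq] at this
            rw [Fin.ext this]
      · have k2 : ∀ i j, (pick s * α).rel (.inl i) (.inr j) → F (.mid i) = F (.bot j) := by
          intro i j hij
          obtain ⟨hi, hij⟩ := (pick_mul_inl_inr hs).1 hij
          simp only [F, dif_pos hi]
          rw [hq hij]
        rintro (i | i) (j | j) hij
        · rcases (pick_mul_inl_inl hs).1 hij with rfl | ⟨hi, hj, k⟩
          · rfl
          · have := h.eq_of_upper k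
            simp only [Fin.mk.injEq] at this
            rw [Fin.ext this]
        · exact k2 i j hij
        · exact (k2 j i ((pick s * α).rel.symm hij)).symm
        · exact congrArg Sum.inl (hq ((pick_mul_inr_inr hs).1 hij))
    have hF : ∀ u, F (inOuter u) = .inl (Quotient.mk _ u) := by rintro (u | u) <;> rfl
    rw [hF, hF] at key
    exact Quotient.exact (Sum.inl_injective key)
  · have k : ∀ i j, α.rel (.inl i) (.inr j) →
        ((α * star (pick t)) * (pick s * α)).rel (.inl i) (.inr j) := by
      intro i j hij
      obtain ⟨l, hl⟩ := h.exists_rel hij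
      have hln : l.val < n := l.isLt.trans_le α.rank_le
      have h1 : Joined (α * star (pick t)) (pick s * α) (.top i) (.mid ⟨l, hln⟩) :=
        Joined.upper (x := .inl i) (y := .inr ⟨l, hln⟩)
          ((mul_star_pick_inl_inr ht).2 ⟨l.isLt, htr hl ((h _ _).2 rfl)⟩)
      have h2 : Joined (α * star (pick t)) (pick s * α) (.mid ⟨l, hln⟩) (.bot j) :=
        Joined.lower (x := .inl ⟨l, hln⟩) (y := .inr j)
          ((pick_mul_inl_inr hs).2 ⟨l.isLt, htr (hsy hl) hij⟩)
      exact h1.trans h2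
    intro hvw
    rcases v with v | v <;> rcases w with w | w
    · exact ker_mul_of ((mul_star_pick_inl_inl ht).2 hvw)
    · exact k v w hvw
    · exact ((α * star (pick t)) * (pick s * α)).rel.symm (k w v (hsy hvw))
    · exact coker_mul_of ((pick_mul_inr_inr hs).2 hvw)

end

/-! ### Flattening and detaching -/

/-- The partition of rank `0` with the same kernel and cokernel. -/
def flatten (α : PartitionMonoid n) : PartitionMonoid n where
  rel :=
    { r := fun x y => α.rel x y ∧ x.isLeft = y.isLeft
      iseqv := ⟨fun x => ⟨α.rel.refl x, rfl⟩, fun h => ⟨α.rel.symm h.1, h.2.symm⟩,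
        fun h h' => ⟨α.rel.trans h.1 h'.1, h.2.trans h'.2⟩⟩ }

theorem rank_flatten (α : PartitionMonoid n) : (flatten α).rank = 0 :=
  rank_eq_zero_iff.2 fun _ _ h => by simpa using h.2

theorem ker_flatten (α : PartitionMonoid n) : (flatten α).ker = α.ker := by
  ext x y
  exact ⟨fun h => h.1, fun h => ⟨h, rfl⟩⟩

theorem coker_flatten (α : PartitionMonoid n) : (flatten α).coker = α.coker := by
  ext x y
  exact ⟨fun h => h.1, fun h => ⟨h, rfl⟩⟩

theorem IsPlanar.flatten {α : PartitionMonoid n} (hα : IsPlanar α) : IsPlanar (flatten α) := by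
  intro a b c d h1 h2 h3 ⟨h4, h4'⟩ ⟨h5, h5'⟩
  refine ⟨hα a b c d h1 h2 h3 h4 h5, ?_⟩
  rcases a with a | a <;> rcases b with b | b <;> rcases c with c | c <;> rcases d with d | d <;>
    simp only [boundaryPos, Sum.elim_inl, Sum.elim_inr, Sum.isLeft_inl, Sum.isLeft_inr,
      reduceCtorEq] at * <;> omega

theorem HasSmallBlocks.flatten {α : PartitionMonoid n} (hα : HasSmallBlocks α) :
    HasSmallBlocks (flatten α) :=
  hasSmallBlocks_of fun _ _ _ h h' hne => hα.eq_or h.1 h'.1 hne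

open Classical in
/-- The labelling whose fibres are the blocks of `detach α a l r`. -/
noncomputable def detachLabel (α : PartitionMonoid n) (a l r : Fin n) :
    Fin n ⊕ Fin n → Quotient α.rel ⊕ Fin n
  | .inl w => if w = a then .inr l else if α.rel (.inl w) (.inl a) then .inr r else
      .inl (Quotient.mk _ (.inl w))
  | .inr j => .inr j

/-- The vertex `a` is removed from its kernel class in `α` and made part of the transversal
`{a, l'}`, the remainder of the class is connected with `r'`, and the lower blocks are trivial. -/
noncomputable def detach (α : PartitionMonoid n) (a l r : Fin n) : PartitionMonoid n where
  rel := Setoid.ker (detachLabel α a l r)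

section

variable {α : PartitionMonoid n} {a l r : Fin n}

theorem detach_inr_inr {i j : Fin n} :
    (detach α a l r).rel (.inr i) (.inr j) ↔ i = j := by
  show Sum.inr i = Sum.inr j ↔ _
  simp

theorem detach_inl_inr {w j : Fin n} :
    (detach α a l r).rel (.inl w) (.inr j) ↔
      (w = a ∧ j = l) ∨ (w ≠ a ∧ α.rel (.inl w) (.inl a) ∧ j = r) := by
  show detachLabel α a l r (.inl w) = detachLabel α a l r (.inr j) ↔ _
  simp only [detachLabel]
  split_ifs with h h' <;> simp [h, eq_comm]
  · exact fun _ => h'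
  · exact fun k => absurd k h'

theorem detach_inl_inl (hlr : l ≠ r) {w v : Fin n} :
    (detach α a l r).rel (.inl w) (.inl v) ↔
      w = v ∨ (w ≠ a ∧ v ≠ a ∧ α.rel (.inl w) (.inl v)) := by
  have hs : ∀ {u v}, α.rel u v → α.rel v u := fun h => α.rel.symm h
  have ht : ∀ {u v w}, α.rel u v → α.rel v w → α.rel u w := fun h h' => α.rel.trans h h'
  have hq : ∀ {u v}, (Quotient.mk α.rel u = Quotient.mk α.rel v) ↔ α.rel u v := Quotient.eq
  have hr : ∀ u, α.rel u u := α.rel.refl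
  show detachLabel α a l r (.inl w) = detachLabel α a l r (.inl v) ↔ _
  by_cases hw : w = a
  · by_cases hv : v = a
    · simp [hw, hv]
    · by_cases hv' : α.rel (.inl v) (.inl a) <;> simp [detachLabel, hw, hv, hv', hlr, Ne.symm hv]
  · by_cases hv : v = a
    · by_cases hw' : α.rel (.inl w) (.inl a) <;> simp [detachLabel, hw, hv, hw', hlr.symm]
    · by_cases hw' : α.rel (.inl w) (.inl a) <;> by_cases hv' : α.rel (.inl v) (.inl a) <;>
        simp only [detachLabel, hw, hv, hw', hv', if_true, if_false, reduceCtorEq,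
          Sum.inl.injEq, hq, ne_eq, not_false_iff, true_and, false_iff, true_iff, not_or]
      · exact Or.inr (ht hw' (hs hv'))
      · exact ⟨fun h => hv' (h ▸ hw'), fun h => hv' (ht (hs h) hw')⟩
      · exact ⟨fun h => hw' (h ▸ hv'), fun h => hw' (ht h hv')⟩
      · exact ⟨Or.inr, fun h => h.elim (fun h => h ▸ hr _) id⟩

/-- All vertices to the left of `a` are kernel singletons, so the new transversal from `a` can be
drawn to the left of every non-trivial class and of the transversal that carries the remainder of
the class. -/
theorem IsPlanar.detach (hα : IsPlanar α) (hlr : l < r)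
    (ha : ∀ w v, w < a → α.rel (.inl w) (.inl v) → w = v) : IsPlanar (detach α a l r) := by
  have hne := hlr.ne
  have hs : ∀ {u v}, α.rel u v → α.rel v u := fun h => α.rel.symm h
  have ht : ∀ {u v w}, α.rel u v → α.rel v w → α.rel u w := fun h h' => α.rel.trans h h'
  have hsy : ∀ {u v}, (PartitionMonoid.detach α a l r).rel u v →
    (PartitionMonoid.detach α a l r).rel v u := fun h => (PartitionMonoid.detach α a l r).rel.symm h
  intro x y z w h1 h2 h3 h4 h5
  rcases x with x | x <;> rcases y with y | y <;> rcases z with z | z <;> rcases w with w | w <;>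
    try (simp only [boundaryPos, Sum.elim_inl, Sum.elim_inr] at h1 h2 h3; omega)
  · rw [detach_inl_inl hne] at *
    simp only [boundaryPos, Sum.elim_inl] at h1 h2 h3
    rcases h4 with rfl | ⟨h4, h4', h4''⟩
    · omega
    rcases h5 with rfl | ⟨h5, h5', h5''⟩
    · omega
    exact Or.inr ⟨h4, h5, hα _ _ _ _ (by simpa [boundaryPos]) (by simpa [boundaryPos])
      (by simpa [boundaryPos]) h4'' h5''⟩
  · rw [detach_inl_inl hne] at *
    rw [detach_inl_inr] at h5
    simp only [boundaryPos, Sum.elim_inl, Sum.elim_inr] at h1 h2 h3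
    rcases h4 with rfl | ⟨h4, h4', h4''⟩
    · omega
    -- The class of `x` and `z` is non-trivial and hence starts to the right of `a`; if it encloses
    -- a vertex `y` of the class of `a`, planarity of `α` forces the two classes to coincide.
    have hxa : a < x := by
      by_contra hc
      have := ha x z (by omega) h4''
      omega
    rcases h5 with ⟨rfl, rfl⟩ | ⟨h5, h6, rfl⟩
    · omega
    · exact Or.inr ⟨h4, h5, ht (hs (hα (.inl a) (.inl x) (.inl y) (.inl z) (by simpa [boundaryPos])
        (by simpa [boundaryPos]) (by simpa [boundaryPos]) (hs h6) h4'')) (hs h6)⟩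
  · rw [detach_inl_inr] at h4 h5
    simp only [boundaryPos, Sum.elim_inl, Sum.elim_inr] at h1 h2 h3
    rcases h4 with ⟨rfl, rfl⟩ | ⟨h4, h4', rfl⟩ <;> rcases h5 with ⟨rfl, rfl⟩ | ⟨h5, h5', rfl⟩
    · omega
    · omega
    · have := ha x y (by omega) h4'
      omega
    · omega
  · rw [detach_inr_inr] at h5
    subst h5; omega
  · rw [detach_inr_inr] at h5
    subst h5; omega

theorem HasSmallBlocks.detach (hα : HasSmallBlocks α) (hlr : l ≠ r) :
    HasSmallBlocks (detach α a l r) := by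
  have hs : ∀ {u v}, α.rel u v → α.rel v u := fun h => α.rel.symm h
  have hsy : ∀ {u v}, (PartitionMonoid.detach α a l r).rel u v →
    (PartitionMonoid.detach α a l r).rel v u := fun h => (PartitionMonoid.detach α a l r).rel.symm h
  have key := fun {x y z : Fin n} (h : α.rel (.inl x) (.inl y)) (h' : α.rel (.inl x) (.inl z))
    (hne : x ≠ y) => by simpa using hα.eq_or h h' (by simpa using hne)
  apply hasSmallBlocks_of
  intro x y z h h' hne
  rcases x with x | x <;> rcases y with y | y
  · have hne' : x ≠ y := fun e => hne (congrArg _ e)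
    rcases (detach_inl_inl hlr).1 h with rfl | ⟨h1, h2, h3⟩
    · exact absurd rfl hne
    rcases z with z | z
    · rcases (detach_inl_inl hlr).1 h' with rfl | ⟨_, _, h4⟩
      · exact Or.inl rfl
      · exact (key h3 h4 hne').imp (congrArg _) (congrArg _)
    · exfalso
      rcases detach_inl_inr.1 h' with ⟨h4, _⟩ | ⟨_, h4, _⟩
      · exact h1 h4
      · exact (key h3 h4 hne').elim (fun e => h1 e.symm) (fun e => h2 e.symm)
  · have h1 := detach_inl_inr.1 h
    rcases z with z | z
    · rcases (detach_inl_inl hlr).1 h' with rfl | ⟨h2, h3, h4⟩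
      · exact Or.inl rfl
      · rcases h1 with ⟨h1, _⟩ | ⟨_, h1, _⟩
        · exact absurd h1 h2
        · exact (key h1 h4 h2).elim (fun e => Or.inl (congrArg _ e)) (fun e => absurd e h3)
    · have h2 := detach_inl_inr.1 h'
      right
      congr 1
      grind
  · have h1 := detach_inl_inr.1 (hsy h)
    rcases z with z | z
    · have h2 := detach_inl_inr.1 (hsy h')
      right
      congr 1
      rcases h1 with ⟨rfl, rfl⟩ | ⟨h1, h3, rfl⟩ <;> rcases h2 with ⟨rfl, h2⟩ | ⟨h2, h4, h5⟩
      · rfl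
      · exact absurd h5 hlr
      · exact absurd h2.symm hlr
      · exact (key h3 (α.rel.trans h3 (hs h4)) h1).elim id fun e => absurd e h2
    · exact Or.inl (congrArg _ (detach_inr_inr.1 h').symm)
  · exact absurd (congrArg _ (detach_inr_inr.1 h)) hne

end

/-- Since `θ` joins no two different middle vertices, repeated excursions into `γ` reduce to a
single one. The labelling `F` in the proof is the resulting description of the component of `w`. -/
theorem mul_rel_inl_inl_of_coker {θ γ : PartitionMonoid n}
    (hθ : ∀ i j, θ.rel (.inr i) (.inr j) → i = j) {w v : Fin n} :
    (θ * γ).rel (.inl w) (.inl v) ↔ θ.rel (.inl w) (.inl v) ∨ ∃ i j, θ.rel (.inl w) (.inr i) ∧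
      γ.rel (.inl i) (.inl j) ∧ θ.rel (.inl v) (.inr j) := by
  have hs : ∀ {u v}, θ.rel u v → θ.rel v u := fun h => θ.rel.symm h
  have ht : ∀ {u v w}, θ.rel u v → θ.rel v w → θ.rel u w := fun h h' => θ.rel.trans h h'
  have hs' : ∀ {u v}, γ.rel u v → γ.rel v u := fun h => γ.rel.symm h
  have ht' : ∀ {u v w}, γ.rel u v → γ.rel v w → γ.rel u w := fun h h' => γ.rel.trans h h'
  constructor
  · intro h
    let F : Vertex n → Prop := fun u => match u with
      | .top v => θ.rel (.inl w) (.inl v) ∨ ∃ i j, θ.rel (.inl w) (.inr i) ∧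
        γ.rel (.inl i) (.inl j) ∧ θ.rel (.inl v) (.inr j)
      | .mid j => ∃ i, θ.rel (.inl w) (.inr i) ∧ γ.rel (.inl i) (.inl j)
      | .bot j => ∃ i, θ.rel (.inl w) (.inr i) ∧ γ.rel (.inl i) (.inr j)
    have key : F (.top w) = F (.top v) := by
      refine Joined.map_eq h F ?_ ?_
      · have k : ∀ x y, θ.rel x y → F (inUpper x) → F (inUpper y) := by
          rintro (x | x) (y | y) hxy hF
          · rcases hF with hF | ⟨i, j, h1, h2, h3⟩
            · exact Or.inl (ht hF hxy)
            · exact Or.inr ⟨i, j, h1, h2, ht (hs hxy) h3⟩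
          · rcases hF with hF | ⟨i, j, h1, h2, h3⟩
            · exact ⟨y, ht hF hxy, γ.rel.refl _⟩
            · have := hθ _ _ (ht (hs hxy) h3)
              subst this
              exact ⟨i, h1, h2⟩
          · obtain ⟨i, h1, h2⟩ := hF
            exact Or.inr ⟨i, x, h1, h2, hs hxy⟩
          · have := hθ _ _ hxy
            subst this; exact hF
        exact fun x y hxy => propext ⟨k x y hxy, k y x (hs hxy)⟩
      · have k : ∀ x y, γ.rel x y → F (inLower x) → F (inLower y) := by
          rintro (x | x) (y | y) hxy ⟨i, h1, h2⟩ <;> exact ⟨i, h1, ht' h2 hxy⟩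
        exact fun x y hxy => propext ⟨k x y hxy, k y x (hs' hxy)⟩
    exact key.mp (Or.inl (θ.rel.refl _))
  · rintro (h | ⟨i, j, h1, h2, h3⟩)
    · exact ker_mul_of h
    · have e1 : Joined θ γ (.top w) (.mid i) := Joined.upper (α := θ) (β := γ) h1
      have e2 : Joined θ γ (.mid i) (.mid j) := Joined.lower (α := θ) (β := γ) h2
      have e3 : Joined θ γ (.top v) (.mid j) := Joined.upper (α := θ) (β := γ) h3
      exact (e1.trans e2).trans e3.symm

/-! ### The monoids under consideration -/

/-- The closure properties of the two monoids that are used in the classification. -/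
structure IsAdmissible (K : Submonoid (PartitionMonoid n)) : Prop where
  planar : ∀ {α}, α ∈ K → IsPlanar α
  star_mem : ∀ {α}, α ∈ K → star α ∈ K
  strand_mem : ∀ {p : ℕ} {s : Fin p → Fin n} {x y : Fin n}, IsClear s x y → strand s x y ∈ K
  flatten_mem : ∀ {α}, α ∈ K → flatten α ∈ K
  detach_mem : ∀ {α} {a l r : Fin n}, α ∈ K → l < r →
    (∀ w v, w < a → α.rel (.inl w) (.inl v) → w = v) → detach α a l r ∈ K

/-- From here on the two monoids are treated alike, through these closure properties. -/
theorem isAdmissible {K : Submonoid (PartitionMonoid n)}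
    (hK : K = planarPartitionMonoid n ∨ K = motzkinMonoid n) : IsAdmissible K := by
  rcases hK with rfl | rfl
  · exact ⟨id, IsPlanar.star, isPlanar_strand, IsPlanar.flatten, IsPlanar.detach⟩
  · exact ⟨fun h => h.2, fun h => ⟨HasSmallBlocks.star h.1, IsPlanar.star h.2⟩,
      fun h => ⟨hasSmallBlocks_strand h, isPlanar_strand h⟩,
      fun h => ⟨HasSmallBlocks.flatten h.1, IsPlanar.flatten h.2⟩,
      fun h h1 h2 => ⟨HasSmallBlocks.detach h.1 h1.ne, IsPlanar.detach h.2 h1 h2⟩⟩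

/-! ### Congruences -/

section

variable {K : Submonoid (PartitionMonoid n)} {α β : PartitionMonoid n}

/-- `T` is a congruence of `K`, viewed as a relation on the partition monoid. -/
structure IsCongOn (K : Submonoid (PartitionMonoid n))
    (T : PartitionMonoid n → PartitionMonoid n → Prop) : Prop where
  mem_left : ∀ {α β}, T α β → α ∈ K
  refl : ∀ {α}, α ∈ K → T α α
  symm : ∀ {α β}, T α β → T β α
  trans : ∀ {α β γ}, T α β → T β γ → T α γ
  mul_left : ∀ {α β γ}, γ ∈ K → T α β → T (γ * α) (γ * β)
  mul_right : ∀ {α β γ}, γ ∈ K → T α β → T (α * γ) (β * γ)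

namespace IsCongOn

variable {T : PartitionMonoid n → PartitionMonoid n → Prop}

theorem mem_right (hT : IsCongOn K T) (h : T α β) : β ∈ K := hT.mem_left (hT.symm h)

theorem starRel (hT : IsCongOn K T) (hK : IsAdmissible K) :
    IsCongOn K fun α β => T (star α) (star β) where
  mem_left h := by simpa [star_star'] using hK.star_mem (hT.mem_left h)
  refl h := hT.refl (hK.star_mem h)
  symm := hT.symm
  trans := hT.trans
  mul_left hγ h := by
    simp only [star_mul']; exact hT.mul_right (hK.star_mem hγ) h
  mul_right hγ h := by
    simp only [star_mul']; exact hT.mul_left (hK.star_mem hγ) h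

end IsCongOn

end

section

variable [NeZero n] {K : Submonoid (PartitionMonoid n)} {p q : ℕ} {α β : PartitionMonoid n}

/-! ### Factorizations through the partial identities -/

theorem idBar_mul_pick (hq : q ≤ n) (hpq : p ≤ q) {s : Fin p → Fin n} (hs : StrictMono s) :
    idBar n q * pick s = pick s := by
  have hc := isClear_self hs 0
  rw [← pick_castLE hq]
  refine ext_rows (fun i j => ?_) (fun i j => ?_) (fun i j => ?_)
  · rw [pick_mul_inl_inl (strictMono_castLE hq)]
    rw [pick, strand_rel_inl_inl hc]
    refine ⟨?_, Or.inl⟩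
    rintro (h | ⟨hi, hj, h⟩)
    · exact h
    · simpa [Fin.ext_iff] using (strand_rel_inl_inl hc).1 h
  · rw [pick_mul_inl_inr (strictMono_castLE hq)]
    refine ⟨fun ⟨_, h⟩ => h, fun h => ⟨?_, h⟩⟩
    obtain ⟨h, _⟩ := (strand_rel_inl_inr hc).1 h
    exact h.trans_le hpq
  · exact pick_mul_inr_inr (strictMono_castLE hq)

theorem idBar_mul_self (hq : q ≤ n) : idBar n q * idBar n q = idBar n q := by
  simpa only [pick_castLE hq] using idBar_mul_pick hq le_rfl (strictMono_castLE hq)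

namespace IsAdmissible

variable (hK : IsAdmissible K)
include hK

theorem pick_mem {s : Fin p → Fin n} (hs : StrictMono s) : pick s ∈ K :=
  hK.strand_mem (isClear_self hs 0)

theorem idBar_mem (hq : q ≤ n) : idBar n q ∈ K :=
  pick_castLE hq ▸ hK.pick_mem (strictMono_castLE hq)

theorem compress_mem {s t : Fin p → Fin n} (hs : StrictMono s) (ht : StrictMono t) (hα : α ∈ K) :
    compress α s t ∈ K :=
  K.mul_mem (K.mul_mem (hK.pick_mem hs) hα) (hK.star_mem (hK.pick_mem ht))

theorem exists_eq_mul_idBar_mul (hα : α ∈ K) (hq : q ≤ n) (hαq : α.rank ≤ q) :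
    ∃ x ∈ K, ∃ y ∈ K, α = x * idBar n q * y := by
  obtain ⟨s, t, hs, ht, h⟩ := (hK.planar hα).exists_frame le_rfl
  refine ⟨_, K.mul_mem hα (hK.star_mem (hK.pick_mem ht)), _, K.mul_mem (hK.pick_mem hs) hα, ?_⟩
  conv_lhs => rw [← mul_pick_mul_eq hs ht h]
  rw [mul_assoc _ (idBar n q), ← mul_assoc (idBar n q), idBar_mul_pick hq hαq hs]

theorem exists_mul_mul_eq_idBar (hα : α ∈ K) (hp : p ≤ α.rank) :
    ∃ x ∈ K, ∃ y ∈ K, x * α * y = idBar n p := by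
  obtain ⟨s, t, hs, ht, h⟩ := (hK.planar hα).exists_frame hp
  exact ⟨_, hK.pick_mem hs, _, hK.star_mem (hK.pick_mem ht), compress_eq_idBar hs ht h⟩

theorem exists_eq_mul_mul (hα : α ∈ K) : ∃ w ∈ K, α = α * w * α := by
  obtain ⟨s, t, hs, ht, h⟩ := (hK.planar hα).exists_frame le_rfl
  refine ⟨_, K.mul_mem (hK.star_mem (hK.pick_mem ht)) (hK.pick_mem hs), ?_⟩
  conv_lhs => rw [← mul_pick_mul_eq hs ht h]
  simp only [mul_assoc]

/-- Both directions of divisibility pass through a partial identity: `idBar n β.rank` is a multiple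
of `β`, and every element of rank at most `β.rank` is a multiple of it. -/
theorem exists_eq_mul_mul_iff (hα : α ∈ K) (hβ : β ∈ K) :
    (∃ x ∈ K, ∃ y ∈ K, α = x * β * y) ↔ α.rank ≤ β.rank := by
  constructor
  · rintro ⟨x, _, y, _, rfl⟩
    exact (rank_mul_le_left _ _).trans (rank_mul_le_right _ _)
  · intro h
    obtain ⟨x, hx, y, hy, h1⟩ := hK.exists_eq_mul_idBar_mul hα β.rank_le h
    obtain ⟨u, hu, v, hv, h2⟩ := hK.exists_mul_mul_eq_idBar hβ le_rfl
    refine ⟨x * u, K.mul_mem hx hu, v * y, K.mul_mem hv hy, ?_⟩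
    rw [h1, ← h2]
    simp only [mul_assoc]

end IsAdmissible

theorem IsCongOn.compress {T : PartitionMonoid n → PartitionMonoid n → Prop}
    (hT : IsCongOn K T) (hK : IsAdmissible K) {s t : Fin p → Fin n}
    (hs : StrictMono s) (ht : StrictMono t) (h : T α β) : T (compress α s t) (compress β s t) :=
  hT.mul_right (hK.star_mem (hK.pick_mem ht)) (hT.mul_left (hK.pick_mem hs) h)

/-! ### Relations that preserve ranks -/

/-- No element of rank `p` is related to an element of smaller rank. -/
def NoDrop (p : ℕ) (T : PartitionMonoid n → PartitionMonoid n → Prop) : Prop :=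
  ∀ α β, T α β → α.rank = p → p ≤ β.rank

section

variable {T : PartitionMonoid n → PartitionMonoid n → Prop} (hK : IsAdmissible K)
  (hT : IsCongOn K T) (hd : NoDrop p T)
include hK hT hd

/-- The compression of `α` is `idBar n p`, of rank exactly `p`. The related compression of `β`
cannot have smaller rank, and a planar compression of full rank comes from a frame. -/
theorem NoDrop.isFrame {s t : Fin p → Fin n} (hs : StrictMono s) (ht : StrictMono t)
    (h : T α β) (hf : IsFrame α s t) : IsFrame β s t := by
  have h1 := hT.compress hK hs ht h
  refine IsPlanar.isFrame_of_rank_compress hs ht (hK.planar (hT.mem_right h1)) (hd _ _ h1 ?_)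
  rw [compress_eq_idBar hs ht hf, rank_idBar (le_of_strictMono hs)]

theorem NoDrop.le_rank (h : T α β) (hp : p ≤ α.rank) : p ≤ β.rank := by
  obtain ⟨s, t, hs, ht, hf⟩ := (hK.planar (hT.mem_left h)).exists_frame hp
  exact (hd.isFrame hK hT hs ht h hf).le_rank

theorem NoDrop.rel_inl_inr (hp1 : 1 ≤ p) (h : T α β) (hp : p ≤ α.rank) {x y : Fin n}
    (hxy : α.rel (.inl x) (.inr y)) : β.rel (.inl x) (.inr y) := by
  obtain ⟨s, t, hs, ht, hf, i, rfl, rfl⟩ :=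
    (hK.planar (hT.mem_left h)).exists_frame_through hp1 hp hxy
  exact (hd.isFrame hK hT hs ht h hf i i).2 rfl

/-- If `u` and `v` are not on transversals of `α`, then they can be used to replace the vertex
`s i` of a frame. -/
theorem NoDrop.rel_of_update (h : T α β) {s t : Fin p → Fin n} (hf : IsFrame α s t)
    (ht : StrictMono t) (i : Fin p) {u v c d : Fin n}
    (hcd : (c = v ∧ d = s i) ∨ (c = s i ∧ d = v)) (hc : IsClear (Function.update s i u) c d)
    (hu : ∀ z, ¬ α.rel (.inl u) (.inr z)) (hv : ∀ z, ¬ α.rel (.inl v) (.inr z))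
    (hu' : ∀ z, ¬ β.rel (.inl u) (.inr z)) (hi : β.rel (.inl (s i)) (.inr (t i)))
    (huv : α.rel (.inl u) (.inl v)) : β.rel (.inl u) (.inl v) := by
  have hpn := le_of_strictMono ht
  have hmerge : ∀ (γ : PartitionMonoid n) a b, mergeLabel γ c d a = mergeLabel γ c d b ↔
      γ.rel a b ∨ (γ.rel a (.inl v) ∧ γ.rel b (.inl (s i))) ∨
        (γ.rel a (.inl (s i)) ∧ γ.rel b (.inl v)) := by
    intro γ a b
    rw [mergeLabel_eq_iff]
    rcases hcd with ⟨rfl, rfl⟩ | ⟨rfl, rfl⟩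
    · rfl
    · rw [or_comm (a := _ ∧ _)]
  -- The upper vertex `i` reaches `(t i)'` by way of `u`, `v` and `s i`: the first link is a block
  -- of `α`, the second is the lower block of the strand.
  have hf1 : IsFrame (strand (Function.update s i u) c d * α) (Fin.castLE hpn) t := by
    intro k j
    rw [strand_mul_inl_inr hc]
    simp only [Fin.val_castLE, Fin.eta, Fin.is_lt, exists_true_left, hmerge]
    have hv1 := fun z h => hv z (α.rel.symm h)
    by_cases hk : k = i
    · subst hk
      simp only [Function.update_self]
      constructor
      · rintro (h | ⟨_, h⟩ | ⟨_, h⟩)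
        · exact absurd h (hu _)
        · exact (hf _ _).1 (α.rel.symm h)
        · exact absurd h (hv1 _)
      · rintro rfl
        exact Or.inr (Or.inl ⟨huv, α.rel.symm ((hf _ _).2 rfl)⟩)
    · rw [Function.update_of_ne hk]
      constructor
      · rintro (h | ⟨h, h'⟩ | ⟨_, h⟩)
        · exact (hf _ _).1 h
        · exact absurd (α.rel.trans (α.rel.symm h) ((hf k k).2 rfl)) (hv _)
        · exact absurd h (hv1 _)
      · rintro rfl
        exact Or.inl ((hf _ _).2 rfl)
  have hf2 := hd.isFrame hK hT (strictMono_castLE hpn) ht (hT.mul_left (hK.strand_mem hc) h) hf1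
  -- As `u` is on no transversal of `β`, its connection with `(t i)'` must use the lower block of
  -- the strand, entering it at `v`.
  have h3 := (hf2 i i).2 rfl
  rw [strand_mul_inl_inr hc] at h3
  simp only [Fin.val_castLE, Fin.eta, Fin.is_lt, exists_true_left, hmerge,
    Function.update_self] at h3
  rcases h3 with h3 | ⟨h3, _⟩ | ⟨h3, _⟩
  · exact absurd h3 (hu' _)
  · exact h3
  · exact absurd (β.rel.trans h3 hi) (hu' _)

/-- Blocks on transversals are already known to be preserved. A pair off the transversals is made
visible by substituting one of its vertices into a frame. -/
theorem NoDrop.ker_of_lt (hp1 : 1 ≤ p) (h : T α β) (hp : p ≤ α.rank) {x y : Fin n} (hlt : x < y)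
    (hxy : α.rel (.inl x) (.inl y)) : β.rel (.inl x) (.inl y) := by
  have h1 := fun {a b} => hd.rel_inl_inr hK hT hp1 h hp (x := a) (y := b)
  have h2 := fun {a b} => hd.rel_inl_inr hK hT hp1 (hT.symm h) (hd.le_rank hK hT h hp)
    (x := a) (y := b)
  by_cases hx : ∃ z, α.rel (.inl x) (.inr z)
  · obtain ⟨z, hz⟩ := hx
    exact β.rel.trans (h1 hz) (β.rel.symm (h1 (α.rel.trans (α.rel.symm hxy) hz)))
  push Not at hx
  have hy : ∀ z, ¬ α.rel (.inl y) (.inr z) := fun z hz => hx z (α.rel.trans hxy hz)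
  have hpl := hK.planar (hT.mem_left h)
  obtain ⟨s, t, hs, ht, hf⟩ := hpl.exists_frame hp
  -- A transversal starting between `x` and `y` would cross their block.
  have hout : ∀ j, s j < x ∨ y < s j := by
    intro j
    have hj := (hf j j).2 rfl
    by_contra hc
    push Not at hc
    have hne1 : s j ≠ x := fun e => hx _ (e ▸ hj)
    have hne2 : s j ≠ y := fun e => hy _ (e ▸ hj)
    have := hpl (.inl x) (.inl (s j)) (.inl y) (.inr (t j))
      (by simp only [boundaryPos, Sum.elim_inl]; omega)
      (by simp only [boundaryPos, Sum.elim_inl]; omega)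
      (by simp only [boundaryPos, Sum.elim_inl, Sum.elim_inr]; omega) hxy hj
    exact hx _ (α.rel.trans this hj)
  -- Either `y` replaces the nearest frame vertex to the left of `x`, or all frame vertices lie to
  -- the right of `y` and `x` replaces the first one. In both cases no transversal of the new strand
  -- ends between the two vertices of its lower block.
  by_cases hL : ∃ j, s j < x
  · obtain ⟨i, hi, hmax⟩ : ∃ i, s i < x ∧ ∀ j, s j < x → j ≤ i := by
      have hne : (Finset.univ.filter fun j => s j < x).Nonempty := by
        obtain ⟨j, hj⟩ := hL
        exact ⟨j, by simpa using hj⟩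
      refine ⟨Finset.max' _ hne, by simpa using Finset.max'_mem _ hne, fun j hj => ?_⟩
      exact Finset.le_max' _ _ (by simpa using hj)
    have hgt : ∀ j, i < j → y < s j := fun j hij =>
      (hout j).resolve_left fun h => absurd (hmax j h) (not_le.2 hij)
    refine β.rel.symm (hd.rel_of_update hK hT h hf ht i (u := y) (v := x) (c := s i) (d := x)
      (Or.inr ⟨rfl, rfl⟩) ⟨?_, hi.le, ?_⟩ hy hx (fun z hz => hy z (h2 hz))
      (h1 ((hf i i).2 rfl)) (α.rel.symm hxy))
    · intro j k hjk
      have := hs hjk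
      simp only [Function.update_apply]
      split_ifs with h3 h4 h4
      · omega
      · subst h3; exact hgt _ hjk
      · subst h4; omega
      · exact this
    · intro _ j
      simp only [Function.update_apply]
      split_ifs with h3
      · exact Or.inr hlt
      · rcases lt_or_gt_of_ne h3 with h4 | h4
        · exact Or.inl (hs h4)
        · exact Or.inr (hlt.trans (hgt _ h4))
  · have hgt : ∀ j, y < s j := fun j => (hout j).resolve_left fun h => hL ⟨j, h⟩
    have hmin : ∀ j : Fin p, j ≠ ⟨0, hp1⟩ → ⟨0, hp1⟩ < j := fun j hj =>
      lt_of_le_of_ne (Nat.zero_le _) (Ne.symm hj)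
    refine hd.rel_of_update hK hT h hf ht ⟨0, hp1⟩ (u := x) (v := y) (c := y) (d := s ⟨0, hp1⟩)
      (Or.inl ⟨rfl, rfl⟩) ⟨?_, (hgt _).le, ?_⟩ hx hy (fun z hz => hx z (h2 hz))
      (h1 ((hf _ _).2 rfl)) hxy
    · intro j k hjk
      have := hs hjk
      simp only [Function.update_apply]
      split_ifs with h3 h4 h4
      · omega
      · exact hlt.trans (hgt _)
      · subst h4; exact absurd hjk (not_lt.2 (Nat.zero_le _))
      · exact this
    · intro _ j
      simp only [Function.update_apply]
      split_ifs with h3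
      · exact Or.inl hlt
      · exact Or.inr (hs (hmin j h3))

theorem NoDrop.ker_le (hp1 : 1 ≤ p) (h : T α β) (hp : p ≤ α.rank) {x y : Fin n}
    (hxy : α.rel (.inl x) (.inl y)) : β.rel (.inl x) (.inl y) := by
  rcases lt_trichotomy x y with hlt | rfl | hlt
  · exact hd.ker_of_lt hK hT hp1 h hp hlt hxy
  · exact β.rel.refl _
  · exact β.rel.symm (hd.ker_of_lt hK hT hp1 h hp hlt (α.rel.symm hxy))

/-- Kernels and transversals are treated directly; cokernels follow from the same argument for the
image of `T` under the involution. -/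
theorem NoDrop.eq (hp1 : 1 ≤ p) (h : T α β) (hp : p ≤ α.rank) : α = β := by
  have hp' := hd.le_rank hK hT h hp
  have hd' : NoDrop p fun α β => T (star α) (star β) := fun γ δ k hγ => by
    rw [← rank_star δ]
    exact hd _ _ k (by rwa [rank_star])
  have hT' := hT.starRel hK
  have h' : T (star (star α)) (star (star β)) := by simpa only [star_star'] using h
  refine ext_rows (fun i j => ⟨hd.ker_le hK hT hp1 h hp, hd.ker_le hK hT hp1 (hT.symm h) hp'⟩)
    (fun i j => ⟨hd.rel_inl_inr hK hT hp1 h hp, hd.rel_inl_inr hK hT hp1 (hT.symm h) hp'⟩)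
    (fun i j => ⟨fun k => ?_, fun k => ?_⟩)
  · exact NoDrop.ker_le hK hT' hd' hp1 h' (by rwa [rank_star]) (x := i) (y := j) k
  · exact NoDrop.ker_le hK hT' hd' hp1 (hT'.symm h') (by rwa [rank_star]) (x := i) (y := j) k

end

end

section

variable [NeZero n] {K : Submonoid (PartitionMonoid n)}

/-! ### Elements of rank zero with at most one non-trivial block in each row -/

/-- The partition whose only non-trivial block, if any, is `{0', y'}`. -/
def lowerPair (y : Fin n) : PartitionMonoid n := strand (p := 0) Fin.elim0 0 y

theorem isClear_elim0 (y : Fin n) : IsClear (Fin.elim0 : Fin 0 → Fin n) 0 y :=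
  ⟨fun i => i.elim0, Fin.zero_le _, fun _ i => i.elim0⟩

theorem rank_lowerPair (y : Fin n) : (lowerPair y).rank = 0 :=
  rank_eq_zero_iff.2 fun _ _ h =>
    absurd ((strand_rel_inl_inr (isClear_elim0 y)).1 h).1 (Nat.not_lt_zero _)

theorem lowerPair_ker {y i j : Fin n} : (lowerPair y).ker i j ↔ i = j :=
  strand_rel_inl_inl (isClear_elim0 y)

theorem lowerPair_coker {y i j : Fin n} :
    (lowerPair y).coker i j ↔ i = j ∨ (i = 0 ∧ j = y) ∨ (i = y ∧ j = 0) :=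
  strand_rel_inr_inr

theorem IsAdmissible.lowerPair_mem (hK : IsAdmissible K) (y : Fin n) : lowerPair y ∈ K :=
  hK.strand_mem (isClear_elim0 y)

/-! ### Congruences that identify elements with different kernels -/

section

variable {T : PartitionMonoid n → PartitionMonoid n → Prop} (hK : IsAdmissible K)
  (hT : IsCongOn K T) (hn : 2 ≤ n)
include hK hT hn

/-- If `T` relates elements of rank at most one with different kernels, then it relates an element
of rank zero with an element whose kernel is trivial. -/
theorem IsCongOn.trivialize_ker {α β : PartitionMonoid n} (h : T α β) (hα : α.rank ≤ 1)
    (hβ : β.rank ≤ 1) {x y : Fin n} (hlt : x < y) (hxy : α.rel (.inl x) (.inl y))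
    (hxy' : ¬ β.rel (.inl x) (.inl y)) {ω : PartitionMonoid n} (hω : ω ∈ K) (hω0 : ω.rank = 0)
    (m : ℕ) : ∀ κ ∈ K, κ.rank = 0 → Set.ncard {w | ∃ v, w ≠ v ∧ κ.ker w v} ≤ m →
      T (κ * ω) (lowerPair 0 * ω) := by
  have hs := strictMono_pair hlt
  let e0 : Fin n := ⟨0, by omega⟩
  let e1 : Fin n := ⟨1, by omega⟩
  have he : e0 < e1 := Nat.zero_lt_one
  have hpick : ∀ {γ : PartitionMonoid n}, γ.rank ≤ 1 →
      ((pick ![x, y] * (γ * ω)).rel (.inl e0) (.inl e1) ↔ γ.rel (.inl x) (.inl y)) := by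
    intro γ hγ
    rw [pick_mul_inl_inl hs]
    refine ⟨fun h => ?_, fun h => Or.inr ⟨Nat.zero_lt_two, Nat.one_lt_two,
      (ker_mul_of h : (γ * ω).rel (.inl x) (.inl y))⟩⟩
    rcases h with h | ⟨_, _, h⟩
    · exact absurd h he.ne
    · exact (Setoid.ext_iff.1 (ker_mul_of_rank_le_one hγ ω) x y).1 h
  have hω1 : ω.rank ≤ 1 := by omega
  induction m with
  | zero =>
    intro κ hκ h0 hm
    have hemp := (Set.ncard_eq_zero (Set.toFinite _)).1 (Nat.le_zero.1 hm)
    rw [eq_of_ker_coker (γ := lowerPair 0 * ω) (rank_mul_eq_zero_right _ hω0) (by omega) hω1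
      (rank_mul_eq_zero_right _ hω0) ?_ (coker_mul_of_rank_le_one _ hω1)]
    · exact hT.refl (K.mul_mem (hK.lowerPair_mem 0) hω)
    · rw [ker_mul_of_rank_le_one (by rw [rank_lowerPair]; omega)]
      ext w v
      rw [lowerPair_ker]
      refine ⟨fun h => h ▸ κ.ker.refl _, fun h => ?_⟩
      by_contra hc
      exact (Set.eq_empty_iff_forall_notMem.1 hemp w) ⟨v, hc, h⟩
  | succ m ih =>
    intro κ hκ h0 hm
    rcases Set.eq_empty_or_nonempty {w | ∃ v, w ≠ v ∧ κ.ker w v} with hemp | hne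
    · exact ih κ hκ h0 (by rw [hemp]; simp)
    -- Choosing the least vertex in a non-trivial class is what keeps the detached partition planar.
    obtain ⟨a, ⟨b, hab, hb⟩, hmin⟩ := Set.exists_min_image _ id (Set.toFinite _) hne
    have ha : ∀ w v, w < a → κ.rel (.inl w) (.inl v) → w = v := by
      intro w v hw hwv
      by_contra hc
      exact absurd (hmin w ⟨v, hc, hwv⟩) (not_le.2 hw)
    -- `θ` leads `a` to the first lower vertex and the rest of its class to the second. A right
    -- factor that joins these two vertices restores the class, while one that separates them leaves
    -- `a` isolated. The factors built from `α` and `β` do the one and the other.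
    let θ := detach κ a e0 e1
    have hθ : θ ∈ K := hK.detach_mem hκ he ha
    have hker : ∀ {γ : PartitionMonoid n} {w v : Fin n},
        (θ * γ).rel (.inl w) (.inl v) ↔ θ.rel (.inl w) (.inl v) ∨
          ∃ i j, θ.rel (.inl w) (.inr i) ∧ γ.rel (.inl i) (.inl j) ∧ θ.rel (.inl v) (.inr j) :=
      mul_rel_inl_inl_of_coker fun i j => detach_inr_inr.1
    have hrk : ∀ {γ : PartitionMonoid n}, (θ * (pick ![x, y] * (γ * ω))).rank = 0 := fun {γ} =>
      rank_mul_eq_zero_right _ (rank_mul_eq_zero_right _ (rank_mul_eq_zero_right _ hω0))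
    have hco : ∀ {γ : PartitionMonoid n}, (θ * (pick ![x, y] * (γ * ω))).coker = ω.coker := by
      intro γ
      rw [← mul_assoc, ← mul_assoc, coker_mul_of_rank_le_one _ hω1]
    have hA : θ * (pick ![x, y] * (α * ω)) = κ * ω := by
      refine ext_of_rank_eq_zero hrk (rank_mul_eq_zero_right _ hω0) ?_
        (by rw [hco, coker_mul_of_rank_le_one _ hω1])
      rw [ker_mul_of_rank_le_one (show κ.rank ≤ 1 by omega)]
      have hkt : ∀ {u v w}, κ.rel u v → κ.rel v w → κ.rel u w := fun h h' => κ.rel.trans h h'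
      have hks : ∀ {u v}, κ.rel u v → κ.rel v u := fun h => κ.rel.symm h
      have h01 := (hpick hα).2 hxy
      ext w v
      refine hker.trans ⟨?_, fun h => ?_⟩
      · have hka : ∀ {w j}, θ.rel (.inl w) (.inr j) → κ.rel (.inl w) (.inl a) := by
          intro w j h
          rcases detach_inl_inr.1 h with ⟨rfl, _⟩ | ⟨_, h, _⟩
          · exact κ.rel.refl _
          · exact h
        rintro (h | ⟨i, j, h1, _, h2⟩)
        · rcases (detach_inl_inl he.ne).1 h with rfl | ⟨_, _, h⟩
          · exact κ.rel.refl _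
          · exact h
        · exact hkt (hka h1) (hks (hka h2))
      · by_cases hw : w = a
        · by_cases hv : v = a
          · subst hw; subst hv; exact Or.inl (θ.rel.refl _)
          · subst hw
            exact Or.inr ⟨e0, e1, detach_inl_inr.2 (Or.inl ⟨rfl, rfl⟩), h01,
              detach_inl_inr.2 (Or.inr ⟨hv, hks h, rfl⟩)⟩
        · by_cases hv : v = a
          · subst hv
            exact Or.inr ⟨e1, e0, detach_inl_inr.2 (Or.inr ⟨hw, h, rfl⟩), rel_comm.1 h01,
              detach_inl_inr.2 (Or.inl ⟨rfl, rfl⟩)⟩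
          · exact Or.inl ((detach_inl_inl he.ne).2 (Or.inr ⟨hw, hv, h⟩))
    have hkerB : ∀ {w v}, (θ * (pick ![x, y] * (β * ω))).ker w v →
        w = v ∨ (w ≠ a ∧ v ≠ a ∧ κ.ker w v) := by
      intro w v h
      have h01 := fun k => hxy' ((hpick hβ).1 k)
      rcases hker.1 h with h | ⟨i, j, h1, h2, h3⟩
      · exact (detach_inl_inl he.ne).1 h
      · rcases detach_inl_inr.1 h1 with ⟨rfl, rfl⟩ | ⟨h6, h4, rfl⟩ <;>
          rcases detach_inl_inr.1 h3 with ⟨rfl, rfl⟩ | ⟨h7, h5, rfl⟩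
        · exact Or.inl rfl
        · exact absurd h2 h01
        · exact absurd (rel_comm.1 h2) h01
        · exact Or.inr ⟨h6, h7, κ.rel.trans h4 (κ.rel.symm h5)⟩
    have hAB : T (θ * (pick ![x, y] * (α * ω))) (θ * (pick ![x, y] * (β * ω))) :=
      hT.mul_left hθ (hT.mul_left (hK.pick_mem hs) (hT.mul_right hω h))
    -- This element has the cokernel of `ω` already, so the induction hypothesis, applied to it in
    -- place of `κ`, speaks about the element itself.
    have hBω : (θ * (pick ![x, y] * (β * ω))) * ω = θ * (pick ![x, y] * (β * ω)) :=
      eq_of_ker_coker hrk (by rw [hrk]; omega) hω1 (rank_mul_eq_zero_right _ hω0) rfl hco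
    have hIH := ih _ (hT.mem_right hAB) hrk (by
      refine Nat.lt_succ_iff.1 (lt_of_lt_of_le (Set.ncard_lt_ncard ?_ (Set.toFinite _)) hm)
      refine Set.ssubset_iff_exists.2 ⟨?_, a, ⟨b, hab, hb⟩, ?_⟩
      · rintro w ⟨v, hne, h⟩
        rcases hkerB h with h | ⟨_, _, h⟩
        · exact absurd h hne
        · exact ⟨v, hne, h⟩
      · rintro ⟨v, hne, h⟩
        rcases hkerB h with h | ⟨h, _, _⟩
        · exact hne h
        · exact h rfl)
    rw [hA] at hAB
    rw [hBω] at hIH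
    exact hT.trans hAB hIH

/-- If `T` relates elements of rank at most one with different kernels, then it relates all elements
of rank zero with the same cokernel. -/
theorem IsCongOn.of_coker_eq {α β : PartitionMonoid n} (h : T α β) (hα : α.rank ≤ 1)
    (hβ : β.rank ≤ 1) (hne : α.ker ≠ β.ker) {γ δ : PartitionMonoid n} (hγ : γ ∈ K) (hδ : δ ∈ K)
    (hγ0 : γ.rank = 0) (hδ0 : δ.rank = 0) (hc : γ.coker = δ.coker) : T γ δ := by
  have key : ∀ κ ∈ K, κ.rank = 0 → T (κ * γ) (lowerPair 0 * γ) := by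
    intro κ hκ hκ0
    obtain ⟨x, y, hlt, ⟨h1, h2⟩ | ⟨h1, h2⟩⟩ := exists_rel_of_ker_ne hne
    · exact hT.trivialize_ker hK hn h hα hβ hlt h1 h2 hγ hγ0 _ κ hκ hκ0 le_rfl
    · exact hT.trivialize_ker hK hn (hT.symm h) hβ hα hlt h1 h2 hγ hγ0 _ κ hκ hκ0 le_rfl
  have h1 := key γ hγ hγ0
  have h2 := key δ hδ hδ0
  -- By the band law `γ * γ = γ`, and `δ * γ = δ` because the cokernels agree.
  rw [eq_of_ker_coker (γ := γ) hγ0 (by omega) (by omega) (rank_mul_eq_zero_right _ hγ0) rfl rfl]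
    at h1
  rw [eq_of_ker_coker (γ := δ) hδ0 (by omega) (by omega) (rank_mul_eq_zero_right _ hγ0) rfl
    hc.symm] at h2
  exact hT.trans h1 (hT.symm h2)

theorem IsCongOn.of_ker_eq {α β : PartitionMonoid n} (h : T α β) (hα : α.rank ≤ 1)
    (hβ : β.rank ≤ 1) (hne : α.coker ≠ β.coker) {γ δ : PartitionMonoid n} (hγ : γ ∈ K)
    (hδ : δ ∈ K) (hγ0 : γ.rank = 0) (hδ0 : δ.rank = 0) (hc : γ.ker = δ.ker) : T γ δ := by
  have := (hT.starRel hK).of_coker_eq hK hn (α := star α) (β := star β) (γ := star γ) (δ := star δ)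
    (by simpa only [star_star'] using h) (by rwa [rank_star]) (by rwa [rank_star]) hne
    (hK.star_mem hγ) (hK.star_mem hδ) (by rwa [rank_star]) (by rwa [rank_star]) hc
  simpa only [star_star'] using this

end

/-- The first right factor joins the first two upper vertices and the second does not, and `idBar n
2` transmits the difference. This fact separates rank 2 from the ranks below it. -/
theorem ker_idBar_mul_ne (hn : 2 ≤ n) :
    (idBar n 2 * star (lowerPair ⟨1, hn⟩)).ker ≠ (idBar n 2 * star (lowerPair 0)).ker := by
  intro h
  have h01 : (0 : Fin n) ≠ ⟨1, hn⟩ := by simp [Fin.ext_iff]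
  have key : ∀ y, (idBar n 2 * star (lowerPair y)).ker 0 ⟨1, hn⟩ ↔ y = ⟨1, hn⟩ := by
    intro y
    rw [← pick_castLE hn, ker_iff, pick_mul_inl_inl (strictMono_castLE hn)]
    simp only [h01, false_or]
    constructor
    · rintro ⟨_, _, h⟩
      have h : (0 : Fin n) = ⟨1, hn⟩ ∨ _ := lowerPair_coker.1 h
      rcases h with h | ⟨_, h⟩ | ⟨_, h⟩
      · exact absurd h h01
      · exact h.symm
      · exact absurd h.symm h01
    · intro h
      exact ⟨by simp, by simp, lowerPair_coker.2 (Or.inr (Or.inl ⟨rfl, h.symm⟩))⟩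
  exact h01 ((key 0).1 ((Setoid.ext_iff.1 h 0 ⟨1, hn⟩).1 ((key _).2 rfl)))

/-! ### Consequences of a drop in rank -/

section

variable {T : PartitionMonoid n → PartitionMonoid n → Prop} (hK : IsAdmissible K)
  (hT : IsCongOn K T) {α β : PartitionMonoid n} (h : T α β) (hne : α ≠ β)
include hK hT h hne

/-- By `NoDrop.eq` some element of rank `p` is related to one of smaller rank; multiplying on both
sides turns the former into the partial identity. -/
theorem IsCongOn.exists_rel_idBar {p : ℕ} (hp1 : 1 ≤ p) (hp : p ≤ α.rank) :
    ∃ δ, T (idBar n p) δ ∧ δ.rank < p := by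
  have : ¬ NoDrop p T := fun hd => hne (hd.eq hK hT hp1 h hp)
  unfold NoDrop at this
  push Not at this
  obtain ⟨γ, δ, hγδ, rfl, hlt⟩ := this
  obtain ⟨x, hx, y, hy, he⟩ := hK.exists_mul_mul_eq_idBar (hT.mem_left hγδ) le_rfl
  exact ⟨x * δ * y, he ▸ hT.mul_right hy (hT.mul_left hx hγδ),
    ((rank_mul_le_left _ _).trans (rank_mul_le_right _ _)).trans_lt hlt⟩

theorem IsCongOn.exists_rel_rank_lt {p : ℕ} (hp1 : 1 ≤ p) (hp : p ≤ α.rank)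
    {γ : PartitionMonoid n} (hγ : γ ∈ K) (hγp : γ.rank ≤ p) : ∃ δ, T γ δ ∧ δ.rank < p := by
  obtain ⟨δ, h1, h2⟩ := hT.exists_rel_idBar hK h hne hp1 hp
  obtain ⟨x, hx, y, hy, rfl⟩ := hK.exists_eq_mul_idBar_mul hγ (hp.trans α.rank_le) hγp
  exact ⟨x * δ * y, hT.mul_right hy (hT.mul_left hx h1),
    ((rank_mul_le_left _ _).trans (rank_mul_le_right _ _)).trans_lt h2⟩

/-- With `γ = γwγ`, the element `wγw` is related to some `η` of rank 0. Multiplying by `γ` on both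
sides gives `γ` on the one hand, and on the other `γηγ`, of rank 0 with the kernel and cokernel of
`γ`. -/
theorem IsCongOn.rel_flatten (hα : 1 ≤ α.rank) {γ : PartitionMonoid n} (hγ : γ ∈ K)
    (hγ1 : γ.rank ≤ 1) : T γ (flatten γ) := by
  obtain ⟨w, hw, he⟩ := hK.exists_eq_mul_mul hγ
  obtain ⟨η, h1, h2⟩ := hT.exists_rel_rank_lt hK h hne le_rfl hα
    (K.mul_mem (K.mul_mem hw hγ) hw)
    (((rank_mul_le_left _ _).trans (rank_mul_le_right _ _)).trans hγ1)
  have h3 := hT.mul_right hγ (hT.mul_left hγ h1)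
  have e1 : γ * (w * γ * w) * γ = γ := by
    rw [show γ * (w * γ * w) * γ = γ * w * γ * w * γ by simp only [mul_assoc], ← he, ← he]
  have h0 : (γ * η).rank = 0 := rank_mul_eq_zero_right _ (by omega)
  rw [e1, eq_of_ker_coker (γ := flatten γ) (rank_flatten γ) (by omega) hγ1
    (rank_mul_eq_zero_left h0 _) (by rw [ker_flatten, ker_mul_of_rank_le_one hγ1])
    (coker_flatten γ)] at h3
  exact h3

/-- Let `idBar n 2` be related to `δ` of rank at most 1. If kernels were preserved in rank at most
1, multiplying by different elements of rank 0 would always give the kernel of `δ`, contrary to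
`ker_idBar_mul_ne`. -/
theorem IsCongOn.exists_ker_ne (hα : 2 ≤ α.rank) :
    ∃ γ δ, T γ δ ∧ γ.rank ≤ 1 ∧ δ.rank ≤ 1 ∧ γ.ker ≠ δ.ker := by
  have hn : 2 ≤ n := hα.trans α.rank_le
  obtain ⟨δ, h1, h2⟩ := hT.exists_rel_idBar hK h hne one_le_two hα
  have key : ∀ y, (idBar n 2 * star (lowerPair y)).rank ≤ 1 ∧ (δ * star (lowerPair y)).rank ≤ 1 ∧
      T (idBar n 2 * star (lowerPair y)) (δ * star (lowerPair y)) := fun y =>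
    ⟨by rw [rank_mul_eq_zero_right _ (by rw [rank_star, rank_lowerPair])]; omega,
      by rw [rank_mul_eq_zero_right _ (by rw [rank_star, rank_lowerPair])]; omega,
      hT.mul_right (hK.star_mem (hK.lowerPair_mem y)) h1⟩
  by_contra! hc
  have h3 := fun y => (hc _ _ (key y).2.2 (key y).1 (key y).2.1).trans
    (ker_mul_of_rank_le_one (by omega) _)
  exact ker_idBar_mul_ne hn ((h3 ⟨1, hn⟩).trans (h3 0).symm)

theorem IsCongOn.exists_coker_ne (hα : 2 ≤ α.rank) :
    ∃ γ δ, T γ δ ∧ γ.rank ≤ 1 ∧ δ.rank ≤ 1 ∧ γ.coker ≠ δ.coker := by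
  obtain ⟨γ, δ, h1, h2, h3, h4⟩ := (hT.starRel hK).exists_ker_ne hK (α := star α) (β := star β)
    (by simpa only [star_star'] using h) (star_injective'.ne hne) (by rwa [rank_star])
  exact ⟨star γ, star δ, h1, by rwa [rank_star], by rwa [rank_star], h4⟩

/-- A congruence that relates some element of rank `q ≥ 2` with another element contains the Rees
congruence of the ideal of all elements of rank at most `q`. -/
theorem IsCongOn.of_rank_le (hα : 2 ≤ α.rank) (p : ℕ) (hp : p ≤ α.rank) :
    ∀ γ ∈ K, ∀ δ ∈ K, γ.rank ≤ p → δ.rank ≤ p → T γ δ := by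
  have hn : 2 ≤ n := hα.trans α.rank_le
  induction p with
  | zero =>
    intro γ hγ δ hδ h1 h2
    obtain ⟨γ₁, δ₁, k1, k2, k3, k4⟩ := hT.exists_ker_ne hK h hne hα
    obtain ⟨γ₂, δ₂, l1, l2, l3, l4⟩ := hT.exists_coker_ne hK h hne hα
    have h3 : (δ * γ).rank = 0 := rank_mul_eq_zero_right _ (by omega)
    have h4 := K.mul_mem hδ hγ
    exact hT.trans
      (hT.of_coker_eq hK hn k1 k2 k3 k4 hγ h4 (by omega) h3
        (coker_mul_of_rank_le_one _ (by omega)).symm)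
      (hT.of_ker_eq hK hn l1 l2 l3 l4 h4 hδ h3 (by omega) (ker_mul_of_rank_le_one (by omega) _))
  | succ p ih =>
    intro γ hγ δ hδ h1 h2
    obtain ⟨γ', k1, k2⟩ := hT.exists_rel_rank_lt hK h hne (Nat.succ_pos p) hp hγ h1
    obtain ⟨δ', l1, l2⟩ := hT.exists_rel_rank_lt hK h hne (Nat.succ_pos p) hp hδ h2
    exact hT.trans k1 (hT.trans (ih (by omega) _ (hT.mem_right k1) _ (hT.mem_right l1)
      (by omega) (by omega)) (hT.symm l1))

end

/-! ### The classification -/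

/-- The relation consisting of the diagonal and all pairs of elements of rank at most `q` with equal
kernels unless `k`, and equal cokernels unless `c`. -/
def stdRel (q : ℕ) (k c : Bool) (α β : PartitionMonoid n) : Prop :=
  α = β ∨ (α.rank ≤ q ∧ β.rank ≤ q ∧ (k = false → α.ker = β.ker) ∧
    (c = false → α.coker = β.coker))

theorem IsCongOn.exists_stdRel {T : PartitionMonoid n → PartitionMonoid n → Prop}
    (hK : IsAdmissible K) (hT : IsCongOn K T) (hn : 2 ≤ n) :
    ∃ (q : ℕ) (k c : Bool), q ≤ n ∧ (q ≤ 1 ∨ (k = true ∧ c = true)) ∧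
      ∀ α ∈ K, ∀ β ∈ K, T α β ↔ stdRel q k c α β := by
  classical
  -- The trivial congruence is recorded as level 0 with both kernels and cokernels fixed.
  by_cases htriv : ∀ α β, T α β → α = β
  · refine ⟨0, false, false, Nat.zero_le _, Or.inl zero_le_one, fun α hα β hβ => ⟨fun h =>
      Or.inl (htriv _ _ h), ?_⟩⟩
    rintro (rfl | ⟨h1, h2, h3, h4⟩)
    · exact hT.refl hα
    · rw [ext_of_rank_eq_zero (Nat.le_zero.1 h1) (Nat.le_zero.1 h2) (h3 rfl) (h4 rfl)]
      exact hT.refl hβ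
  push Not at htriv
  obtain ⟨α₁, β₁, h1, hne1⟩ := htriv
  -- The rank of `α₀` below is the largest one occurring in a non-trivial class and serves as the
  -- level `q`.
  let P : ℕ → Prop := fun q => ∃ α β, T α β ∧ α ≠ β ∧ α.rank = q
  obtain ⟨α₀, β₀, h0, hne0, hq⟩ : P (Nat.findGreatest P n) :=
    Nat.findGreatest_spec α₁.rank_le ⟨α₁, β₁, h1, hne1, rfl⟩
  have hmax : ∀ {α β}, T α β → α ≠ β → α.rank ≤ α₀.rank := by
    intro α β h hne
    rw [hq]
    exact Nat.le_findGreatest α.rank_le ⟨α, β, h, hne, rfl⟩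
  have hmax' : ∀ {α β}, T α β → α ≠ β → α.rank ≤ α₀.rank ∧ β.rank ≤ α₀.rank :=
    fun h hne => ⟨hmax h hne, hmax (hT.symm h) hne.symm⟩
  by_cases h2 : 2 ≤ α₀.rank
  · refine ⟨α₀.rank, true, true, α₀.rank_le, Or.inr ⟨rfl, rfl⟩, fun α hα β hβ => ⟨fun h => ?_, ?_⟩⟩
    · by_cases hne : α = β
      · exact Or.inl hne
      · exact Or.inr ⟨(hmax' h hne).1, (hmax' h hne).2, by simp, by simp⟩
    · rintro (rfl | ⟨h3, h4, _⟩)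
      · exact hT.refl hα
      · exact hT.of_rank_le hK h0 hne0 h2 _ le_rfl _ hα _ hβ h3 h4
  have hle : α₀.rank ≤ 1 := by omega
  refine ⟨α₀.rank, decide (∃ α β, T α β ∧ α.rank ≤ 1 ∧ β.rank ≤ 1 ∧ α.ker ≠ β.ker),
    decide (∃ α β, T α β ∧ α.rank ≤ 1 ∧ β.rank ≤ 1 ∧ α.coker ≠ β.coker), α₀.rank_le, Or.inl hle,
    fun α hα β hβ => ⟨fun h => ?_, ?_⟩⟩
  · by_cases hne : α = β
    · exact Or.inl hne
    · obtain ⟨h3, h4⟩ := hmax' h hne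
      refine Or.inr ⟨h3, h4, fun hk => ?_, fun hk => ?_⟩
      · rw [decide_eq_false_iff_not] at hk
        push Not at hk
        exact hk _ _ h (h3.trans hle) (h4.trans hle)
      · rw [decide_eq_false_iff_not] at hk
        push Not at hk
        exact hk _ _ h (h3.trans hle) (h4.trans hle)
  · rintro (rfl | ⟨h3, h4, h5, h6⟩)
    · exact hT.refl hα
    have hflat : ∀ {γ}, γ ∈ K → γ.rank ≤ α₀.rank → T γ (flatten γ) := by
      intro γ hγ hr
      rcases Nat.eq_zero_or_pos α₀.rank with hz | hz
      · rw [ext_of_rank_eq_zero (rank_flatten γ) (by omega) (ker_flatten γ) (coker_flatten γ)]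
        exact hT.refl hγ
      · exact hT.rel_flatten hK h0 hne0 hz hγ (hr.trans hle)
    have hfa := hK.flatten_mem hα
    have hfb := hK.flatten_mem hβ
    have hm := K.mul_mem hfb hfa
    have hm0 : (flatten β * flatten α).rank = 0 := rank_mul_eq_zero_left (rank_flatten _) _
    have hmk : (flatten β * flatten α).ker = β.ker := by
      rw [ker_mul_of_rank_le_one (by rw [rank_flatten]; omega), ker_flatten]
    have hmc : (flatten β * flatten α).coker = α.coker := by
      rw [coker_mul_of_rank_le_one _ (by rw [rank_flatten]; omega), coker_flatten]
    -- The passage from `flatten α` to `flatten β` changes first the kernel and then the cokernel.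
    -- If `T` has no pair of rank at most 1 with different kernels, the kernels agree by assumption
    -- and this first step is an equality; the second step is dual.
    have s1 : T (flatten α) (flatten β * flatten α) := by
      by_cases hk : ∃ α β, T α β ∧ α.rank ≤ 1 ∧ β.rank ≤ 1 ∧ α.ker ≠ β.ker
      · obtain ⟨γ, δ, k1, k2, k3, k4⟩ := hk
        exact hT.of_coker_eq hK hn k1 k2 k3 k4 hfa hm (rank_flatten _) hm0
          (by rw [coker_flatten, hmc])
      · rw [ext_of_rank_eq_zero hm0 (rank_flatten α)
          (by rw [hmk, ker_flatten, h5 (by simpa using hk)])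
          (by rw [hmc, coker_flatten])]
        exact hT.refl hfa
    have s2 : T (flatten β * flatten α) (flatten β) := by
      by_cases hk : ∃ α β, T α β ∧ α.rank ≤ 1 ∧ β.rank ≤ 1 ∧ α.coker ≠ β.coker
      · obtain ⟨γ, δ, k1, k2, k3, k4⟩ := hk
        exact hT.of_ker_eq hK hn k1 k2 k3 k4 hm hfb hm0 (rank_flatten _)
          (by rw [ker_flatten, hmk])
      · rw [ext_of_rank_eq_zero hm0 (rank_flatten β) (by rw [hmk, ker_flatten])
          (by rw [hmc, coker_flatten, h6 (by simpa using hk)])]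
        exact hT.refl hfb
    exact hT.trans (hflat hα h3) (hT.trans s1 (hT.trans s2 (hT.symm (hflat hβ h4))))

end

end PartitionMonoid

/-! ### Stability of finite monoids -/

namespace MonoidCong

theorem exists_of_greenR {S : Type*} [Monoid S] {x y : S} (h : GreenR x y) : ∃ s, x = y * s :=
  (Set.ext_iff.1 h x).1 ⟨1, (mul_one x).symm⟩

theorem exists_of_greenL {S : Type*} [Monoid S] {x y : S} (h : GreenL x y) : ∃ s, x = s * y :=
  (Set.ext_iff.1 h x).1 ⟨1, (one_mul x).symm⟩

theorem greenR_of {S : Type*} [Monoid S] {x y s t : S} (h : x = y * s) (h' : y = x * t) :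
    GreenR x y := by
  ext z
  constructor
  · rintro ⟨u, rfl⟩; exact ⟨s * u, by rw [← mul_assoc, ← h]⟩
  · rintro ⟨u, rfl⟩; exact ⟨t * u, by rw [← mul_assoc, ← h']⟩

theorem greenL_of {S : Type*} [Monoid S] {x y s t : S} (h : x = s * y) (h' : y = t * x) :
    GreenL x y := by
  ext z
  constructor
  · rintro ⟨u, rfl⟩; exact ⟨u * s, by rw [mul_assoc, ← h]⟩
  · rintro ⟨u, rfl⟩; exact ⟨u * t, by rw [mul_assoc, ← h']⟩

theorem eq_pow_mul_mul_pow {S : Type*} [Monoid S] {x s b : S} (h : x = s * x * b) (k : ℕ) :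
    x = s ^ k * x * b ^ k := by
  induction k with
  | zero => simp
  | succ k ih =>
    rw [pow_succ, pow_succ', show s ^ k * s * x * (b * b ^ k) = s ^ k * (s * x * b) * b ^ k by
      simp only [mul_assoc], ← h]
    exact ih

/-- If `x = s * x * (a * t)`, then `x = s ^ k * x * (a * t) ^ k` for all `k`. As the powers of `a *
t` eventually repeat, `x = x * (a * t) ^ (m + 1)` for some `m`, so `x` is a right multiple of `x *
a`. The other side is dual. -/
theorem isStable_of_finite {S : Type*} [Monoid S] [Finite S] (J : Set S) : IsStable J := by
  have hpow : ∀ b : S, ∃ i m, b ^ i = b ^ (i + (m + 1)) := by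
    intro b
    obtain ⟨i, j, hij, he⟩ := Finite.exists_ne_map_eq_of_infinite (fun k : ℕ => b ^ k)
    rcases lt_or_gt_of_ne hij with h | h
    · exact ⟨i, j - i - 1, by rw [show i + (j - i - 1 + 1) = j by omega]; exact he⟩
    · exact ⟨j, i - j - 1, by rw [show j + (i - j - 1 + 1) = i by omega]; exact he.symm⟩
  refine fun x _ a => ⟨fun h => ?_, fun h => ?_⟩
  · obtain ⟨s, t, hst⟩ := (Set.ext_iff.1 h x).2 ⟨1, 1, by simp⟩
    have hst' : x = s * x * (a * t) := by simpa only [mul_assoc] using hst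
    obtain ⟨i, m, hi⟩ := hpow (a * t)
    have h1 := eq_pow_mul_mul_pow hst' i
    have h2 : x = x * (a * t) ^ (m + 1) := by
      conv_rhs => rw [h1]
      rw [mul_assoc, ← pow_add, ← hi]
      exact h1
    refine greenR_of rfl (t := t * (a * t) ^ m) ?_
    conv_lhs => rw [h2]
    rw [pow_succ']
    simp only [mul_assoc]
  · obtain ⟨s, t, hst⟩ := (Set.ext_iff.1 h x).2 ⟨1, 1, by simp⟩
    have hst' : x = (s * a) * x * t := by rw [mul_assoc s a x]; exact hst
    obtain ⟨i, m, hi⟩ := hpow (s * a)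
    have h1 := eq_pow_mul_mul_pow hst' i
    have h2 : x = (s * a) ^ (m + 1) * x := by
      conv_rhs => rw [h1]
      rw [mul_assoc ((s * a) ^ i), ← mul_assoc ((s * a) ^ (m + 1)), ← pow_add, add_comm (m + 1),
        ← hi, ← mul_assoc]
      exact h1
    refine greenL_of rfl (t := (s * a) ^ m * s) ?_
    conv_lhs => rw [h2]
    rw [pow_succ]
    simp only [mul_assoc]

end MonoidCong

namespace PartitionMonoid

open MonoidCong

variable {n : ℕ}

instance : Finite (PartitionMonoid n) :=
  Finite.of_injective (fun α : PartitionMonoid n => (fun x y => α.rel x y)) fun α β h => by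
    ext x y
    exact iff_of_eq (congrFun (congrFun h x) y)

section

variable {K : Submonoid (PartitionMonoid n)}

theorem mem_rankIdeal {q : ℕ} {α : K} : α ∈ rankIdeal K q ↔ (α : PartitionMonoid n).rank ≤ q :=
  Iff.rfl

theorem eq_of_subtype_ker_coker {γ α β : K} (hγ : (γ : PartitionMonoid n).rank = 0)
    (hα : (α : PartitionMonoid n).rank = 0) (hβ : (β : PartitionMonoid n).rank = 0)
    (hk : (γ : PartitionMonoid n).ker = (α : PartitionMonoid n).ker)
    (hc : (γ : PartitionMonoid n).coker = (β : PartitionMonoid n).coker) : γ = α * β :=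
  Subtype.ext (eq_of_ker_coker hγ (by omega) (by omega) (rank_mul_eq_zero_left hα _) hk hc).symm

theorem greenR_iff_of_rank_eq_zero {α β : K} (hα : (α : PartitionMonoid n).rank = 0)
    (hβ : (β : PartitionMonoid n).rank = 0) :
    GreenR α β ↔ (α : PartitionMonoid n).ker = (β : PartitionMonoid n).ker := by
  constructor
  · intro h
    obtain ⟨s, hs⟩ := exists_of_greenR h
    rw [hs]
    exact ker_mul_of_rank_le_one (by omega) _
  · intro h
    exact greenR_of (eq_of_subtype_ker_coker hα hβ hα h rfl)
      (eq_of_subtype_ker_coker hβ hα hβ h.symm rfl)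

theorem greenL_iff_of_rank_eq_zero {α β : K} (hα : (α : PartitionMonoid n).rank = 0)
    (hβ : (β : PartitionMonoid n).rank = 0) :
    GreenL α β ↔ (α : PartitionMonoid n).coker = (β : PartitionMonoid n).coker := by
  constructor
  · intro h
    obtain ⟨s, hs⟩ := exists_of_greenL h
    rw [hs]
    exact coker_mul_of_rank_le_one _ (by omega)
  · intro h
    exact greenL_of (eq_of_subtype_ker_coker hα hα hβ rfl h)
      (eq_of_subtype_ker_coker hβ hβ hα rfl h.symm)

variable [NeZero n] (hK : IsAdmissible K)
include hK

/-! ### Green's relations and ideals -/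

theorem IsAdmissible.jle_iff {α β : K} :
    JLE α β ↔ (α : PartitionMonoid n).rank ≤ (β : PartitionMonoid n).rank := by
  rw [← hK.exists_eq_mul_mul_iff α.2 β.2]
  constructor
  · rintro ⟨s, t, h⟩
    exact ⟨s, s.2, t, t.2, congrArg Subtype.val h⟩
  · rintro ⟨s, hs, t, ht, h⟩
    exact ⟨⟨s, hs⟩, ⟨t, ht⟩, Subtype.ext h⟩

theorem IsAdmissible.greenJ_iff {α β : K} :
    GreenJ α β ↔ (α : PartitionMonoid n).rank = (β : PartitionMonoid n).rank := by
  have key : ∀ x y : K, y ∈ {z : K | ∃ s t, z = s * x * t} ↔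
      (y : PartitionMonoid n).rank ≤ (x : PartitionMonoid n).rank := fun _ _ => hK.jle_iff
  constructor
  · intro h
    refine le_antisymm ?_ ?_
    · rw [← key β α, ← show _ = _ from h, key]
    · rw [← key α β, show _ = _ from h, key]
  · intro h
    ext z
    rw [key, key, h]

/-- The `J`-classes form a chain ordered by rank, so an ideal is determined by the largest rank in
it. -/
theorem IsAdmissible.isIdeal_iff {I : Set K} :
    IsIdeal I ↔ ∃ q : Fin (n + 1), I = rankIdeal K q := by
  constructor
  · rintro ⟨hne, hI⟩
    obtain ⟨α, hα, hmax⟩ := Set.exists_max_image I (fun α : K => (α : PartitionMonoid n).rank)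
      (Set.toFinite _) hne
    refine ⟨⟨(α : PartitionMonoid n).rank, Nat.lt_succ_of_le (rank_le _)⟩, ?_⟩
    ext β
    refine ⟨fun hβ => hmax β hβ, fun hβ => ?_⟩
    obtain ⟨s, t, rfl⟩ := (hK.jle_iff (α := β) (β := α)).2 hβ
    exact (hI _ (hI _ hα s).1 t).2
  · rintro ⟨q, rfl⟩
    refine ⟨⟨⟨idBar n 0, hK.idBar_mem (Nat.zero_le _)⟩, ?_⟩, fun x hx a => ⟨?_, ?_⟩⟩
    · rw [mem_rankIdeal, rank_idBar (Nat.zero_le _)]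
      exact Nat.zero_le _
    · exact (rank_mul_le_right _ _).trans hx
    · exact (rank_mul_le_left _ _).trans hx

theorem IsAdmissible.isIdeal_rankIdeal {q : ℕ} (hq : q ≤ n) : IsIdeal (rankIdeal K q) :=
  hK.isIdeal_iff.2 ⟨⟨q, Nat.lt_succ_of_le hq⟩, rfl⟩

theorem IsAdmissible.mem_minimalIdeal {α : K} :
    α ∈ minimalIdeal K ↔ (α : PartitionMonoid n).rank = 0 := by
  constructor
  · intro h
    exact Nat.le_zero.1 (h _ (hK.isIdeal_rankIdeal (Nat.zero_le n)))
  · intro h I hI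
    obtain ⟨q, rfl⟩ := hK.isIdeal_iff.1 hI
    rw [mem_rankIdeal, h]
    exact Nat.zero_le _

/-- Maximal subgroups are trivial. -/
theorem IsAdmissible.eq_of_greenH {x e : K} (he : e * e = e) (h : GreenH x e) : x = e := by
  obtain ⟨a, ha⟩ := exists_of_greenR h.1
  obtain ⟨b, hb⟩ := exists_of_greenL h.2
  obtain ⟨c, hc⟩ := exists_of_greenR (show GreenR e x from Eq.symm h.1)
  have h1 : e * x = x := by rw [ha, ← mul_assoc, he]
  have h2 : x * e = x := by rw [hb, mul_assoc, he]
  have hr : (e : PartitionMonoid n).rank ≤ (x : PartitionMonoid n).rank := by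
    rw [show (e : PartitionMonoid n) = x * c from congrArg Subtype.val hc]
    exact rank_mul_le_left _ _
  apply Subtype.ext
  have k1 : (e * x : PartitionMonoid n) = x := congrArg Subtype.val h1
  have k2 : (x * e : PartitionMonoid n) = x := congrArg Subtype.val h2
  have k3 : (e * e : PartitionMonoid n) = e := congrArg Subtype.val he
  generalize hε : (e : PartitionMonoid n) = ε at *
  generalize hξ : (x : PartitionMonoid n) = ξ at *
  have hεK : ε ∈ K := hε ▸ e.2
  have hξK : ξ ∈ K := hξ ▸ x.2
  obtain ⟨s, t, hs, ht, hf⟩ := (hK.planar hεK).exists_frame le_rfl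
  -- An element fixed by `ε` on both sides is recovered from its compression along a maximal frame
  -- of `ε`. For `ξ` this compression has full rank, so by planarity it is the same partial identity
  -- as for `ε`.
  have key : ∀ γ : PartitionMonoid n, ε * γ = γ → γ * ε = γ →
      γ = (ε * star (pick t)) * compress γ s t * (pick s * ε) := by
    intro γ g1 g2
    have e1 := mul_pick_mul_eq hs ht hf
    calc γ = ε * γ * ε := by rw [g1, g2]
      _ = (ε * star (pick t) * (pick s * ε)) * γ * (ε * star (pick t) * (pick s * ε)) := by rw [e1]
      _ = (ε * star (pick t)) * (pick s * (ε * γ * ε) * star (pick t)) * (pick s * ε) := by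
        simp only [mul_assoc]
      _ = _ := by rw [g1, g2]; rfl
  have hf' : IsFrame ξ s t := by
    refine IsPlanar.isFrame_of_rank_compress hs ht (hK.planar (hK.compress_mem hs ht hξK))
      (hr.trans ?_)
    conv_lhs => rw [key ξ k1 k2]
    exact (rank_mul_le_left _ _).trans (rank_mul_le_right _ _)
  rw [key ξ k1 k2, compress_eq_idBar hs ht hf', ← compress_eq_idBar hs ht hf]
  exact (key ε k3 k3).symm

/-! ### Retractions -/

theorem IsAdmissible.exists_mem_minimalIdeal :
    ∃ x : K, x ∈ minimalIdeal K ∧ (x : PartitionMonoid n) = lowerPair 0 :=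
  ⟨⟨_, hK.lowerPair_mem 0⟩, hK.mem_minimalIdeal.2 (rank_lowerPair 0), rfl⟩

/-- Since `x` and `α * x` are in the minimal ideal, `f α * x = f α * f x = f (α * x) = α * x`;
dually on the other side. -/
theorem IsAdmissible.retraction_mul {q : ℕ} (hq : q ≤ n) {f : K → K}
    (hf : IsRetraction (rankIdeal K q) f) {α x : K} (hα : α ∈ rankIdeal K q)
    (hx : x ∈ minimalIdeal K) : f α * x = α * x ∧ x * f α = x * α := by
  have hxI : x ∈ rankIdeal K q := hx _ (hK.isIdeal_rankIdeal hq)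
  have hM := hK.isIdeal_rankIdeal (Nat.zero_le n)
  have hx0 : x ∈ rankIdeal K 0 := hx _ hM
  have hmem : ∀ y : K, y ∈ rankIdeal K 0 → f y = y := fun y hy =>
    hf.fixes y (hK.mem_minimalIdeal.2 (Nat.le_zero.1 hy))
  constructor
  · conv_lhs => rw [← hf.fixes x hx, ← hf.map_mul α hα x hxI]
    exact hmem _ (hM.2 x hx0 α).1
  · conv_lhs => rw [← hf.fixes x hx, ← hf.map_mul x hxI α hα]
    exact hmem _ (hM.2 x hx0 α).2

/-- `f α` and `α` act alike on the minimal ideal, and in rank at most 1 kernel and cokernel can be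
read off from that action. -/
theorem IsAdmissible.retraction_spec {q : ℕ} (hq : q ≤ n) (hq1 : q ≤ 1) {f : K → K}
    (hf : IsRetraction (rankIdeal K q) f) {α : K} (hα : α ∈ rankIdeal K q) :
    (f α : PartitionMonoid n).rank = 0 ∧
      (f α : PartitionMonoid n).ker = (α : PartitionMonoid n).ker ∧
      (f α : PartitionMonoid n).coker = (α : PartitionMonoid n).coker := by
  have h0 := hK.mem_minimalIdeal.1 (hf.maps α hα)
  have hα1 : (α : PartitionMonoid n).rank ≤ 1 := (mem_rankIdeal.1 hα).trans hq1
  obtain ⟨x, hx, -⟩ := hK.exists_mem_minimalIdeal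
  obtain ⟨h1, h2⟩ := hK.retraction_mul hq hf hα hx
  have k1 : (f α * x : PartitionMonoid n) = α * x := congrArg Subtype.val h1
  have k2 : (x * f α : PartitionMonoid n) = x * α := congrArg Subtype.val h2
  refine ⟨h0, ?_, ?_⟩
  · rw [← ker_mul_of_rank_le_one (β := x) (by omega), k1, ker_mul_of_rank_le_one hα1]
  · rw [← coker_mul_of_rank_le_one x (by omega), k2, coker_mul_of_rank_le_one _ hα1]

theorem IsAdmissible.isRetraction_flatten {q : ℕ} (hq1 : q ≤ 1) :
    IsRetraction (rankIdeal K q) fun α => ⟨flatten α, hK.flatten_mem α.2⟩ where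
  maps _ _ := hK.mem_minimalIdeal.2 (rank_flatten _)
  fixes x hx := Subtype.ext (ext_of_rank_eq_zero (rank_flatten _) (hK.mem_minimalIdeal.1 hx)
    (ker_flatten _) (coker_flatten _))
  map_mul x hx y hy := by
    have hx' := (mem_rankIdeal.1 hx).trans hq1
    have hy' := (mem_rankIdeal.1 hy).trans hq1
    refine eq_of_subtype_ker_coker (rank_flatten _) (rank_flatten _) (rank_flatten _) ?_ ?_
    · exact (ker_flatten _).trans ((ker_mul_of_rank_le_one hx' _).trans (ker_flatten _).symm)
    · exact (coker_flatten _).trans ((coker_mul_of_rank_le_one _ hy').trans (coker_flatten _).symm)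

/-- For `e = idBar n 2` the image `f e` has rank 0, so the kernel of `f e * x` does not depend on
`x`. But `f e * x = e * x` on the minimal ideal, and the kernel of `e * x` does depend on `x`. -/
theorem IsAdmissible.le_one_of_isRetraction (hn : 2 ≤ n) {q : ℕ} (hq : q ≤ n) {f : K → K}
    (hf : IsRetraction (rankIdeal K q) f) : q ≤ 1 := by
  by_contra hc
  let e : K := ⟨idBar n 2, hK.idBar_mem hn⟩
  have he : e ∈ rankIdeal K q := by
    rw [mem_rankIdeal, rank_idBar hn]; omega
  have h0 := hK.mem_minimalIdeal.1 (hf.maps e he)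
  have key : ∀ y, (f e : PartitionMonoid n).ker = (idBar n 2 * star (lowerPair y)).ker := by
    intro y
    have hm := hK.star_mem (hK.lowerPair_mem y)
    have h1 := (hK.retraction_mul hq hf he (x := ⟨_, hm⟩)
      (hK.mem_minimalIdeal.2 (by rw [rank_star, rank_lowerPair]))).1
    rw [← ker_mul_of_rank_le_one (β := star (lowerPair y)) (by omega)]
    exact congrArg (fun z : K => (z : PartitionMonoid n).ker) h1
  exact ker_idBar_mul_ne hn ((key _).symm.trans (key _))

/-! ### IN-pairs -/

theorem IsAdmissible.isNormalSubgroupAt_singleton {e : K} (he : e * e = e) :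
    IsNormalSubgroupAt e {e} where
  idem := he
  subset := by rintro x rfl; exact ⟨rfl, rfl⟩
  one_mem := rfl
  mul_mem := by rintro x rfl y rfl; exact he
  inv_mem := by rintro x rfl; exact ⟨x, rfl, he, he⟩
  conj_mem := by
    rintro x rfl g h hg hh _ _
    rw [hK.eq_of_greenH he hg, hK.eq_of_greenH he hh, he, he]
    rfl

theorem IsAdmissible.isRetractableINPair_iff (hn : 2 ≤ n) {I N : Set K} :
    IsRetractableINPair I N ↔ ∃ i : Fin 2, I = rankIdeal K i ∧
      ∃ ε : K, ε * ε = ε ∧ (ε : PartitionMonoid n).rank = i + 1 ∧ N = {ε} := by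
  constructor
  · rintro ⟨⟨hI, e, hN, -, -, heI, hmin⟩, ⟨f, hf⟩, -⟩
    obtain ⟨⟨q, hq⟩, rfl⟩ := hK.isIdeal_iff.1 hI
    have hqn : q ≤ n := Nat.lt_succ_iff.1 hq
    have hq1 := hK.le_one_of_isRetraction hn hqn hf
    simp only [mem_rankIdeal, not_le] at heI hmin
    refine ⟨⟨q, Nat.lt_succ_of_le hq1⟩, rfl, e, hN.idem, ?_, ?_⟩
    · have hle : q + 1 ≤ n := heI.trans_le (rank_le _)
      -- The partial identity of rank `q + 1` lies outside the ideal and below `e`, so minimality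
      -- forces equal ranks.
      have := hK.greenJ_iff.1 (hmin ⟨idBar n (q + 1), hK.idBar_mem hle⟩
        (by rw [rank_idBar hle]; omega) (hK.jle_iff.2 (by rw [rank_idBar hle]; omega)))
      rw [rank_idBar hle] at this
      exact this.symm
    · ext x
      exact ⟨fun hx => hK.eq_of_greenH hN.idem (hN.subset x hx), fun hx => hx ▸ hN.one_mem⟩
  · rintro ⟨i, rfl, ε, hε, hr, rfl⟩
    have hi : i.val ≤ 1 := by omega
    refine ⟨⟨hK.isIdeal_rankIdeal (by omega), ε, hK.isNormalSubgroupAt_singleton hε,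
      isStable_of_finite _, fun x _ => ?_, ?_, fun x hx hxe => ?_⟩,
      ⟨_, hK.isRetraction_flatten hi⟩, fun x _ => ⟨⟨x * ε, ?_⟩, ⟨ε * x, ?_⟩⟩⟩
    · obtain ⟨w, hw, h⟩ := hK.exists_eq_mul_mul x.2
      exact ⟨⟨w, hw⟩, Subtype.ext h⟩
    · rw [mem_rankIdeal]; omega
    · rw [hK.jle_iff] at hxe
      rw [mem_rankIdeal] at hx
      rw [hK.greenJ_iff]
      omega
    · ext z; simp
    · ext z; simp

theorem IsAdmissible.isRetractableINPair_trivialGroup (hn : 2 ≤ n) (i : Fin 2) :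
    IsRetractableINPair (rankIdeal K i) (trivialGroup K (i + 1)) := by
  have hle : i.val + 1 ≤ n := by omega
  refine (hK.isRetractableINPair_iff hn).2 ⟨i, rfl, ⟨idBar n (i + 1), hK.idBar_mem hle⟩,
    Subtype.ext (idBar_mul_self hle), rank_idBar hle, ?_⟩
  ext x
  exact ⟨fun h => Subtype.ext h, fun h => congrArg Subtype.val h⟩

end

end PartitionMonoid

namespace PartitionMonoid

open MonoidCong

variable {n : ℕ}

/-! ### The standard relations are congruences -/

theorem stdRel_refl (q : ℕ) (k c : Bool) (α : PartitionMonoid n) : stdRel q k c α α := Or.inl rfl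

theorem stdRel.symm {q : ℕ} {k c : Bool} {α β : PartitionMonoid n} (h : stdRel q k c α β) :
    stdRel q k c β α := by
  rcases h with rfl | ⟨h1, h2, h3, h4⟩
  · exact Or.inl rfl
  · exact Or.inr ⟨h2, h1, fun h => (h3 h).symm, fun h => (h4 h).symm⟩

theorem stdRel.trans {q : ℕ} {k c : Bool} {α β γ : PartitionMonoid n} (h : stdRel q k c α β)
    (h' : stdRel q k c β γ) : stdRel q k c α γ := by
  rcases h with rfl | ⟨h1, h2, h3, h4⟩
  · exact h'
  rcases h' with rfl | ⟨k1, k2, k3, k4⟩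
  · exact Or.inr ⟨h1, h2, h3, h4⟩
  · exact Or.inr ⟨h1, k2, fun h => (h3 h).trans (k3 h), fun h => (h4 h).trans (k4 h)⟩

theorem stdRel.star {q : ℕ} {k c : Bool} {α β : PartitionMonoid n} (h : stdRel q k c α β) :
    stdRel q c k (star α) (star β) := by
  rcases h with rfl | ⟨h1, h2, h3, h4⟩
  · exact Or.inl rfl
  · exact Or.inr ⟨by rwa [rank_star], by rwa [rank_star], h4, h3⟩

/-- Only a condition on kernels or cokernels needs an argument, and then `q ≤ 1`. Kernels do not
feel the right factor. For cokernels, left multiplication by `flatten α` changes no cokernel, but it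
makes `α` and `β` equal when their cokernels agree. -/
theorem stdRel.mul_right {q : ℕ} {k c : Bool} (hq : q ≤ 1 ∨ (k = true ∧ c = true))
    {α β : PartitionMonoid n} (h : stdRel q k c α β) (γ : PartitionMonoid n) :
    stdRel q k c (α * γ) (β * γ) := by
  rcases h with rfl | ⟨h1, h2, h3, h4⟩
  · exact Or.inl rfl
  have hαγ := (rank_mul_le_left α γ).trans h1
  have hβγ := (rank_mul_le_left β γ).trans h2
  refine Or.inr ⟨hαγ, hβγ, fun hk => ?_, fun hc => ?_⟩
  · have hq1 : q ≤ 1 := hq.resolve_right fun h => by simp [h.1] at hk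
    rw [ker_mul_of_rank_le_one (h1.trans hq1), ker_mul_of_rank_le_one (h2.trans hq1), h3 hk]
  · have hq1 : q ≤ 1 := hq.resolve_right fun h => by simp [h.2] at hc
    have hf := rank_flatten α
    have e : flatten α * α = flatten α * β := by
      refine eq_of_ker_coker (rank_mul_eq_zero_left hf β) (by omega) (h1.trans hq1)
        (rank_mul_eq_zero_left hf α) (ker_mul_of_rank_le_one (by omega) _) ?_
      rw [coker_mul_of_rank_le_one _ (h2.trans hq1), h4 hc]
    rw [← coker_mul_of_rank_le_one (flatten α) (hαγ.trans hq1),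
      ← coker_mul_of_rank_le_one (flatten α) (hβγ.trans hq1), ← mul_assoc, e, mul_assoc]

theorem stdRel.mul_left {q : ℕ} {k c : Bool} (hq : q ≤ 1 ∨ (k = true ∧ c = true))
    {α β : PartitionMonoid n} (h : stdRel q k c α β) (γ : PartitionMonoid n) :
    stdRel q k c (γ * α) (γ * β) := by
  have := (h.star.mul_right (hq.imp_right And.symm) (Star.star γ)).star
  simpa only [star_mul', star_star'] using this

end PartitionMonoid

namespace CongLabel

open MonoidCong

variable {n : ℕ}

/-! ### The lattice of labels -/

/-- The largest rank of an element of a non-trivial class. -/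
def lvl : CongLabel n → ℕ
  | R q => q
  | lam i => i
  | rho i => i
  | mu i => i

/-- Whether elements with different kernels are related. -/
def kd : CongLabel n → Bool
  | R _ => true
  | lam _ => true
  | rho _ => false
  | mu _ => false

/-- Whether elements with different cokernels are related. -/
def cd : CongLabel n → Bool
  | R _ => true
  | lam _ => false
  | rho _ => true
  | mu _ => false

/-- The inclusion order of the relations with the given names. -/
def Le (k l : CongLabel n) : Prop :=
  k.lvl ≤ l.lvl ∧ (k.kd = true → l.kd = true) ∧ (k.cd = true → l.cd = true)

theorem lvl_le_one_or (l : CongLabel n) : l.lvl ≤ 1 ∨ (l.kd = true ∧ l.cd = true) := by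
  cases l with
  | R q => exact Or.inr ⟨rfl, rfl⟩
  | lam i => exact Or.inl (Nat.lt_succ_iff.1 i.isLt)
  | rho i => exact Or.inl (Nat.lt_succ_iff.1 i.isLt)
  | mu i => exact Or.inl (Nat.lt_succ_iff.1 i.isLt)

theorem lvl_le (hn : 2 ≤ n) (l : CongLabel n) : l.lvl ≤ n := by
  cases l with
  | R q => exact Nat.lt_succ_iff.1 q.isLt
  | lam i => exact i.isLt.le.trans hn
  | rho i => exact i.isLt.le.trans hn
  | mu i => exact i.isLt.le.trans hn

theorem Le.antisymm {k l : CongLabel n} (h : k.Le l) (h' : l.Le k) : k = l := by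
  obtain ⟨h1, h2, h3⟩ := h
  obtain ⟨k1, k2, k3⟩ := h'
  have e := le_antisymm h1 k1
  cases k <;> cases l <;> simp [kd, cd] at h2 h3 k2 k3 <;> congr 1 <;> exact Fin.ext e

theorem exists_label {q : ℕ} {k c : Bool} (hqn : q ≤ n)
    (hq : q ≤ 1 ∨ (k = true ∧ c = true)) :
    ∃ l : CongLabel n, l.lvl = q ∧ l.kd = k ∧ l.cd = c := by
  cases k <;> cases c <;> simp only [reduceCtorEq, and_false, false_and, or_false] at hq
  · exact ⟨mu ⟨q, by omega⟩, rfl, rfl, rfl⟩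
  · exact ⟨rho ⟨q, by omega⟩, rfl, rfl, rfl⟩
  · exact ⟨lam ⟨q, by omega⟩, rfl, rfl, rfl⟩
  · exact ⟨R ⟨q, by omega⟩, rfl, rfl, rfl⟩

theorem Hasse.le {k l : CongLabel n} (h : Hasse k l) : k.Le l ∧ ¬ l.Le k := by
  cases h <;> simp_all [Le, lvl, kd, cd]

theorem StarHasse.le {k l : CongLabel n} (h : StarHasse k l) : k.Le l ∧ ¬ l.Le k := by
  cases h <;> simp_all [Le, lvl, kd, cd]

/-- Nothing lies strictly between the ends of an edge of the Hasse diagram. -/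
theorem Hasse.eq_or_eq {k l m : CongLabel n} (h : Hasse k l) (h1 : k.Le m) (h2 : m.Le l) :
    m.Le k ∨ l.Le m := by
  obtain ⟨h1, h3, h4⟩ := h1
  obtain ⟨h2, h5, h6⟩ := h2
  cases h <;> cases m <;> simp_all [Le, lvl, kd, cd] <;> omega

theorem StarHasse.eq_or_eq {k l m : CongLabel n} (h : StarHasse k l) (hm : m.IsStarLabel)
    (h1 : k.Le m) (h2 : m.Le l) : m.Le k ∨ l.Le m := by
  obtain ⟨h1, h3, h4⟩ := h1
  obtain ⟨h2, h5, h6⟩ := h2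
  cases h <;> cases m <;> simp_all [Le, lvl, kd, cd, IsStarLabel] <;> omega

/-- With `Hasse.eq_or_eq` this identifies the edges with the covering pairs: a covering pair must be
the edge found here. -/
theorem exists_hasse (hn : 2 ≤ n) {k l : CongLabel n} (h : k.Le l) (h' : ¬ l.Le k) :
    ∃ m, Hasse k m ∧ m.Le l := by
  obtain ⟨h1, h2, h3⟩ := h
  have hl := l.lvl_le hn
  have h01 : ∀ i : Fin 2, i = 0 ∨ i = 1 := by decide
  cases k with
  | R q =>
    cases l with
    | R r =>
      have : q.val < r.val := by
        by_contra hc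
        exact h' ⟨not_lt.1 hc, fun _ => rfl, fun _ => rfl⟩
      exact ⟨R ⟨q + 1, by omega⟩, .R_R _ _ rfl, this, fun _ => rfl, fun _ => rfl⟩
    | lam j => exact absurd (h3 rfl) (by simp [cd])
    | rho j => exact absurd (h2 rfl) (by simp [kd])
    | mu j => exact absurd (h2 rfl) (by simp [kd])
  | lam i =>
    cases l with
    | R r => exact ⟨R ⟨i, by omega⟩, .lam_R _ _ rfl, h1, fun _ => rfl, fun _ => rfl⟩
    | lam j =>
      rcases h01 i with rfl | rfl <;> rcases h01 j with rfl | rfl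
      · simp [Le] at h'
      · exact ⟨lam 1, .lam_lam, le_rfl, id, id⟩
      · simp [lvl] at h1
      · simp [Le] at h'
    | rho j => exact absurd (h2 rfl) (by simp [kd])
    | mu j => exact absurd (h2 rfl) (by simp [kd])
  | rho i =>
    cases l with
    | R r => exact ⟨R ⟨i, by omega⟩, .rho_R _ _ rfl, h1, fun _ => rfl, fun _ => rfl⟩
    | rho j =>
      rcases h01 i with rfl | rfl <;> rcases h01 j with rfl | rfl
      · simp [Le] at h'
      · exact ⟨rho 1, .rho_rho, le_rfl, id, id⟩
      · simp [lvl] at h1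
      · simp [Le] at h'
    | lam j => exact absurd (h3 rfl) (by simp [cd])
    | mu j => exact absurd (h3 rfl) (by simp [cd])
  | mu i =>
    cases l with
    | R r => exact ⟨lam i, .mu_lam i, h1, fun _ => rfl, fun _ => rfl⟩
    | lam j => exact ⟨lam i, .mu_lam i, h1, id, id⟩
    | rho j => exact ⟨rho i, .mu_rho i, h1, id, id⟩
    | mu j =>
      rcases h01 i with rfl | rfl <;> rcases h01 j with rfl | rfl
      · simp [Le] at h'
      · exact ⟨mu 1, .mu_mu, le_rfl, id, id⟩
      · simp [lvl] at h1
      · simp [Le] at h'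

theorem exists_starHasse (hn : 2 ≤ n) {k l : CongLabel n} (hk : k.IsStarLabel) (hl : l.IsStarLabel)
    (h : k.Le l) (h' : ¬ l.Le k) : ∃ m, m.IsStarLabel ∧ StarHasse k m ∧ m.Le l := by
  obtain ⟨h1, h2, h3⟩ := h
  have hln := l.lvl_le hn
  have h01 : ∀ i : Fin 2, i = 0 ∨ i = 1 := by decide
  cases k with
  | R q =>
    cases l with
    | R r =>
      have : q.val < r.val := by
        by_contra hc
        exact h' ⟨not_lt.1 hc, fun _ => rfl, fun _ => rfl⟩
      exact ⟨R ⟨q + 1, by omega⟩, trivial, .R_R _ _ rfl, this, fun _ => rfl, fun _ => rfl⟩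
    | lam j => exact absurd hl id
    | rho j => exact absurd hl id
    | mu j => exact absurd (h2 rfl) (by simp [kd])
  | lam i => exact absurd hk id
  | rho i => exact absurd hk id
  | mu i =>
    cases l with
    | R r => exact ⟨R ⟨i, by omega⟩, trivial, .mu_R _ _ rfl, h1, fun _ => rfl, fun _ => rfl⟩
    | lam j => exact absurd hl id
    | rho j => exact absurd hl id
    | mu j =>
      rcases h01 i with rfl | rfl <;> rcases h01 j with rfl | rfl
      · simp [Le] at h'
      · exact ⟨mu 1, trivial, .mu_mu, le_rfl, id, id⟩
      · simp [lvl] at h1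
      · simp [Le] at h'

/-! ### From labels to congruences -/

/-- The congruence with a given name. -/
def toCon (K : Submonoid (PartitionMonoid n)) (l : CongLabel n) : Con K where
  r α β := stdRel l.lvl l.kd l.cd (α : PartitionMonoid n) β
  iseqv := ⟨fun _ => stdRel_refl _ _ _ _, stdRel.symm, stdRel.trans⟩
  mul' h h' := (h.mul_right l.lvl_le_one_or _).trans (h'.mul_left l.lvl_le_one_or _)

theorem toCon_iff {K : Submonoid (PartitionMonoid n)} {l : CongLabel n} {α β : K} :
    l.toCon K α β ↔ stdRel l.lvl l.kd l.cd (α : PartitionMonoid n) β := Iff.rfl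

variable [NeZero n]

theorem coker_lowerPair_ite_eq_iff (hn : 2 ≤ n) {b : Bool} {s : Setoid (Fin n)}
    (hs : ∀ i j, s i j ↔ i = j) :
    s = (lowerPair (if b = true then (⟨1, hn⟩ : Fin n) else 0)).coker ↔ b = false := by
  constructor
  · intro h
    by_contra hb
    rw [Bool.not_eq_false] at hb
    subst hb
    have := (hs 0 ⟨1, hn⟩).1 (by rw [h]; exact lowerPair_coker.2 (Or.inr (Or.inl ⟨rfl, by simp⟩)))
    simp [Fin.ext_iff] at this
  · rintro rfl
    ext i j
    rw [hs, lowerPair_coker]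
    simp only [Bool.false_eq_true, if_false]
    grind

variable {K : Submonoid (PartitionMonoid n)} (hK : IsAdmissible K)
include hK

/-- As the subgroup is a singleton, `nuRel` contributes only diagonal pairs. Every retraction
preserves kernels and cokernels, so the condition on the images is one on the elements themselves;
`flatten` provides the retraction needed for the converse. -/
theorem zetaRel_iff {i : ℕ} (hi : i ≤ 1) (hin : i ≤ n) {ξ : K → K → Prop} {k c : Bool}
    (hξ : ∀ α β : K, (α : PartitionMonoid n).rank = 0 → (β : PartitionMonoid n).rank = 0 →
      (ξ α β ↔ (k = false → (α : PartitionMonoid n).ker = (β : PartitionMonoid n).ker) ∧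
        (c = false → (α : PartitionMonoid n).coker = (β : PartitionMonoid n).coker))) {α β : K} :
    zetaRel (rankIdeal K i) (trivialGroup K (i + 1)) ξ α β ↔
      stdRel i k c (α : PartitionMonoid n) β := by
  constructor
  · rintro (rfl | ⟨x, hx, y, hy, s, t, rfl, rfl, -, -⟩ | ⟨hα, hβ, f, hf, h⟩)
    · exact Or.inl rfl
    · have : x = y := Subtype.ext (Eq.trans hx hy.symm)
      rw [this]
      exact Or.inl rfl
    · obtain ⟨a1, a2, a3⟩ := hK.retraction_spec hin hi hf hα
      obtain ⟨b1, b2, b3⟩ := hK.retraction_spec hin hi hf hβ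
      rw [hξ _ _ a1 b1, a2, a3, b2, b3] at h
      exact Or.inr ⟨hα, hβ, h⟩
  · rintro (h | ⟨h1, h2, h3⟩)
    · exact Or.inl (Subtype.ext h)
    · refine Or.inr (Or.inr ⟨h1, h2, _, hK.isRetraction_flatten hi, ?_⟩)
      refine (hξ ⟨flatten α, hK.flatten_mem α.2⟩ ⟨flatten β, hK.flatten_mem β.2⟩
        (rank_flatten _) (rank_flatten _)).2 ⟨fun h => ?_, fun h => ?_⟩
      · exact (ker_flatten _).trans ((h3.1 h).trans (ker_flatten _).symm)
      · exact (coker_flatten _).trans ((h3.2 h).trans (coker_flatten _).symm)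

theorem toCon_iff_toRel (hn : 2 ≤ n) {l : CongLabel n} {α β : K} :
    l.toCon K α β ↔ l.toRel K α β := by
  rw [toCon_iff]
  cases l with
  | R q =>
    constructor
    · rintro (h | ⟨h1, h2, _⟩)
      · exact Or.inl (Subtype.ext h)
      · exact Or.inr ⟨h1, h2⟩
    · rintro (rfl | ⟨h1, h2⟩)
      · exact Or.inl rfl
      · exact Or.inr ⟨h1, h2, fun h => by simp [kd] at h, fun h => by simp [cd] at h⟩
  | lam i =>
    refine (zetaRel_iff hK (Nat.lt_succ_iff.1 i.isLt) (i.isLt.le.trans hn) fun α β h h' => ?_).symm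
    simp [greenL_iff_of_rank_eq_zero h h', kd, cd]
  | rho i =>
    refine (zetaRel_iff hK (Nat.lt_succ_iff.1 i.isLt) (i.isLt.le.trans hn) fun α β h h' => ?_).symm
    simp [greenR_iff_of_rank_eq_zero h h', kd, cd]
  | mu i =>
    refine (zetaRel_iff hK (Nat.lt_succ_iff.1 i.isLt) (i.isLt.le.trans hn) fun α β h h' => ?_).symm
    simp [GreenH, greenR_iff_of_rank_eq_zero h h', greenL_iff_of_rank_eq_zero h h', kd, cd]

theorem exists_toCon_eq (hn : 2 ≤ n) (σ : Con K) : ∃ l : CongLabel n, l.toCon K = σ := by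
  have hT : IsCongOn K fun α β => ∃ (hα : α ∈ K) (hβ : β ∈ K), σ ⟨α, hα⟩ ⟨β, hβ⟩ :=
    { mem_left := fun ⟨h, _, _⟩ => h
      refl := fun h => ⟨h, h, σ.refl _⟩
      symm := fun ⟨h, h', k⟩ => ⟨h', h, σ.symm k⟩
      trans := fun ⟨h, _, k⟩ ⟨_, h', k'⟩ => ⟨h, h', σ.trans k k'⟩
      mul_left := fun hγ ⟨h, h', k⟩ =>
        ⟨K.mul_mem hγ h, K.mul_mem hγ h', σ.mul (σ.refl ⟨_, hγ⟩) k⟩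
      mul_right := fun hγ ⟨h, h', k⟩ =>
        ⟨K.mul_mem h hγ, K.mul_mem h' hγ, σ.mul k (σ.refl ⟨_, hγ⟩)⟩ }
  obtain ⟨q, k, c, h1, h2, h3⟩ := hT.exists_stdRel hK hn
  obtain ⟨l, rfl, rfl, rfl⟩ := exists_label h1 h2
  refine ⟨l, Con.ext fun α β => ?_⟩
  rw [toCon_iff, ← h3 α α.2 β β.2]
  exact ⟨fun ⟨_, _, h⟩ => h, fun h => ⟨α.2, β.2, h⟩⟩

/-! ### Generating pairs and the inclusion order -/

/-- The upper end of a pair that generates the congruence with the name `l`. -/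
def genLeft (hn : 2 ≤ n) (l : CongLabel n) : K := ⟨idBar n l.lvl, hK.idBar_mem (l.lvl_le hn)⟩

/-- The lower end of a pair that generates the congruence with the name `l`. -/
def genRight (hn : 2 ≤ n) (l : CongLabel n) : K :=
  ⟨star (lowerPair (if l.kd then ⟨1, hn⟩ else 0)) * lowerPair (if l.cd then ⟨1, hn⟩ else 0),
    K.mul_mem (hK.star_mem (hK.lowerPair_mem _)) (hK.lowerPair_mem _)⟩

theorem rank_genRight (hn : 2 ≤ n) (l : CongLabel n) :
    (genRight hK hn l : PartitionMonoid n).rank = 0 :=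
  rank_mul_eq_zero_right _ (rank_lowerPair _)

theorem ker_gen_eq_iff (hn : 2 ≤ n) (l : CongLabel n) :
    (genLeft hK hn l : PartitionMonoid n).ker = (genRight hK hn l : PartitionMonoid n).ker ↔
      l.kd = false := by
  have : (genRight hK hn l : PartitionMonoid n).ker =
      (lowerPair (if l.kd then (⟨1, hn⟩ : Fin n) else 0)).coker := by
    rw [← ker_star]
    exact ker_mul_of_rank_le_one (by rw [rank_star, rank_lowerPair]; omega) _
  rw [this]
  exact coker_lowerPair_ite_eq_iff hn fun i j => idBar_inl_inl

theorem coker_gen_eq_iff (hn : 2 ≤ n) (l : CongLabel n) :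
    (genLeft hK hn l : PartitionMonoid n).coker = (genRight hK hn l : PartitionMonoid n).coker ↔
      l.cd = false := by
  have : (genRight hK hn l : PartitionMonoid n).coker =
      (lowerPair (if l.cd then (⟨1, hn⟩ : Fin n) else 0)).coker :=
    coker_mul_of_rank_le_one _ (by rw [rank_lowerPair]; omega)
  rw [this]
  exact coker_lowerPair_ite_eq_iff hn fun i j => idBar_inr_inr

/-- The rank of the left end and the agreement or disagreement of the kernels and of the cokernels
encode the three data of `k`, so membership tests them one by one. If the two ends coincide, all
three data of `k` are least possible. -/
theorem toCon_gen_iff (hn : 2 ≤ n) {k l : CongLabel n} :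
    l.toCon K (genLeft hK hn k) (genRight hK hn k) ↔ k.Le l := by
  have hr : (genLeft hK hn k : PartitionMonoid n).rank = k.lvl := rank_idBar (k.lvl_le hn)
  have hr' := rank_genRight hK hn k
  rw [toCon_iff]
  constructor
  · rintro (h | ⟨h1, _, h3, h4⟩)
    · have hk := (ker_gen_eq_iff hK hn k).1 (by rw [h])
      have hc := (coker_gen_eq_iff hK hn k).1 (by rw [h])
      rw [h, hr'] at hr
      exact ⟨by omega, fun h => by simp [hk] at h, fun h => by simp [hc] at h⟩
    · rw [ker_gen_eq_iff] at h3
      rw [coker_gen_eq_iff] at h4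
      refine ⟨hr ▸ h1, fun h => ?_, fun h => ?_⟩
      · by_contra hc
        simp [h3 (by simpa using hc)] at h
      · by_contra hc
        simp [h4 (by simpa using hc)] at h
  · rintro ⟨h1, h2, h3⟩
    refine Or.inr ⟨hr.trans_le h1, by omega, fun h => ?_, fun h => ?_⟩
    · rw [ker_gen_eq_iff]
      by_contra hc
      simp [h2 (by simpa using hc)] at h
    · rw [coker_gen_eq_iff]
      by_contra hc
      simp [h3 (by simpa using hc)] at h

theorem toCon_le_iff (hn : 2 ≤ n) {k l : CongLabel n} : k.toCon K ≤ l.toCon K ↔ k.Le l := by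
  constructor
  · intro h
    exact (toCon_gen_iff hK hn).1 (h ((toCon_gen_iff hK hn).2 ⟨le_rfl, id, id⟩))
  · rintro ⟨h1, h2, h3⟩ α β h
    rw [toCon_iff] at h ⊢
    rcases h with h | ⟨k1, k2, k3, k4⟩
    · exact Or.inl h
    · refine Or.inr ⟨k1.trans h1, k2.trans h1, fun h => k3 ?_, fun h => k4 ?_⟩
      · by_contra hc
        simp [h2 (by simpa using hc)] at h
      · by_contra hc
        simp [h3 (by simpa using hc)] at h

/-- By the classification the generated congruence has a label, and since it contains the pair this
label dominates `l`. -/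
theorem toCon_eq_conGen (hn : 2 ≤ n) (l : CongLabel n) :
    l.toCon K = conGen fun x y => x = genLeft hK hn l ∧ y = genRight hK hn l := by
  refine le_antisymm ?_ (Con.conGen_le.2 ?_)
  · obtain ⟨m, hm⟩ := exists_toCon_eq hK hn
      (conGen fun x y => x = genLeft hK hn l ∧ y = genRight hK hn l)
    rw [← hm, toCon_le_iff hK hn, ← toCon_gen_iff hK hn, hm]
    exact ConGen.Rel.of _ _ ⟨rfl, rfl⟩
  · rintro x y ⟨rfl, rfl⟩
    exact (toCon_gen_iff hK hn).2 ⟨le_rfl, id, id⟩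

/-- The involution exchanges kernels and cokernels, hence the two Booleans of a label; the
generating pair detects whether they differ. -/
theorem isStarCon_toCon_iff (hn : 2 ≤ n) (hs : ∀ α ∈ K, star α ∈ K) (l : CongLabel n) :
    IsStarCon K hs (l.toCon K) ↔ l.IsStarLabel := by
  have key : l.IsStarLabel ↔ l.kd = l.cd := by cases l <;> simp [IsStarLabel, kd, cd]
  rw [key]
  constructor
  · intro h
    rcases h _ _ ((toCon_gen_iff hK hn).2 (⟨le_rfl, id, id⟩ : l.Le l)) with h1 | ⟨-, -, h3, h4⟩
    · have h2 := star_injective' h1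
      rw [(ker_gen_eq_iff hK hn l).1 (by rw [h2]), (coker_gen_eq_iff hK hn l).1 (by rw [h2])]
    · have h3' := fun h => (coker_gen_eq_iff hK hn l).1 (h3 h)
      have h4' := fun h => (ker_gen_eq_iff hK hn l).1 (h4 h)
      revert h3' h4'
      cases l.kd <;> cases l.cd <;> simp
  · intro e α β h
    have := stdRel.star (toCon_iff.1 h)
    rw [toCon_iff]
    rw [e] at this ⊢
    exact this

end CongLabel

/-! ### Covering relations and the final statement -/

namespace CongLabel

variable {n : ℕ} [NeZero n] {K : Submonoid (PartitionMonoid n)} (hK : IsAdmissible K)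
include hK

/-- The classification as a bijection between names and congruences. -/
noncomputable def equivCon (hn : 2 ≤ n) : CongLabel n ≃ Con K :=
  Equiv.ofBijective (toCon K) ⟨fun _ _ h => ((toCon_le_iff hK hn).1 h.le).antisymm
    ((toCon_le_iff hK hn).1 h.ge), exists_toCon_eq hK hn⟩

theorem toCon_lt_iff (hn : 2 ≤ n) {k l : CongLabel n} :
    k.toCon K < l.toCon K ↔ k.Le l ∧ ¬ l.Le k := by
  rw [lt_iff_le_not_ge, toCon_le_iff hK hn, toCon_le_iff hK hn]

theorem toCon_covBy_iff (hn : 2 ≤ n) {k l : CongLabel n} :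
    k.toCon K ⋖ l.toCon K ↔ Hasse k l := by
  constructor
  · rintro ⟨h, hc⟩
    obtain ⟨h1, h2⟩ := (toCon_lt_iff hK hn).1 h
    obtain ⟨m, hm, hml⟩ := exists_hasse hn h1 h2
    by_cases hlm : l.Le m
    · rwa [hlm.antisymm hml]
    · exact absurd ((toCon_lt_iff hK hn).2 ⟨hml, hlm⟩) (hc ((toCon_lt_iff hK hn).2 hm.le))
  · intro h
    refine ⟨(toCon_lt_iff hK hn).2 h.le, fun σ h1 h2 => ?_⟩
    obtain ⟨m, rfl⟩ := exists_toCon_eq hK hn σ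
    rw [toCon_lt_iff hK hn] at h1 h2
    exact (h.eq_or_eq h1.1 h2.1).elim h1.2 h2.2

theorem starCon_covBy_iff (hn : 2 ≤ n) (hs : ∀ α ∈ K, star α ∈ K)
    (c d : {c : Con K // IsStarCon K hs c}) :
    c ⋖ d ↔ ∃ k l : CongLabel n, c.1 = k.toCon K ∧ d.1 = l.toCon K ∧ StarHasse k l := by
  have hstar := fun m : CongLabel n => isStarCon_toCon_iff hK hn hs m
  have hlt : ∀ {k l : CongLabel n} (hk : IsStarCon K hs (k.toCon K))
      (hl : IsStarCon K hs (l.toCon K)),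
      (⟨_, hk⟩ : {c : Con K // IsStarCon K hs c}) < ⟨_, hl⟩ ↔ k.Le l ∧ ¬ l.Le k :=
    fun _ _ => (Subtype.mk_lt_mk).trans (toCon_lt_iff hK hn)
  obtain ⟨c, hc⟩ := c
  obtain ⟨d, hd⟩ := d
  obtain ⟨k, rfl⟩ := exists_toCon_eq hK hn c
  obtain ⟨l, rfl⟩ := exists_toCon_eq hK hn d
  constructor
  · rintro ⟨h, hcov⟩
    obtain ⟨h1, h2⟩ := (hlt _ _).1 h
    obtain ⟨m, hm1, hm, hml⟩ := exists_starHasse hn ((hstar k).1 hc) ((hstar l).1 hd) h1 h2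
    by_cases hlm : l.Le m
    · exact ⟨k, l, rfl, rfl, by rwa [hlm.antisymm hml]⟩
    · exact absurd ((hlt ((hstar m).2 hm1) _).2 ⟨hml, hlm⟩) (hcov ((hlt _ _).2 hm.le))
  · rintro ⟨k', l', hk, hl, h⟩
    obtain rfl := (equivCon hK hn).injective hk
    obtain rfl := (equivCon hK hn).injective hl
    refine ⟨(hlt _ _).2 h.le, ?_⟩
    rintro ⟨σ, hσ⟩ h1 h2
    obtain ⟨m, rfl⟩ := exists_toCon_eq hK hn σ
    rw [hlt] at h1 h2
    exact (h.eq_or_eq ((hstar m).1 hσ) h1.1 h2.1).elim h1.2 h2.2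

end CongLabel

theorem theorem6 (n : ℕ) (hn : 2 ≤ n) (K : Submonoid (PartitionMonoid n))
    (hK : K = planarPartitionMonoid n ∨ K = motzkinMonoid n) :
    -- the ideals
    (∀ I : Set K, MonoidCong.IsIdeal I ↔ ∃ q : Fin (n + 1), I = rankIdeal K q) ∧
    -- the retractable IN-pairs, for all choices of the (trivial) maximal subgroups, and in
    -- particular for the distinguished ones
    (∀ I N : Set K, MonoidCong.IsRetractableINPair I N ↔
      ∃ i : Fin 2, I = rankIdeal K i ∧
        ∃ ε : K, ε * ε = ε ∧ (ε : PartitionMonoid n).rank = i + 1 ∧ N = {ε}) ∧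
    (∀ i : Fin 2, MonoidCong.IsRetractableINPair (rankIdeal K i) (trivialGroup K (i + 1))) ∧
    -- the retractions
    (∀ (i : Fin 2) (f : K → K), MonoidCong.IsRetraction (rankIdeal K i) f →
      ∀ α ∈ rankIdeal K i, (f α : PartitionMonoid n).rank = 0 ∧
        (f α : PartitionMonoid n).ker = (α : PartitionMonoid n).ker ∧
        (f α : PartitionMonoid n).coker = (α : PartitionMonoid n).coker) ∧
    -- the listed relations are congruences, they are distinct, and they are all the congruences
    ∃ e : CongLabel n ≃ Con K,
      (∀ (l : CongLabel n) (α β : K), e l α β ↔ l.toRel K α β) ∧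
      -- the Hasse diagram of the congruence lattice; all congruences are principal
      e (.R (Fin.last n)) = ⊤ ∧ e (.mu 0) = ⊥ ∧
      (∀ k l : CongLabel n, e k ⋖ e l ↔ CongLabel.Hasse k l) ∧
      (∀ c : Con K, ∃ α β : K, c = conGen fun x y => x = α ∧ y = β) ∧
      -- the `*`-congruences and the Hasse diagram of their lattice
      (∀ l : CongLabel n, IsStarCon K (star_mem hK) (e l) ↔ l.IsStarLabel) ∧
      (∀ c d : {c : Con K // IsStarCon K (star_mem hK) c},
        c ⋖ d ↔ ∃ k l : CongLabel n, c.1 = e k ∧ d.1 = e l ∧ CongLabel.StarHasse k l) := by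
  have hA := isAdmissible hK
  have : NeZero n := ⟨by omega⟩
  refine ⟨fun I => hA.isIdeal_iff, fun I N => hA.isRetractableINPair_iff hn,
    hA.isRetractableINPair_trivialGroup hn,
    fun i f hf α hα => hA.retraction_spec (by omega) (by omega) hf hα,
    CongLabel.equivCon hA hn, fun l α β => CongLabel.toCon_iff_toRel hA hn, ?_, ?_,
    fun k l => CongLabel.toCon_covBy_iff hA hn, fun c => ?_,
    CongLabel.isStarCon_toCon_iff hA hn _, CongLabel.starCon_covBy_iff hA hn _⟩
  · refine eq_top_iff.2 fun α β _ => Or.inr ⟨rank_le _, rank_le _, ?_, ?_⟩ <;>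
      simp [CongLabel.kd, CongLabel.cd]
  · refine eq_bot_iff.2 fun α β h => ?_
    rcases h with h | ⟨h1, h2, h3, h4⟩
    · exact Subtype.ext h
    · exact Subtype.ext (ext_of_rank_eq_zero (Nat.le_zero.1 h1) (Nat.le_zero.1 h2)
        (h3 rfl) (h4 rfl))
  · obtain ⟨l, rfl⟩ := CongLabel.exists_toCon_eq hA hn c
    exact ⟨_, _, CongLabel.toCon_eq_conGen hA hn l⟩
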